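/- Let $(\mathcal M,g)$ be a stably causal smooth spacetime: a connected, Hausdorff, second countable smooth manifold of dimension $d\ge 2$ with a smooth time-oriented Lorentzian metric such that, for some continuous future-directed timelike vector field $T$, the metric $g-T^\flat\otimes T^\flat$ admits no closed timelike curve. Assume that $(\mathcal M,g)$ is future null geodesically complete, i.e. every future-directed null geodesic extends to arbitrarily large values of its affine parameter. Terminology. A future-infinite causal worldline $W$ is (the image of) a piecewise $C^1$ future-directed causal curve that is infinite towards the future in generalized affine parameter: the integral of the Euclidean length of the components of its velocity in a parallel frame along it diverges towards the future. A null geodesic is future-infinite if its affine parameter is unbounded above. The causal horizon of $W$ is the topological boundary $\partial I^-(W)$ of the chronological past of $W$. The edge of an achronal set $A$ is the set of $p\in\mathrm{cl}(A)$ such that every open neighbourhood $O$ of $p$ contains some $q\in I^+(p,O)$, some $r\in I^-(p,O)$ and a timelike curve in $O$ from $r$ to $q$ that misses $A$. A slice is a closed achronal set with empty edge, and a hypersurface is a relatively open subset of a slice. An exterior of $\partial I^-(W)$ is a hypersurface $a\subseteq \mathrm{cl}(I^-(W))$ with $\mathrm{edge}(a)\subseteq\partial I^-(W)$. Two sets are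 Cauchy comparable if both are contained in some open set $N\subseteq\mathcal M$ that is globally hyperbolic as a spacetime of its own (it has a Cauchy surface; $N$ need not be connected). $D(a)$ denotes the domain of dependence of $a$ (with respect to inextendible causal curves). The generalized entropy $S_{\mathrm{gen}}$ enters only as a real-valued function on some class of sets; what follows holds for every such function, and $a,b$ below range over the sets on which it is defined. Generalized second law (GSL): let $W$ be a future-infinite causal worldline and let $a,b$ be Cauchy comparable exteriors of $\partial I^-(W)$ with $D(a)\subseteq D(b)$; suppose in addition that (*) through every point of $\mathrm{edge}(b)\setminus\mathrm{edge}(a)$ there passes a future-infinite null geodesic $\gamma\subseteq\partial I^-(W)$. Then $S_{\mathrm{gen}}(a)-S_{\mathrm{gen}}(b)\ge 0$. Claims. 1. For every future-infinite causal worldline $W$ and every $p\in\partial I^-(W)$ there is a future-infinite null geodesic $\gamma\subseteq\partial I^-(W)$ passing through $p$. 2. Hypothesis (*) of the GSL is redundant: it holds for every $W,a,b$ satisfying the other hypotheses of the GSL. 3. The GSL is equivalent to its restatement without (*): for every future-infinite causal worldline $W$ and all Cauchy comparable exteriors $a,b$ of $\partial I^-(W)$ with $D(a)\subseteq D(b)$,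 one has $S_{\mathrm{gen}}(a)-S_{\mathrm{gen}}(b)\ge 0$. -/

import Mathlib

open Set Filter Topology MeasureTheory
open scoped Manifold ContDiff

noncomputable section

namespace Spacetimes

/-- Coordinate space of dimension `d`. -/
abbrev Coord (d : ℕ) : Type := EuclideanSpace ℝ (Fin d)

/-- A smooth Lorentzian metric of signature `(-,+,…,+)` together with a time orientation, given by a
continuous timelike vector field. -/
structure LorentzStructure (d : ℕ) (M : Type*) [TopologicalSpace M] [ChartedSpace (Coord d) M]
    [IsManifold (𝓡 d) ∞ M] where
  /-- the metric tensor -/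
  metric (x : M) : TangentSpace (𝓡 d) x →L[ℝ] TangentSpace (𝓡 d) x →L[ℝ] ℝ
  symm (x : M) (v w : TangentSpace (𝓡 d) x) : metric x v w = metric x w v
  signature (x : M) : ∃ v : TangentSpace (𝓡 d) x, metric x v v < 0 ∧
    ∀ w : TangentSpace (𝓡 d) x, w ≠ 0 → metric x v w = 0 → 0 < metric x w w
  smooth : ContMDiff (𝓡 d) ((𝓡 d).prod 𝓘(ℝ, Coord d →L[ℝ] Coord d →L[ℝ] ℝ)) ∞
    (fun x => Bundle.TotalSpace.mk' (Coord d →L[ℝ] Coord d →L[ℝ] ℝ)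
      (E := fun x : M => TangentSpace (𝓡 d) x →L[ℝ] TangentSpace (𝓡 d) x →L[ℝ] ℝ) x (metric x))
  /-- the future-pointing timelike vector field that fixes the time orientation -/
  future (x : M) : TangentSpace (𝓡 d) x
  future_timelike (x : M) : metric x (future x) (future x) < 0
  future_continuous : Continuous (fun x => (⟨x, future x⟩ : TangentBundle (𝓡 d) M))

section

variable {d : ℕ} {M : Type*} [TopologicalSpace M] [ChartedSpace (Coord d) M]
  [IsManifold (𝓡 d) ∞ M]

/-! ### Cones and curves -/

/-- Future-directed timelike vectors at `x`. -/
def futureTimelike (g : LorentzStructure d M) (x : M) : Set (TangentSpace (𝓡 d) x) :=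
  {v | g.metric x v v < 0 ∧ g.metric x v (g.future x) < 0}

/-- Future-directed causal vectors at `x` (nonzero, timelike or null). -/
def futureCausal (g : LorentzStructure d M) (x : M) : Set (TangentSpace (𝓡 d) x) :=
  {v | g.metric x v v ≤ 0 ∧ g.metric x v (g.future x) < 0}

/-- Future-directed null vectors at `x` (nonzero). -/
def futureNull (g : LorentzStructure d M) (x : M) : Set (TangentSpace (𝓡 d) x) :=
  {v | g.metric x v v = 0 ∧ g.metric x v (g.future x) < 0}

/-- The velocity at `t` of the curve `γ`, differentiated within the parameter set `s`. -/
def velocity (γ : ℝ → M) (s : Set ℝ) (t : ℝ) : TangentSpace (𝓡 d) (γ t) :=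
  mfderivWithin 𝓘(ℝ, ℝ) (𝓡 d) γ s t (1 : ℝ)

/-- `B` has only finitely many points in each compact interval contained in `s`. -/
def LocallyFiniteIn (B s : Set ℝ) : Prop :=
  ∀ a b : ℝ, Icc a b ⊆ s → (B ∩ Icc a b).Finite

/-- `γ` is a piecewise `C¹` curve on the interval `s` all of whose velocities (both one-sided ones
at a break point) lie in the cone field `C`. -/
def IsCurveIn (C : ∀ x : M, Set (TangentSpace (𝓡 d) x)) (γ : ℝ → M) (s : Set ℝ) : Prop :=
  s.OrdConnected ∧ ContinuousOn γ s ∧ ∃ B : Set ℝ, LocallyFiniteIn B s ∧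
    ∀ a b : ℝ, a < b → Icc a b ⊆ s → Ioo a b ∩ B = ∅ →
      ContMDiffOn 𝓘(ℝ, ℝ) (𝓡 d) 1 γ (Icc a b) ∧
      ∀ t ∈ Icc a b, velocity γ (Icc a b) t ∈ C (γ t)

/-- Future-directed timelike curve on the parameter interval `s`. -/
def IsTimelikeCurve (g : LorentzStructure d M) (γ : ℝ → M) (s : Set ℝ) : Prop :=
  IsCurveIn (futureTimelike g) γ s

/-- Future-directed causal curve on the parameter interval `s`. -/
def IsCausalCurve (g : LorentzStructure d M) (γ : ℝ → M) (s : Set ℝ) : Prop :=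
  IsCurveIn (futureCausal g) γ s

/-! ### Causality -/

/-- A future-directed timelike curve runs from `p` to `q` inside `O`, off the set `A`. -/
def TimelikeJoined (g : LorentzStructure d M) (O A : Set M) (p q : M) : Prop :=
  ∃ (γ : ℝ → M) (a b : ℝ), a < b ∧ IsTimelikeCurve g γ (Icc a b) ∧ γ a = p ∧ γ b = q ∧
    ∀ t ∈ Icc a b, γ t ∈ O \ A

/-- `I⁺(p, O)`, the chronological future of `p` relative to `O`. -/
def chronFuture (g : LorentzStructure d M) (O : Set M) (p : M) : Set M :=
  {q | TimelikeJoined g O ∅ p q}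

/-- `I⁻(p, O)`, the chronological past of `p` relative to `O`. -/
def chronPast (g : LorentzStructure d M) (O : Set M) (p : M) : Set M :=
  {q | TimelikeJoined g O ∅ q p}

/-- `I⁻(A)`, the chronological past of a set. -/
def pastOf (g : LorentzStructure d M) (A : Set M) : Set M :=
  ⋃ p ∈ A, chronPast g univ p

/-- For a timelike vector field `T` the Lorentzian metric `g - T♭ ⊗ T♭` has a strictly wider cone
than `g`; these are its future-directed timelike vectors. -/
def widenedTimelike (g : LorentzStructure d M) (T : ∀ x : M, TangentSpace (𝓡 d) x) (x : M) :
    Set (TangentSpace (𝓡 d) x) :=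
  {v | g.metric x v v < (g.metric x (T x) v) ^ 2 ∧ g.metric x (T x) v < 0}

/-- Stable causality: for some continuous future-directed timelike vector field `T`, the metric
`g - T♭ ⊗ T♭` admits no closed timelike curve. -/
def StablyCausal (g : LorentzStructure d M) : Prop :=
  ∃ T : ∀ x : M, TangentSpace (𝓡 d) x,
    Continuous (fun x => (⟨x, T x⟩ : TangentBundle (𝓡 d) M)) ∧
    (∀ x, T x ∈ futureTimelike g x) ∧
    ¬ ∃ (γ : ℝ → M) (a b : ℝ), a < b ∧ IsCurveIn (widenedTimelike g T) γ (Icc a b) ∧ γ a = γ b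

/-- Achronality relative to `N`: no two points of `A` are joined by a timelike curve in `N`. -/
def IsAchronal (g : LorentzStructure d M) (N A : Set M) : Prop :=
  ∀ p ∈ A, ∀ q ∈ A, q ∉ chronFuture g N p

/-- The edge of an achronal set `A`: the points `p` of its closure such that every open
neighbourhood `O` of `p` contains points `q ∈ I⁺(p, O)` and `r ∈ I⁻(p, O)` and a timelike curve from
`r` to `q` in `O` that does not meet `A`. -/
def edge (g : LorentzStructure d M) (A : Set M) : Set M :=
  {p | p ∈ closure A ∧ ∀ O : Set M, IsOpen O → p ∈ O →
    ∃ q ∈ chronFuture g O p, ∃ r ∈ chronPast g O p, TimelikeJoined g O A r q}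

/-- A slice: a closed achronal set with empty edge. -/
def IsSlice (g : LorentzStructure d M) (A : Set M) : Prop :=
  IsClosed A ∧ IsAchronal g univ A ∧ edge g A = ∅

/-- A hypersurface: a relatively open subset of a slice. -/
def IsHypersurface (g : LorentzStructure d M) (A : Set M) : Prop :=
  ∃ S U : Set M, IsSlice g S ∧ IsOpen U ∧ A = S ∩ U

/-- `D⁺(A)` within the spacetime `N`: every past-inextendible causal curve of `N` that ends at `p`
meets `A`. -/
def futureDomain (g : LorentzStructure d M) (N A : Set M) : Set M :=
  {p | p ∈ N ∧ ∀ γ : ℝ → M, IsCausalCurve g γ (Iic 0) → γ 0 = p → (∀ t ∈ Iic (0 : ℝ), γ t ∈ N) →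
    (∀ x ∈ N, ¬ Tendsto γ atBot (𝓝 x)) → ∃ t ∈ Iic (0 : ℝ), γ t ∈ A}

/-- `D⁻(A)` within the spacetime `N`: every future-inextendible causal curve of `N` that starts at
`p` meets `A`. -/
def pastDomain (g : LorentzStructure d M) (N A : Set M) : Set M :=
  {p | p ∈ N ∧ ∀ γ : ℝ → M, IsCausalCurve g γ (Ici 0) → γ 0 = p → (∀ t ∈ Ici (0 : ℝ), γ t ∈ N) →
    (∀ x ∈ N, ¬ Tendsto γ atTop (𝓝 x)) → ∃ t ∈ Ici (0 : ℝ), γ t ∈ A}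

/-- The domain of dependence `D(A) = D⁺(A) ∪ D⁻(A)` within `N`. -/
def domainOfDependence (g : LorentzStructure d M) (N A : Set M) : Set M :=
  futureDomain g N A ∪ pastDomain g N A

/-- The open set `N`, as a spacetime of its own, is globally hyperbolic: it has a Cauchy surface,
that is, a relatively closed achronal set whose domain of dependence is all of `N`. -/
def IsGloballyHyperbolicOn (g : LorentzStructure d M) (N : Set M) : Prop :=
  IsOpen N ∧ ∃ S ⊆ N, closure S ∩ N ⊆ S ∧ IsAchronal g N S ∧ domainOfDependence g N S = N

/-- Two sets are Cauchy comparable if some globally hyperbolic open sub-spacetime contains both. -/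
def CauchyComparable (g : LorentzStructure d M) (A B : Set M) : Prop :=
  ∃ N : Set M, IsGloballyHyperbolicOn g N ∧ A ⊆ N ∧ B ⊆ N

/-! ### The Levi-Civita connection in charts, geodesics, parallel transport -/

/-- The metric in the coordinates of the chart at `x₀`, at the coordinate point `y`. -/
def coordMetric (g : LorentzStructure d M) (x₀ : M) (y : Coord d) :
    Coord d →L[ℝ] Coord d →L[ℝ] ℝ :=
  let G : Coord d →L[ℝ] Coord d →L[ℝ] ℝ := g.metric ((extChartAt (𝓡 d) x₀).symm y)
  let A : Coord d →L[ℝ] Coord d :=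
    mfderiv 𝓘(ℝ, Coord d) (𝓡 d) (extChartAt (𝓡 d) x₀).symm y
  G.bilinearComp A A

/-- Christoffel symbols of the first kind in the chart at `x₀`:
`Γ(u, v; w) = ½ (∂ᵤ g(v, w) + ∂ᵥ g(u, w) - ∂_w g(u, v))`. -/
def christoffel (g : LorentzStructure d M) (x₀ : M) (y u v w : Coord d) : ℝ :=
  (1 / 2 : ℝ) * (fderiv ℝ (coordMetric g x₀) y u v w + fderiv ℝ (coordMetric g x₀) y v u w
    - fderiv ℝ (coordMetric g x₀) y w u v)

/-- `γ` is an affinely parametrized geodesic on the interval `s`: in every chart of the atlas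
indexed by the points of `M` it solves the geodesic equation
`g(c'', w) + Γ(c', c'; w) = 0` for all `w`. -/
def IsGeodesic (g : LorentzStructure d M) (γ : ℝ → M) (s : Set ℝ) : Prop :=
  ContMDiffOn 𝓘(ℝ, ℝ) (𝓡 d) 2 γ s ∧
  ∀ t ∈ s, ∀ x₀ : M, γ t ∈ (chartAt (Coord d) x₀).source →
    let c : ℝ → Coord d := fun τ => extChartAt (𝓡 d) x₀ (γ τ)
    ∀ w : Coord d, coordMetric g x₀ (c t) (derivWithin (derivWithin c s) s t) w
      + christoffel g x₀ (c t) (derivWithin c s t) (derivWithin c s t) w = 0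

/-- `γ` is an affinely parametrized future-directed null geodesic on the interval `s`. -/
def IsNullGeodesic (g : LorentzStructure d M) (γ : ℝ → M) (s : Set ℝ) : Prop :=
  IsGeodesic g γ s ∧ ∀ t ∈ s, velocity γ s t ∈ futureNull g (γ t)

/-- Future null geodesic completeness: each future-directed null vector is the initial velocity of
a null geodesic that is defined for all affine parameters in `[0, ∞)`. -/
def FutureNullComplete (g : LorentzStructure d M) : Prop :=
  ∀ (p : M), ∀ v ∈ futureNull g p, ∃ γ : ℝ → M, IsNullGeodesic g γ (Ici 0) ∧
    (⟨γ 0, velocity γ (Ici 0) 0⟩ : TangentBundle (𝓡 d) M) = ⟨p, v⟩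

/-- Through `p` there passes a null geodesic contained in `H` whose affine parameter is unbounded
towards the future. -/
def HasFutureInfiniteNullGeodesic (g : LorentzStructure d M) (H : Set M) (p : M) : Prop :=
  ∃ (γ : ℝ → M) (s : Set ℝ), s.OrdConnected ∧ ¬ BddAbove s ∧ IsNullGeodesic g γ s ∧
    p ∈ γ '' s ∧ γ '' s ⊆ H

/-- `V` is a continuous vector field along the piecewise `C¹` curve `γ`, parallel off the break
points: in every chart it solves `g(V', w) + Γ(c', V; w) = 0` for all `w`. -/
def IsParallelAlong (g : LorentzStructure d M) (γ : ℝ → M) (s : Set ℝ)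
    (V : ∀ t : ℝ, TangentSpace (𝓡 d) (γ t)) : Prop :=
  ContinuousOn (fun t => (⟨γ t, V t⟩ : TangentBundle (𝓡 d) M)) s ∧
  ∃ B : Set ℝ, LocallyFiniteIn B s ∧ ∀ t ∈ interior s \ B, ∀ x₀ : M,
    γ t ∈ (chartAt (Coord d) x₀).source →
    let c : ℝ → Coord d := fun τ => extChartAt (𝓡 d) x₀ (γ τ)
    let ξ : ℝ → Coord d := fun τ =>
      mfderiv (𝓡 d) 𝓘(ℝ, Coord d) (extChartAt (𝓡 d) x₀) (γ τ) (V τ)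
    DifferentiableAt ℝ c t ∧ DifferentiableAt ℝ ξ t ∧
    ∀ w : Coord d, coordMetric g x₀ (c t) (deriv ξ t) w
      + christoffel g x₀ (c t) (deriv c t) (ξ t) w = 0

/-- The curve `γ` on `s` is infinite towards the future in (generalized) affine parameter: for a
parallel frame `e` along `γ`, the integral of the Euclidean length of the components of the velocity
in the frame diverges towards the future. Whether it diverges depends neither on the frame nor on
the starting parameter; on a geodesic the integral is a constant times the affine parameter. -/
def IsFutureInfinite (g : LorentzStructure d M) (γ : ℝ → M) (s : Set ℝ) : Prop :=
  ∃ e : ∀ t : ℝ, Coord d ≃L[ℝ] TangentSpace (𝓡 d) (γ t),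
    (∀ u : Coord d, IsParallelAlong g γ s (fun t => e t u)) ∧
    ∀ t₀ ∈ s, ∫⁻ t in s ∩ Ici t₀, ‖(e t).symm (velocity γ s t)‖ₑ = ⊤

/-- `W` is (the image of) a future-infinite causal worldline. -/
def IsFutureInfiniteWorldline (g : LorentzStructure d M) (W : Set M) : Prop :=
  ∃ (γ : ℝ → M) (s : Set ℝ), s.Nonempty ∧ IsCausalCurve g γ s ∧ IsFutureInfinite g γ s ∧
    W = γ '' s

/-! ### Horizons and the generalized second law -/

/-- The causal horizon `∂I⁻(W)`. -/
def horizon (g : LorentzStructure d M) (W : Set M) : Set M :=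
  frontier (pastOf g W)

/-- `a` is an exterior of the horizon `∂I⁻(W)`. -/
def IsExterior (g : LorentzStructure d M) (W a : Set M) : Prop :=
  IsHypersurface g a ∧ a ⊆ closure (pastOf g W) ∧ edge g a ⊆ horizon g W

/-- The geometric situation in which the GSL compares `a` with `b`: `W` is a future-infinite causal
worldline, and `a`, `b` are Cauchy comparable exteriors of `∂I⁻(W)` with `D(a) ⊆ D(b)`. -/
def IsGSLPair (g : LorentzStructure d M) (W a b : Set M) : Prop :=
  IsFutureInfiniteWorldline g W ∧ IsExterior g W a ∧ IsExterior g W b ∧ CauchyComparable g a b ∧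
    domainOfDependence g univ a ⊆ domainOfDependence g univ b

/-- The final hypothesis of the GSL. -/
def GeneratorCondition (g : LorentzStructure d M) (W a b : Set M) : Prop :=
  ∀ p ∈ edge g b \ edge g a, HasFutureInfiniteNullGeodesic g (horizon g W) p

/-- The generalized second law for a set function `S`, defined on the sets in `R`. -/
def GSL (g : LorentzStructure d M) (R : Set (Set M)) (S : Set M → ℝ) : Prop :=
  ∀ W : Set M, ∀ a ∈ R, ∀ b ∈ R, IsGSLPair g W a b → GeneratorCondition g W a b → 0 ≤ S a - S b

/-- The generalized second law restated without its final hypothesis. -/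
def SimplifiedGSL (g : LorentzStructure d M) (R : Set (Set M)) (S : Set M → ℝ) : Prop :=
  ∀ W : Set M, ∀ a ∈ R, ∀ b ∈ R, IsGSLPair g W a b → 0 ≤ S a - S b

end

end Spacetimes

end

/-!
Let `p` lie on the horizon `∂I⁻(W)`. In a small chart ball around `p` a linear function increases
along causal curves at a rate comparable to their coordinate speed, so a parallel frame along a
causal curve in the ball stays bounded and the generalized affine length is finite: the worldline
leaves the ball. Now take `x ∈ I⁻(W)` close to `p` and follow a timelike curve from `x` to `W`, and
then `W`, until the ball is left. The exit point lies in the closure of `I⁻(W)`, and it is the image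
of a causal vector under the exponential map at a point slightly to the past of `x`. By compactness
of the vectors involved, some causal geodesic from `p` reaches the sphere within the closure of
`I⁻(W)`, hence runs in this closure all the way; it is null, because otherwise `p` would belong to
`I⁻(W)`.

By completeness this germ extends to a null geodesic on `[0, ∞)`, which never enters `I⁻(W)` since
`p ∉ I⁻(W)`. Suppose that it has run in the closure of `I⁻(W)` up to a point `q`. A second causal
germ in the closure starts at `q`. If it is not tangent to the geodesic, the corner at `q` is cut by
a timelike segment, which puts a point of the geodesic before `q` into `I⁻(W)`; so it is tangent,
and by uniqueness of geodesics it continues the geodesic within the closure beyond `q`.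
-/

set_option maxSynthPendingDepth 3

noncomputable section

namespace Spacetimes

lemma exists_first_exit {X : Type*} [TopologicalSpace X] {γ : ℝ → X} {a b : ℝ} {N : Set X}
    (hN : IsOpen N) (hγ : ContinuousOn γ (Icc a b)) (ha : γ a ∈ N)
    (hexit : ∃ t ∈ Icc a b, γ t ∉ N) :
    ∃ t ∈ Ioc a b, γ t ∉ N ∧ γ t ∈ closure N ∧ ∀ u ∈ Ico a t, γ u ∈ N := by
  have hcompact : IsCompact (Icc a b ∩ γ ⁻¹' Nᶜ) :=
    isCompact_Icc.of_isClosed_subset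
      (hγ.preimage_isClosed_of_isClosed isClosed_Icc hN.isClosed_compl) inter_subset_left
  obtain ⟨t, ⟨ht, htN⟩, hleast⟩ := hcompact.exists_isLeast hexit
  have hat : a < t := ht.1.lt_of_ne fun h => htN (h ▸ ha)
  have hbefore : ∀ u ∈ Ico a t, γ u ∈ N := fun u hu =>
    by_contra fun hcon => hu.2.not_ge (hleast ⟨⟨hu.1, hu.2.le.trans ht.2⟩, hcon⟩)
  refine ⟨t, ⟨hat, ht.2⟩, htN, ?_, hbefore⟩
  have hcont : ContinuousWithinAt γ (Ico a t) t :=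
    (hγ t ht).mono (Ico_subset_Icc_self.trans (Icc_subset_Icc_right ht.2))
  have hcl : t ∈ closure (Ico a t) := by
    rw [closure_Ico hat.ne]
    exact right_mem_Icc.2 hat.le
  exact closure_mono (image_subset_iff.2 hbefore) (hcont.mem_closure_image hcl)

/-! ### Lorentzian bilinear forms -/

section LorentzForm

variable {E : Type*} [NormedAddCommGroup E] [NormedSpace ℝ E]

/-- A symmetric bilinear form of signature `(-,+,…,+)`. -/
def IsLorentzForm (B : E →L[ℝ] E →L[ℝ] ℝ) : Prop :=
  (∀ v w, B v w = B w v) ∧ ∃ v, B v v < 0 ∧ ∀ w, w ≠ 0 → B v w = 0 → 0 < B w w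

/-- Timelike vectors in the cone singled out by the vector `f`, which is timelike in all uses. -/
def timelikeCone (B : E →L[ℝ] E →L[ℝ] ℝ) (f : E) : Set E := {v | B v v < 0 ∧ B v f < 0}

/-- Nonzero causal vectors in the cone singled out by the vector `f`, which is timelike in all
uses. -/
def causalCone (B : E →L[ℝ] E →L[ℝ] ℝ) (f : E) : Set E := {v | B v v ≤ 0 ∧ B v f < 0}

variable {B : E →L[ℝ] E →L[ℝ] ℝ} {f u v w : E} {k : ℝ}

lemma timelikeCone_subset_causalCone : timelikeCone B f ⊆ causalCone B f :=
  fun _ hv => ⟨hv.1.le, hv.2⟩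

lemma isOpen_timelikeCone : IsOpen (timelikeCone B f) := by
  have hsq : IsOpen {v | B v v < 0} := isOpen_lt (by fun_prop) continuous_const
  have hf : IsOpen {v | B v f < 0} := isOpen_lt (by fun_prop) continuous_const
  exact hsq.inter hf

lemma ne_zero_of_mem_causalCone (hv : v ∈ causalCone B f) : v ≠ 0 := by
  rintro rfl
  simp [causalCone] at hv

lemma smul_mem_timelikeCone (hk : 0 < k) (hv : v ∈ timelikeCone B f) :
    k • v ∈ timelikeCone B f := by
  simp only [timelikeCone, mem_ofPred_eq, map_smul, smul_apply, smul_eq_mul]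
  exact ⟨mul_neg_of_pos_of_neg hk (mul_neg_of_pos_of_neg hk hv.1), mul_neg_of_pos_of_neg hk hv.2⟩

lemma smul_mem_causalCone (hk : 0 < k) (hv : v ∈ causalCone B f) : k • v ∈ causalCone B f := by
  simp only [causalCone, mem_ofPred_eq, map_smul, smul_apply, smul_eq_mul]
  exact ⟨mul_nonpos_of_nonneg_of_nonpos hk.le (mul_nonpos_of_nonneg_of_nonpos hk.le hv.1),
    mul_neg_of_pos_of_neg hk hv.2⟩

lemma smul_mem_timelikeCone_iff (hk : 0 < k) : k • v ∈ timelikeCone B f ↔ v ∈ timelikeCone B f := by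
  refine ⟨fun h => ?_, smul_mem_timelikeCone hk⟩
  simpa [smul_smul, inv_mul_cancel₀ hk.ne'] using smul_mem_timelikeCone (inv_pos.2 hk) h

namespace IsLorentzForm

lemma nondegenerate (hB : IsLorentzForm B) (h : ∀ w, B v w = 0) : v = 0 := by
  by_contra hv
  obtain ⟨hsymm, e, -, hpos⟩ := hB
  exact (hpos v hv (by rw [hsymm, h])).ne' (h v)

lemma pos_of_orthogonal (hB : IsLorentzForm B) (hu : B u u < 0) (hw : w ≠ 0) (huw : B u w = 0) :
    0 < B w w := by
  obtain ⟨hsymm, e, -, hpos⟩ := hB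
  have hwu : B w u = 0 := by rw [hsymm, huw]
  have heu : B e u ≠ 0 := fun h =>
    (hpos u (by rintro rfl; simp at hu) h).not_gt hu
  -- `B e w • u - B e u • w` spans the part of the plane of `u` and `w` orthogonal to `e`.
  have hz : B e w • u - B e u • w ≠ 0 := by
    intro h
    have hBew : B e w = 0 := by
      have := congrArg (B u) h
      simpa [huw, hu.ne] using this
    rw [hBew, zero_smul, zero_sub, neg_eq_zero] at h
    exact (smul_eq_zero.1 h).elim heu hw
  have hzz := hpos _ hz (by simp only [map_sub, map_smul, smul_eq_mul]; ring)
  simp only [map_sub, map_smul, sub_apply, smul_apply, smul_eq_mul, huw, hwu] at hzz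
  by_contra! hww
  nlinarith [mul_nonneg (sq_nonneg (B e w)) (neg_nonneg.2 hu.le),
    mul_nonneg (sq_nonneg (B e u)) (neg_nonneg.2 hww)]

lemma ne_zero_of_causal (hB : IsLorentzForm B) (hu : B u u < 0) (hw : w ≠ 0) (hww : B w w ≤ 0) :
    B w u ≠ 0 := fun h =>
  (hB.pos_of_orthogonal hu hw (by rw [hB.1, h])).not_ge hww

lemma neg_of_causal_of_ne_smul (hB : IsLorentzForm B) (hf : B f f < 0) (hu : u ∈ causalCone B f)
    (hw : w ∈ causalCone B f) (hne : ∀ k : ℝ, 0 < k → w ≠ k • u) : B u w < 0 := by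
  obtain ⟨huu, huf⟩ := hu
  obtain ⟨hww, hwf⟩ := hw
  by_contra! huw
  -- The vector of the plane of `u` and `w` orthogonal to `f` would be causal.
  set z := B u f • w - B w f • u with hz
  have hfz : B f z = 0 := by
    simp only [hz, map_sub, map_smul, smul_eq_mul, hB.1 f w, hB.1 f u]; ring
  have hzz : B z z = (B u f) ^ 2 * B w w + (B w f) ^ 2 * B u u
      - 2 * (B u f * B w f) * B u w := by
    simp only [hz, map_sub, map_smul, sub_apply, smul_apply, smul_eq_mul, hB.1 w u]; ring
  have hzz_nonpos : B z z ≤ 0 := by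
    have := mul_pos_of_neg_of_neg huf hwf
    nlinarith [mul_nonneg (sq_nonneg (B u f)) (neg_nonneg.2 hww),
      mul_nonneg (sq_nonneg (B w f)) (neg_nonneg.2 huu)]
  have hz0 : z ≠ 0 := by
    intro h
    refine hne (B w f / B u f) (div_pos_of_neg_of_neg hwf huf) ?_
    rw [div_eq_inv_mul, mul_smul, ← sub_eq_zero.1 h, smul_smul, inv_mul_cancel₀ huf.ne, one_smul]
  exact (hB.pos_of_orthogonal hf hz0 hfz).not_ge hzz_nonpos

lemma neg_of_timelike_causal (hB : IsLorentzForm B) (hf : B f f < 0) (hu : u ∈ timelikeCone B f)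
    (hw : w ∈ causalCone B f) : B u w < 0 := by
  by_cases hne : ∀ k : ℝ, 0 < k → w ≠ k • u
  · exact hB.neg_of_causal_of_ne_smul hf (timelikeCone_subset_causalCone hu) hw hne
  · push Not at hne
    obtain ⟨k, hk, rfl⟩ := hne
    simpa only [map_smul, smul_eq_mul] using mul_neg_of_pos_of_neg hk hu.1

lemma add_mem_timelikeCone (hB : IsLorentzForm B) (hf : B f f < 0) (hu : u ∈ causalCone B f)
    (hw : w ∈ causalCone B f) (hne : ∀ k : ℝ, 0 < k → w ≠ k • u) : u + w ∈ timelikeCone B f := by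
  have huw := hB.neg_of_causal_of_ne_smul hf hu hw hne
  obtain ⟨huu, huf⟩ := hu
  obtain ⟨hww, hwf⟩ := hw
  simp only [timelikeCone, mem_ofPred_eq, map_add, add_apply, hB.1 w u]
  exact ⟨by linarith, by linarith⟩

lemma mem_timelikeCone_of_mem (hB : IsLorentzForm B) (hf : B f f < 0) (hu : u ∈ timelikeCone B f)
    (hw : w ∈ timelikeCone B u) : w ∈ timelikeCone B f :=
  ⟨hw.1, hB.neg_of_timelike_causal hu.1 hw ⟨hf.le, by rw [hB.1]; exact hu.2⟩⟩

lemma forall_mem_timelikeCone_of_deriv_nonpos (hB : IsLorentzForm B) (hf : B f f < 0)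
    {w : ℝ → E} {a b : ℝ} (hw : ContinuousOn w (Icc a b)) (ha : w a ∈ timelikeCone B f)
    (hderiv : ∀ t ∈ Ico a b, w t ∈ timelikeCone B f →
      ∃ h' ≤ 0, HasDerivWithinAt (fun t => B (w t) (w t)) h' (Ici t) t) :
    ∀ t ∈ Icc a b, w t ∈ timelikeCone B f := by
  by_contra! hexit
  obtain ⟨s, hs, hsout, hscl, hbefore⟩ := exists_first_exit isOpen_timelikeCone hw ha hexit
  have hsub : Icc a s ⊆ Icc a b := Icc_subset_Icc_right hs.2
  choose! h' hh' hderiv using fun t (ht : t ∈ Ico a s) =>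
    hderiv t ⟨ht.1, ht.2.trans_le hs.2⟩ (hbefore t ht)
  have hwB : ContinuousOn (fun t => B (w t) (w t)) (Icc a s) := by
    have := hw.mono hsub
    fun_prop
  have hle : B (w s) (w s) ≤ B (w a) (w a) :=
    image_le_of_deriv_right_le_deriv_boundary hwB hderiv le_rfl continuousOn_const
      (fun _ _ => hasDerivWithinAt_const ..) hh' (right_mem_Icc.2 hs.1.le)
  have hneg : B (w s) (w s) < 0 := hle.trans_lt ha.1
  have hclosed : IsClosed {v | B v f ≤ 0} := isClosed_le (by fun_prop) continuous_const
  have hlim : B (w s) f ≤ 0 := closure_minimal (fun v hv => hv.2.le) hclosed hscl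
  refine hsout ⟨hneg, hlim.lt_of_ne (hB.ne_zero_of_causal hf ?_ hneg.le)⟩
  rintro h0
  simp [h0] at hneg

lemma exists_equiv [FiniteDimensional ℝ E] (hB : IsLorentzForm B) :
    ∃ e : E ≃L[ℝ] (E →L[ℝ] ℝ), (e : E →L[ℝ] (E →L[ℝ] ℝ)) = B := by
  have hinj : Function.Injective (B : E →ₗ[ℝ] (E →L[ℝ] ℝ)) :=
    (injective_iff_map_eq_zero _).2 fun v hv => hB.nondegenerate fun w => DFunLike.congr_fun hv w
  have hdim : Module.finrank ℝ E = Module.finrank ℝ (E →L[ℝ] ℝ) := by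
    rw [← (LinearMap.toContinuousLinearMap (𝕜 := ℝ) (E := E) (F' := ℝ)).finrank_eq]
    exact Subspace.dual_finrank_eq.symm
  exact ⟨(LinearMap.linearEquivOfInjective _ hinj hdim).toContinuousLinearEquiv, rfl⟩

end IsLorentzForm

end LorentzForm

/-! ### The geodesic equation in coordinates -/

section Spray

variable {E : Type*} [NormedAddCommGroup E] [NormedSpace ℝ E]
  {G : E → E →L[ℝ] E →L[ℝ] ℝ} {U : Set E}

/-- Christoffel symbols of the first kind of a metric `G` given in coordinates. -/
def christoffelOf (G : E → E →L[ℝ] E →L[ℝ] ℝ) (y u v w : E) : ℝ :=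
  (1 / 2 : ℝ) * (fderiv ℝ G y u v w + fderiv ℝ G y v u w - fderiv ℝ G y w u v)

/-- The linear form `w ↦ Γ(v, v; w)`. -/
def christoffelForm (G : E → E →L[ℝ] E →L[ℝ] ℝ) (y v : E) : E →L[ℝ] ℝ :=
  fderiv ℝ G y v v - (1 / 2 : ℝ) • ((fderiv ℝ G y).flip v).flip v

lemma christoffelForm_apply (G : E → E →L[ℝ] E →L[ℝ] ℝ) (y v w : E) :
    christoffelForm G y v w = christoffelOf G y v v w := by
  simp only [christoffelForm, christoffelOf, sub_apply, smul_apply,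
    ContinuousLinearMap.flip_apply, smul_eq_mul]
  ring

/-- The acceleration prescribed by the geodesic equation. It is the junk value `0` where `G y` is
degenerate, since `ContinuousLinearMap.inverse` is `0` there. -/
def spray (G : E → E →L[ℝ] E →L[ℝ] ℝ) (y v : E) : E :=
  -(G y).inverse (christoffelForm G y v)

/-- The geodesic equation as a first-order system for position and velocity. -/
def geodesicField (G : E → E →L[ℝ] E →L[ℝ] ℝ) (z : E × E) : E × E :=
  (z.2, spray G z.1 z.2)

lemma spray_smul (G : E → E →L[ℝ] E →L[ℝ] ℝ) (y v : E) (k : ℝ) :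
    spray G y (k • v) = (k * k) • spray G y v := by
  have : christoffelForm G y (k • v) = (k * k) • christoffelForm G y v := by
    ext w
    simp only [christoffelForm_apply, christoffelOf, map_smul, smul_apply, smul_eq_mul]
    ring
  rw [spray, this, map_smul, spray, smul_neg]

lemma geodesicField_zero_velocity (G : E → E →L[ℝ] E →L[ℝ] ℝ) (y : E) :
    geodesicField G (y, 0) = 0 := by
  simpa [geodesicField] using spray_smul G y 0 0

/-- The kinetic energy `½ g(v, v)`, as a function of position and velocity. -/
def energy (G : E → E →L[ℝ] E →L[ℝ] ℝ) (z : E × E) : ℝ := (1 / 2 : ℝ) * G z.1 z.2 z.2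

/-- A smooth field of Lorentzian forms on an open set: a Lorentzian metric in coordinates. -/
structure IsLorentzMetricOn (G : E → E →L[ℝ] E →L[ℝ] ℝ) (U : Set E) : Prop where
  isOpen : IsOpen U
  contDiffOn : ContDiffOn ℝ ∞ G U
  lorentz : ∀ y ∈ U, IsLorentzForm (G y)

namespace IsLorentzMetricOn

lemma symm (hG : IsLorentzMetricOn G U) {y : E} (hy : y ∈ U) (v w : E) : G y v w = G y w v :=
  (hG.lorentz y hy).1 v w

lemma hasFDerivAt (hG : IsLorentzMetricOn G U) {y : E} (hy : y ∈ U) :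
    HasFDerivAt G (fderiv ℝ G y) y :=
  ((hG.contDiffOn.differentiableOn (by simp) y hy).differentiableAt
    (hG.isOpen.mem_nhds hy)).hasFDerivAt

lemma contDiffOn_fderiv (hG : IsLorentzMetricOn G U) : ContDiffOn ℝ ∞ (fderiv ℝ G) U :=
  hG.contDiffOn.fderiv_of_isOpen hG.isOpen (by simp)

lemma hasDerivWithinAt_apply (hG : IsLorentzMetricOn G U) {x a b : ℝ → E} {x' a' b' : E}
    {s : Set ℝ} {t : ℝ} (hxU : x t ∈ U) (hx : HasDerivWithinAt x x' s t)
    (ha : HasDerivWithinAt a a' s t) (hb : HasDerivWithinAt b b' s t) :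
    HasDerivWithinAt (fun t => G (x t) (a t) (b t))
      (fderiv ℝ G (x t) x' (a t) (b t) + G (x t) a' (b t) + G (x t) (a t) b') s t := by
  simpa using (((hG.hasFDerivAt hxU).comp_hasDerivWithinAt t hx).clm_apply ha).clm_apply hb

lemma contDiffOn_energy (hG : IsLorentzMetricOn G U) :
    ContDiffOn ℝ ∞ (energy G) (U ×ˢ univ) :=
  contDiffOn_const.mul (((hG.contDiffOn.comp contDiffOn_fst fun _ hz => hz.1).clm_apply
    contDiffOn_snd).clm_apply contDiffOn_snd)

lemma fderiv_energy (hG : IsLorentzMetricOn G U) {z : E × E} (hz : z.1 ∈ U) (w : E × E) :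
    fderiv ℝ (energy G) z w =
      (1 / 2 : ℝ) * fderiv ℝ G z.1 w.1 z.2 z.2 + G z.1 z.2 w.2 := by
  have hmetric : HasFDerivAt (fun z : E × E => G z.1)
      ((fderiv ℝ G z.1).comp (ContinuousLinearMap.fst ℝ E E)) z :=
    (hG.hasFDerivAt hz).comp z hasFDerivAt_fst
  unfold energy
  rw [(((hmetric.clm_apply hasFDerivAt_snd).clm_apply
    hasFDerivAt_snd).const_mul (1 / 2 : ℝ)).fderiv]
  simp only [ContinuousLinearMap.flip_add, add_apply, smul_add, smul_apply,
    ContinuousLinearMap.comp_apply, ContinuousLinearMap.coe_fst', ContinuousLinearMap.coe_snd',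
    ContinuousLinearMap.flip_apply, smul_eq_mul, hG.symm hz w.2 z.2]
  ring

variable [FiniteDimensional ℝ E]

lemma spray_spec (hG : IsLorentzMetricOn G U) {y : E} (hy : y ∈ U) (v w : E) :
    G y (spray G y v) w = -christoffelOf G y v v w := by
  obtain ⟨e, he⟩ := (hG.lorentz y hy).exists_equiv
  rw [spray, map_neg, neg_apply, ← he, ContinuousLinearMap.inverse_equiv]
  simp [christoffelForm_apply]

lemma fderiv_energy_geodesicField (hG : IsLorentzMetricOn G U) {z : E × E} (hz : z.1 ∈ U) :
    fderiv ℝ (energy G) z (geodesicField G z) = 0 := by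
  rw [hG.fderiv_energy hz, geodesicField, hG.symm hz, hG.spray_spec hz, christoffelOf]
  ring

lemma eq_spray (hG : IsLorentzMetricOn G U) {y : E} (hy : y ∈ U) {a v : E}
    (h : ∀ w, G y a w + christoffelOf G y v v w = 0) : a = spray G y v := by
  refine sub_eq_zero.1 ((hG.lorentz y hy).nondegenerate fun w => ?_)
  rw [map_sub, sub_apply, hG.spray_spec hy]
  linarith [h w]

lemma contDiffOn_geodesicField (hG : IsLorentzMetricOn G U) :
    ContDiffOn ℝ ∞ (geodesicField G) (U ×ˢ univ) := by
  have := FiniteDimensional.complete ℝ E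
  have hfst : ContDiffOn ℝ ∞ (Prod.fst : E × E → E) (U ×ˢ univ) := contDiffOn_fst
  have hsnd : ContDiffOn ℝ ∞ (Prod.snd : E × E → E) (U ×ˢ univ) := contDiffOn_snd
  have hmaps : MapsTo (Prod.fst : E × E → E) (U ×ˢ univ) U := fun z hz => hz.1
  have hderiv : ContDiffOn ℝ ∞ (fun z : E × E => fderiv ℝ G z.1) (U ×ˢ univ) :=
    hG.contDiffOn_fderiv.comp hfst hmaps
  have hflip : ContDiffOn ℝ ∞ (fun z : E × E => (fderiv ℝ G z.1).flip) (U ×ˢ univ) :=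
    (ContinuousLinearMap.flipₗᵢ ℝ E E (E →L[ℝ] ℝ)).contDiff.comp_contDiffOn hderiv
  have hflip_flip : ContDiffOn ℝ ∞ (fun z : E × E => ((fderiv ℝ G z.1).flip z.2).flip)
      (U ×ˢ univ) :=
    (ContinuousLinearMap.flipₗᵢ ℝ E E ℝ).contDiff.comp_contDiffOn (hflip.clm_apply hsnd)
  have hform : ContDiffOn ℝ ∞ (fun z : E × E => christoffelForm G z.1 z.2) (U ×ˢ univ) :=
    ((hderiv.clm_apply hsnd).clm_apply hsnd).sub ((hflip_flip.clm_apply hsnd).const_smul _)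
  have hinverse : ContDiffOn ℝ ∞ (fun z : E × E => (G z.1).inverse) (U ×ˢ univ) := by
    intro z hz
    obtain ⟨e, he⟩ := (hG.lorentz z.1 hz.1).exists_equiv
    have : ContDiffAt ℝ ∞ ContinuousLinearMap.inverse (G z.1) := he ▸ contDiffAt_map_inverse e
    exact this.comp_contDiffWithinAt z (hG.contDiffOn.comp hfst hmaps z hz)
  exact hsnd.prodMk (hinverse.clm_apply hform).neg

end IsLorentzMetricOn

end Spray

/-! ### The local geodesic flow -/

section Flow

open Metric

lemma mk_mem_closedBall {X Y : Type*} [PseudoMetricSpace X] [PseudoMetricSpace Y] {x₀ x : X}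
    {y₀ y : Y} {r : ℝ} (hx : x ∈ closedBall x₀ r) (hy : y ∈ closedBall y₀ r) :
    (x, y) ∈ closedBall (x₀, y₀) r := by
  rw [← closedBall_prod_same]
  exact ⟨hx, hy⟩

variable {E : Type*} [NormedAddCommGroup E] [NormedSpace ℝ E]

lemma hasDerivWithinAt_Ici_of_Icc {f : ℝ → E} {f' : E} {a b t : ℝ}
    (h : HasDerivWithinAt f f' (Icc a b) t) (ht : t ∈ Ico a b) :
    HasDerivWithinAt f f' (Ici t) t :=
  h.mono_of_mem_nhdsWithin (Icc_mem_nhdsGE_of_mem ht)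

lemma hasDerivWithinAt_fst {f : ℝ → E × E} {f' : E × E} {s : Set ℝ} {t : ℝ}
    (h : HasDerivWithinAt f f' s t) : HasDerivWithinAt (fun t => (f t).1) f'.1 s t :=
  (ContinuousLinearMap.fst ℝ E E).hasFDerivAt.comp_hasDerivWithinAt t h

lemma hasDerivWithinAt_snd {f : ℝ → E × E} {f' : E × E} {s : Set ℝ} {t : ℝ}
    (h : HasDerivWithinAt f f' s t) : HasDerivWithinAt (fun t => (f t).2) f'.2 s t :=
  (ContinuousLinearMap.snd ℝ E E).hasFDerivAt.comp_hasDerivWithinAt t h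

lemma exists_solution_of_lipschitzOnWith [CompleteSpace E] {X : E → E} {z₀ : E} (h₀ : X z₀ = 0)
    {K : NNReal} {R τ : ℝ} (hR : 0 ≤ R) (hτ : 0 ≤ τ) (hKτ : K * τ ≤ 1 / 2)
    (hX : LipschitzOnWith K X (closedBall z₀ R)) {z : E} (hz : z ∈ closedBall z₀ (R / 2)) :
    ∃ α : ℝ → E, α 0 = z ∧ ∀ t ∈ Icc 0 τ,
      α t ∈ closedBall z₀ R ∧ HasDerivWithinAt α (X (α t)) (Icc 0 τ) t := by
  lift R to NNReal using hR
  have hXR : ∀ x ∈ closedBall z₀ (R : ℝ), ‖X x‖ ≤ (K * R : NNReal) := by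
    intro x hx
    have h := hX.norm_sub_le hx (mem_closedBall_self R.2)
    rw [h₀, sub_zero] at h
    exact h.trans (mul_le_mul_of_nonneg_left (mem_closedBall_iff_norm.1 hx) K.2)
  -- Truncating the field bounds the speed globally, which keeps the solution inside the ball.
  let Y : E → E := (closedBall z₀ (R : ℝ)).indicator X
  have hYX : EqOn Y X (closedBall z₀ R) := eqOn_indicator
  have hYR (x : E) : ‖Y x‖ ≤ (K * R : NNReal) := by
    by_cases hx : x ∈ closedBall z₀ (R : ℝ)
    · exact hYX hx ▸ hXR x hx
    · simp only [Y, indicator_of_notMem hx, norm_zero, NNReal.coe_nonneg]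
  have hstep : K * R * τ ≤ R / 2 := by nlinarith [R.2]
  have hpicard : IsPicardLindelof (fun _ => Y) (tmin := 0) (tmax := τ) ⟨0, le_rfl, hτ⟩ z₀
      R (R / 2) (K * R) K := by
    refine .of_time_independent (fun x _ => hYR x) (fun x hx y hy => ?_) ?_
    · rw [hYX hx, hYX hy]
      exact hX hx hy
    · simp only [sub_zero, max_eq_left hτ, NNReal.coe_mul, NNReal.coe_div, NNReal.coe_ofNat]
      linarith
  obtain ⟨α, hα0, hα⟩ := hpicard.exists_eq_forall_mem_Icc_hasDerivWithinAt hz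
  have hmem : ∀ t ∈ Icc 0 τ, α t ∈ closedBall z₀ R := by
    intro t ht
    have hdist := norm_image_sub_le_of_norm_deriv_le_segment' hα (fun s _ => hYR (α s)) t ht
    rw [← dist_eq_norm, show α 0 = z from hα0, sub_zero] at hdist
    have hle : (K * R : NNReal) * t ≤ K * R * τ := by push_cast; gcongr; exact ht.2
    rw [mem_closedBall] at hz ⊢
    linarith [dist_triangle (α t) z z₀]
  exact ⟨α, hα0, fun t ht => ⟨hmem t ht, hYX (hmem t ht) ▸ hα t ht⟩⟩

/-- A flow of the geodesic equation for a short time `τ`, with initial data near `(y₀, 0)`. The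
parameter `κ` measures how much the flow may differ from the flow of straight lines. -/
structure LocalGeodesicFlow (G : E → E →L[ℝ] E →L[ℝ] ℝ) (U : Set E) (y₀ : E) (κ : ℝ) where
  /-- the time for which the flow is defined -/
  τ : ℝ
  /-- the radius of the ball in which the flow lives -/
  R : ℝ
  /-- a Lipschitz constant of the geodesic field -/
  K : NNReal
  /-- the flow -/
  Z : E × E → ℝ → E × E
  τ_pos : 0 < τ
  τ_le : τ ≤ 1
  R_pos : 0 < R
  ball_subset : closedBall y₀ R ⊆ U
  lipschitz : LipschitzOnWith K (geodesicField G) (closedBall (y₀, 0) R)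
  two_mul_K_mul_τ_le : 2 * K * τ ≤ κ
  κ_le : κ ≤ 1 / 2
  init : ∀ z ∈ closedBall (y₀, (0 : E)) (R / 2), Z z 0 = z
  mem : ∀ z ∈ closedBall (y₀, (0 : E)) (R / 2), ∀ t ∈ Icc 0 τ, Z z t ∈ closedBall (y₀, 0) R
  deriv : ∀ z ∈ closedBall (y₀, (0 : E)) (R / 2), ∀ t ∈ Icc 0 τ,
    HasDerivWithinAt (Z z) (geodesicField G (Z z t)) (Icc 0 τ) t

variable {G : E → E →L[ℝ] E →L[ℝ] ℝ} {U : Set E} {y₀ : E} {κ : ℝ}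

theorem IsLorentzMetricOn.exists_localGeodesicFlow [FiniteDimensional ℝ E]
    (hG : IsLorentzMetricOn G U) (hy₀ : y₀ ∈ U) (hκ0 : 0 < κ) (hκ : κ ≤ 1 / 2) :
    Nonempty (LocalGeodesicFlow G U y₀ κ) := by
  have := FiniteDimensional.complete ℝ E
  have hU : U ×ˢ (univ : Set E) ∈ 𝓝 (y₀, (0 : E)) :=
    (hG.isOpen.prod isOpen_univ).mem_nhds ⟨hy₀, trivial⟩
  have hfield : ContDiffAt ℝ 1 (geodesicField G) (y₀, 0) :=
    (hG.contDiffOn_geodesicField.contDiffAt hU).of_le (by simp)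
  obtain ⟨K, s, hs, hlip⟩ := hfield.exists_lipschitzOnWith
  obtain ⟨R, hR, hsub⟩ := nhds_basis_closedBall.mem_iff.1 (inter_mem hs hU)
  let τ := κ / 2 / (K + 1 : ℝ)
  have hτ : 0 < τ := by positivity
  have hτK : τ * (K + 1) = κ / 2 := div_mul_cancel₀ _ (by positivity)
  have hlipR := hlip.mono (hsub.trans inter_subset_left)
  have hflow := fun z (hz : z ∈ closedBall (y₀, (0 : E)) (R / 2)) =>
    exists_solution_of_lipschitzOnWith (geodesicField_zero_velocity G y₀) hR.le hτ.le
      (by nlinarith [K.2]) hlipR hz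
  choose! Z hZ0 hZ using hflow
  exact ⟨{
    τ, R, K, Z
    τ_pos := hτ
    τ_le := by nlinarith [K.2]
    R_pos := hR
    ball_subset := fun y hy => (hsub (mk_mem_closedBall hy (mem_closedBall_self hR.le))).2.1
    lipschitz := hlipR
    two_mul_K_mul_τ_le := by nlinarith [K.2]
    κ_le := hκ
    init := hZ0
    mem := fun z hz t ht => (hZ z hz t ht).1
    deriv := fun z hz t ht => (hZ z hz t ht).2 }⟩

namespace LocalGeodesicFlow

/-- The exponential map of the flow; it follows a geodesic for the time `τ` instead of `1`. -/
def exp (Φ : LocalGeodesicFlow G U y₀ κ) (y v : E) : E := (Φ.Z (y, v) Φ.τ).1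

/-- The end velocity of the geodesic that the exponential map follows. -/
def endVelocity (Φ : LocalGeodesicFlow G U y₀ κ) (y v : E) : E := (Φ.Z (y, v) Φ.τ).2

variable {Φ : LocalGeodesicFlow G U y₀ κ} {z z' : E × E} {y y' v v' : E} {t : ℝ}

lemma κ_nonneg (Φ : LocalGeodesicFlow G U y₀ κ) : 0 ≤ κ :=
  le_trans (by have := Φ.τ_pos; positivity) Φ.two_mul_K_mul_τ_le

lemma zero_mem_closedBall (Φ : LocalGeodesicFlow G U y₀ κ) :
    (0 : E) ∈ closedBall (0 : E) (Φ.R / 2) :=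
  mem_closedBall_self (by have := Φ.R_pos; positivity)

lemma τ_mem (Φ : LocalGeodesicFlow G U y₀ κ) : Φ.τ ∈ Icc 0 Φ.τ := ⟨Φ.τ_pos.le, le_rfl⟩

lemma fst_mem (hz : z ∈ closedBall (y₀, (0 : E)) (Φ.R / 2)) (ht : t ∈ Icc 0 Φ.τ) :
    (Φ.Z z t).1 ∈ U := by
  have hmem := Φ.mem z hz t ht
  rw [← closedBall_prod_same] at hmem
  exact Φ.ball_subset hmem.1

lemma continuousOn (hz : z ∈ closedBall (y₀, (0 : E)) (Φ.R / 2)) :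
    ContinuousOn (Φ.Z z) (Icc 0 Φ.τ) := fun t ht => (Φ.deriv z hz t ht).continuousWithinAt

lemma deriv_right (hz : z ∈ closedBall (y₀, (0 : E)) (Φ.R / 2)) :
    ∀ t ∈ Ico 0 Φ.τ, HasDerivWithinAt (Φ.Z z) (geodesicField G (Φ.Z z t)) (Ici t) t :=
  fun t ht => hasDerivWithinAt_Ici_of_Icc (Φ.deriv z hz t (Ico_subset_Icc_self ht)) ht

lemma dist_le (hz : z ∈ closedBall (y₀, (0 : E)) (Φ.R / 2))
    (hz' : z' ∈ closedBall (y₀, (0 : E)) (Φ.R / 2)) (ht : t ∈ Icc 0 Φ.τ) :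
    dist (Φ.Z z t) (Φ.Z z' t) ≤ 2 * dist z z' := by
  have hgronwall := dist_le_of_trajectories_ODE_of_mem (v := fun _ => geodesicField G)
    (s := fun _ => closedBall (y₀, (0 : E)) Φ.R) (fun _ _ => Φ.lipschitz) (continuousOn hz)
    (deriv_right hz) (fun t ht => Φ.mem z hz t (Ico_subset_Icc_self ht)) (continuousOn hz')
    (deriv_right hz') (fun t ht => Φ.mem z' hz' t (Ico_subset_Icc_self ht))
    (δ := dist z z') (by rw [Φ.init z hz, Φ.init z' hz']) t ht
  have hexp : Real.exp (Φ.K * (t - 0)) ≤ 2 := by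
    rw [← Real.le_log_iff_exp_le two_pos]
    have : Φ.K * (t - 0) ≤ Φ.K * Φ.τ := by gcongr; linarith [ht.2]
    linarith [Real.log_two_gt_d9, Φ.two_mul_K_mul_τ_le, Φ.κ_le]
  exact hgronwall.trans (by rw [mul_comm]; gcongr)

lemma norm_velocity_sub_le (hy : y ∈ closedBall y₀ (Φ.R / 2))
    (hv : v ∈ closedBall (0 : E) (Φ.R / 2)) (hv' : v' ∈ closedBall (0 : E) (Φ.R / 2))
    (ht : t ∈ Icc 0 Φ.τ) :
    ‖(Φ.Z (y, v) t).2 - (Φ.Z (y, v') t).2 - (v - v')‖ ≤ κ * ‖v - v'‖ := by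
  have hz := mk_mem_closedBall hy hv
  have hz' := mk_mem_closedBall hy hv'
  have hfield : ∀ s ∈ Ico 0 Φ.τ,
      ‖(geodesicField G (Φ.Z (y, v) s)).2 - (geodesicField G (Φ.Z (y, v') s)).2‖ ≤
        Φ.K * (2 * ‖v - v'‖) := by
    intro s hs
    have hs' := Ico_subset_Icc_self hs
    refine (norm_snd_le (geodesicField G (Φ.Z (y, v) s) - geodesicField G (Φ.Z (y, v') s))).trans ?_
    rw [← dist_eq_norm, ← dist_eq_norm v, ← dist_prod_same_left (x := y) (y₁ := v)]
    exact (Φ.lipschitz.dist_le_mul _ (Φ.mem _ hz s hs') _ (Φ.mem _ hz' s hs')).trans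
      (mul_le_mul_of_nonneg_left (dist_le hz hz' hs') Φ.K.2)
  have hmvt := norm_image_sub_le_of_norm_deriv_le_segment'
    (fun s hs => (hasDerivWithinAt_snd (Φ.deriv _ hz s hs)).sub
      (hasDerivWithinAt_snd (Φ.deriv _ hz' s hs))) hfield t ht
  simp only [Pi.sub_apply, Φ.init _ hz, Φ.init _ hz', sub_zero] at hmvt
  calc _ ≤ Φ.K * (2 * ‖v - v'‖) * t := hmvt
    _ ≤ Φ.K * (2 * ‖v - v'‖) * Φ.τ := by gcongr; exact ht.2
    _ = 2 * Φ.K * Φ.τ * ‖v - v'‖ := by ring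
    _ ≤ κ * ‖v - v'‖ := by gcongr; exact Φ.two_mul_K_mul_τ_le

lemma norm_exp_sub_exp_sub_le (hy : y ∈ closedBall y₀ (Φ.R / 2))
    (hv : v ∈ closedBall (0 : E) (Φ.R / 2)) (hv' : v' ∈ closedBall (0 : E) (Φ.R / 2)) :
    ‖Φ.exp y v - Φ.exp y v' - Φ.τ • (v - v')‖ ≤ κ * Φ.τ * ‖v - v'‖ := by
  have hz := mk_mem_closedBall hy hv
  have hz' := mk_mem_closedBall hy hv'
  have hmvt := norm_image_sub_le_of_norm_deriv_le_segment'
    (fun s hs => ((hasDerivWithinAt_fst (Φ.deriv _ hz s hs)).sub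
      (hasDerivWithinAt_fst (Φ.deriv _ hz' s hs))).sub
        ((hasDerivWithinAt_id s _).smul_const (v - v')))
    (fun s hs => by
      rw [one_smul]
      exact norm_velocity_sub_le hy hv hv' (Ico_subset_Icc_self hs)) Φ.τ Φ.τ_mem
  simp only [Pi.sub_apply, Φ.init _ hz, Φ.init _ hz', sub_self, zero_smul, sub_zero, id] at hmvt
  exact hmvt.trans_eq (by ring)

lemma exp_zero (hy : y ∈ closedBall y₀ (Φ.R / 2)) : Φ.exp y 0 = y := by
  have hz := mk_mem_closedBall hy Φ.zero_mem_closedBall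
  have hR := Φ.R_pos
  have hunique := dist_le_of_trajectories_ODE_of_mem (v := fun _ => geodesicField G)
    (s := fun _ => closedBall (y₀, (0 : E)) Φ.R) (g := fun _ => (y, 0)) (δ := 0)
    (fun _ _ => Φ.lipschitz) (continuousOn hz) (deriv_right hz)
    (fun t ht => Φ.mem _ hz t (Ico_subset_Icc_self ht)) continuousOn_const
    (fun _ _ => by rw [geodesicField_zero_velocity]; exact hasDerivWithinAt_const ..)
    (fun _ _ => closedBall_subset_closedBall (by linarith) hz)
    (by rw [Φ.init _ hz, dist_self]) Φ.τ Φ.τ_mem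
  rw [zero_mul, dist_le_zero] at hunique
  rw [exp, hunique]

lemma dist_exp_le (hy : y ∈ closedBall y₀ (Φ.R / 2)) (hv : v ∈ closedBall (0 : E) (Φ.R / 2))
    (hy' : y' ∈ closedBall y₀ (Φ.R / 2)) (hv' : v' ∈ closedBall (0 : E) (Φ.R / 2)) :
    dist (Φ.exp y v) (Φ.exp y' v') ≤ 2 * dist (y, v) (y', v') :=
  (le_max_left _ _).trans
    (dist_le (mk_mem_closedBall hy hv) (mk_mem_closedBall hy' hv') Φ.τ_mem)

lemma norm_sub_le (hy : y ∈ closedBall y₀ (Φ.R / 2)) (hv : v ∈ closedBall (0 : E) (Φ.R / 2))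
    (hv' : v' ∈ closedBall (0 : E) (Φ.R / 2)) :
    ‖v - v'‖ ≤ 2 / Φ.τ * ‖Φ.exp y v - Φ.exp y v'‖ := by
  have hτ := Φ.τ_pos
  have hnear := norm_exp_sub_exp_sub_le hy hv hv'
  have hsmul : ‖Φ.τ • (v - v')‖ = Φ.τ * ‖v - v'‖ := by rw [norm_smul, Real.norm_of_nonneg hτ.le]
  have htriangle := norm_sub_norm_le (Φ.τ • (v - v')) (Φ.exp y v - Φ.exp y v')
  rw [hsmul, norm_sub_rev (Φ.τ • (v - v'))] at htriangle
  have hκ : κ * Φ.τ * ‖v - v'‖ ≤ 1 / 2 * Φ.τ * ‖v - v'‖ := by gcongr; exact Φ.κ_le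
  rw [div_mul_eq_mul_div, le_div_iff₀ hτ]
  linarith

lemma surjOn_exp [CompleteSpace E] (hy : y ∈ closedBall y₀ (Φ.R / 2)) :
    SurjOn (Φ.exp y) (closedBall 0 (Φ.R / 2)) (closedBall y (Φ.τ * Φ.R / 4)) := by
  have hτ := Φ.τ_pos
  have hR := Φ.R_pos
  have hκ0 := Φ.κ_nonneg
  let τid : E →L[ℝ] E := Φ.τ • ContinuousLinearMap.id ℝ E
  let c : NNReal := ⟨κ * Φ.τ, by positivity⟩
  let inv : τid.NonlinearRightInverse :=
    { toFun := fun v => Φ.τ⁻¹ • v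
      nnnorm := ⟨Φ.τ⁻¹, by positivity⟩
      bound' := fun v => by rw [norm_smul, Real.norm_of_nonneg (by positivity)]; rfl
      right_inv' := fun v => by simp [τid, smul_smul, inv_mul_cancel₀ hτ.ne'] }
  have happrox : ApproximatesLinearOn (Φ.exp y) τid (closedBall 0 (Φ.R / 2)) c :=
    fun v hv v' hv' => norm_exp_sub_exp_sub_le hy hv hv'
  have hsurj := happrox.surjOn_closedBall_of_nonlinearRightInverse inv (ε := Φ.R / 2) (b := 0)
    (by positivity) subset_rfl
  rw [exp_zero hy] at hsurj
  refine hsurj.mono subset_rfl (closedBall_subset_closedBall ?_)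
  have hinv : ((inv.nnnorm : ℝ))⁻¹ = Φ.τ := inv_inv _
  have hc : (c : ℝ) = κ * Φ.τ := rfl
  rw [hinv, hc]
  nlinarith [mul_pos hτ hR, Φ.κ_le]

end LocalGeodesicFlow

end Flow

/-! ### Time-oriented Lorentzian metrics in coordinates -/

section Cones

open Metric

variable {E : Type*} [NormedAddCommGroup E] [NormedSpace ℝ E]
  {G : E → E →L[ℝ] E →L[ℝ] ℝ} {F : E → E} {U : Set E} {y₀ v : E}

/-- A smooth field of Lorentzian forms on an open set, with a continuous timelike vector field `F`
that singles out the future cones. -/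
structure IsOrientedLorentzOn (G : E → E →L[ℝ] E →L[ℝ] ℝ) (F : E → E) (U : Set E) : Prop
    extends IsLorentzMetricOn G U where
  future_continuousOn : ContinuousOn F U
  future_timelike : ∀ y ∈ U, G y (F y) (F y) < 0

namespace IsOrientedLorentzOn

lemma continuousAt_metric (hG : IsOrientedLorentzOn G F U) (hy₀ : y₀ ∈ U) : ContinuousAt G y₀ :=
  hG.contDiffOn.continuousOn.continuousAt (hG.isOpen.mem_nhds hy₀)

lemma continuousAt_sq (hG : IsOrientedLorentzOn G F U) (hy₀ : y₀ ∈ U) (v : E) :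
    ContinuousAt (fun z : E × E => G z.1 z.2 z.2) (y₀, v) :=
  (((hG.continuousAt_metric hy₀).comp continuousAt_fst).clm_apply continuousAt_snd).clm_apply
    continuousAt_snd

lemma continuousAt_apply_future (hG : IsOrientedLorentzOn G F U) (hy₀ : y₀ ∈ U) (v : E) :
    ContinuousAt (fun z : E × E => G z.1 z.2 (F z.1)) (y₀, v) :=
  have hF : ContinuousAt F y₀ := hG.future_continuousOn.continuousAt (hG.isOpen.mem_nhds hy₀)
  (((hG.continuousAt_metric hy₀).comp continuousAt_fst).clm_apply continuousAt_snd).clm_apply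
    (hF.comp continuousAt_fst)

lemma future_mem (hG : IsOrientedLorentzOn G F U) (hy₀ : y₀ ∈ U) :
    F y₀ ∈ timelikeCone (G y₀) (F y₀) :=
  ⟨hG.future_timelike y₀ hy₀, hG.future_timelike y₀ hy₀⟩

lemma exists_timelike_ball (hG : IsOrientedLorentzOn G F U) (hy₀ : y₀ ∈ U)
    (hv : v ∈ timelikeCone (G y₀) (F y₀)) :
    ∃ η > 0, ∀ y ∈ ball y₀ η, y ∈ U ∧ ∀ w ∈ ball v η, w ∈ timelikeCone (G y) (F y) := by
  have hU : ∀ᶠ z : E × E in 𝓝 (y₀, v), z.1 ∈ U :=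
    continuousAt_fst.eventually (hG.isOpen.mem_nhds hy₀)
  obtain ⟨η, hη, h⟩ := eventually_nhds_iff_ball.1
    (((hG.continuousAt_sq hy₀ v).eventually_lt_const hv.1).and
      (((hG.continuousAt_apply_future hy₀ v).eventually_lt_const hv.2).and hU))
  rw [← ball_prod_same] at h
  exact ⟨η, hη, fun y hy => ⟨(h (y, v) ⟨hy, mem_ball_self hη⟩).2.2, fun w hw =>
    ⟨(h (y, w) ⟨hy, hw⟩).1, (h (y, w) ⟨hy, hw⟩).2.1⟩⟩⟩

lemma mem_causalCone_of_tendsto (hG : IsOrientedLorentzOn G F U) (hy₀ : y₀ ∈ U) (hv : v ≠ 0)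
    {y w : ℕ → E} (hy : Tendsto y atTop (𝓝 y₀)) (hw : Tendsto w atTop (𝓝 v))
    (h : ∀ n, w n ∈ timelikeCone (G (y n)) (F (y n))) : v ∈ causalCone (G y₀) (F y₀) := by
  have hyw := hy.prodMk_nhds hw
  have hvv : G y₀ v v ≤ 0 :=
    le_of_tendsto' ((hG.continuousAt_sq hy₀ v).tendsto.comp hyw) fun n => (h n).1.le
  have hvF : G y₀ v (F y₀) ≤ 0 :=
    le_of_tendsto' ((hG.continuousAt_apply_future hy₀ v).tendsto.comp hyw) fun n => (h n).2.le
  exact ⟨hvv, hvF.lt_of_ne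
    ((hG.lorentz y₀ hy₀).ne_zero_of_causal (hG.future_timelike y₀ hy₀) hv hvv)⟩

lemma exists_lower_bound_of_unit_causal [FiniteDimensional ℝ E] (hG : IsOrientedLorentzOn G F U)
    (hy₀ : y₀ ∈ U) : ∃ k > 0, ∀ v ∈ sphere (0 : E) 1, G y₀ v v ≤ 0 → G y₀ v (F y₀) ≤ 0 →
      k ≤ (-G y₀ (F y₀)) v := by
  have hsq : IsClosed {v | G y₀ v v ≤ 0} := isClosed_le (by fun_prop) continuous_const
  have hF : IsClosed {v | G y₀ v (F y₀) ≤ 0} := isClosed_le (by fun_prop) continuous_const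
  have hpos : ∀ v ∈ sphere (0 : E) 1 ∩ ({v | G y₀ v v ≤ 0} ∩ {v | G y₀ v (F y₀) ≤ 0}),
      0 < (-G y₀ (F y₀)) v := by
    rintro v ⟨hv, hvv, hvF⟩
    rw [neg_apply, hG.symm hy₀, neg_pos]
    exact hvF.lt_of_ne ((hG.lorentz y₀ hy₀).ne_zero_of_causal (hG.future_timelike y₀ hy₀)
      (ne_zero_of_mem_unit_sphere ⟨v, hv⟩) hvv)
  obtain ⟨k, hk, hkle⟩ := ((isCompact_sphere 0 1).inter_right (hsq.inter hF)).exists_forall_le'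
    (-G y₀ (F y₀)).continuous.continuousOn hpos
  exact ⟨k, hk, fun v hv hvv hvF => hkle v ⟨hv, hvv, hvF⟩⟩

-- The form `-G y₀ (F y₀)` is the differential of a time coordinate near `y₀`.
lemma exists_mul_norm_le_of_mem_causalCone [FiniteDimensional ℝ E]
    (hG : IsOrientedLorentzOn G F U) (hy₀ : y₀ ∈ U) :
    ∃ k > 0, ∀ᶠ y in 𝓝 y₀, ∀ v ∈ causalCone (G y) (F y), k * ‖v‖ ≤ (-G y₀ (F y₀)) v := by
  obtain ⟨k, hk, hkle⟩ := hG.exists_lower_bound_of_unit_causal hy₀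
  refine ⟨k / 2, by positivity, ?_⟩
  have hunit : ∀ᶠ y in 𝓝 y₀, ∀ v ∈ sphere (0 : E) 1,
      v ∈ causalCone (G y) (F y) → k / 2 < (-G y₀ (F y₀)) v := by
    refine (isCompact_sphere 0 1).eventually_forall_of_forall_eventually fun v hv => ?_
    by_cases hvv : G y₀ v v ≤ 0
    · by_cases hvF : G y₀ v (F y₀) ≤ 0
      · have hkv : k / 2 < (-G y₀ (F y₀)) v := by linarith [hkle v hv hvv hvF]
        have hcont : ContinuousAt (fun z : E × E => (-G y₀ (F y₀)) z.2) (y₀, v) := by fun_prop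
        filter_upwards [hcont.eventually_const_lt hkv] with z hz _ using hz
      · filter_upwards [(hG.continuousAt_apply_future hy₀ v).eventually_const_lt (not_le.1 hvF)]
          with z hz hz' using absurd hz'.2 hz.le.not_gt
    · filter_upwards [(hG.continuousAt_sq hy₀ v).eventually_const_lt (not_le.1 hvv)]
        with z hz hz' using absurd hz'.1 hz.not_ge
  filter_upwards [hunit] with y hy v hv
  have hv0 : 0 < ‖v‖ := norm_pos_iff.2 (ne_zero_of_mem_causalCone hv)
  have hscaled := hy (‖v‖⁻¹ • v) (by simp [norm_smul, hv0.ne'])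
    (smul_mem_causalCone (by positivity) hv)
  rw [map_smul, smul_eq_mul, inv_mul_eq_div, lt_div_iff₀ hv0] at hscaled
  exact hscaled.le

end IsOrientedLorentzOn

-- The hypotheses say that passing from the old form to `B` worsens the square of `v` by at most
-- `s * Λ * ‖v‖ ^ 2`, which the cross term of order `s * ‖v‖ * p` compensates.
lemma IsLorentzForm.add_smul_mem_timelikeCone {B : E →L[ℝ] E →L[ℝ] ℝ} (hB : IsLorentzForm B)
    {e v : E} {s k Λ p : ℝ} (hs : 0 < s) (hk : 0 < k) (hΛ : 0 ≤ Λ) (hv : v ≠ 0) (he : B e e < 0)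
    (hp : k * ‖v‖ ≤ p) (hev : B e v ≤ -(k / 2) * ‖v‖) (hvv : B v v ≤ s * Λ * ‖v‖ ^ 2) :
    v + (s * ((Λ + 1) / k ^ 2 * p)) • e ∈ timelikeCone B e := by
  have hv0 : 0 < ‖v‖ := norm_pos_iff.2 hv
  set c := s * ((Λ + 1) / k ^ 2 * p) with hc
  have hck : s * (Λ + 1) * ‖v‖ ≤ c * k := by
    have : c * k = s * (Λ + 1) * (p / k) := by rw [hc]; field_simp
    rw [this]
    gcongr
    rwa [le_div_iff₀ hk, mul_comm]
  have hc0 : 0 < c := pos_of_mul_pos_left (lt_of_lt_of_le (by positivity) hck) hk.le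
  constructor
  · calc B (v + c • e) (v + c • e) = B v v + 2 * c * B e v + c ^ 2 * B e e := by
          simp only [map_add, map_smul, add_apply, smul_apply, smul_eq_mul, hB.1 v e]
          ring
      _ ≤ s * Λ * ‖v‖ ^ 2 + 2 * c * (-(k / 2) * ‖v‖) + 0 := by
          gcongr
          exact mul_nonpos_of_nonneg_of_nonpos (sq_nonneg c) he.le
      _ = s * Λ * ‖v‖ ^ 2 - c * k * ‖v‖ := by ring
      _ ≤ s * Λ * ‖v‖ ^ 2 - s * (Λ + 1) * ‖v‖ * ‖v‖ := by gcongr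
      _ = -(s * ‖v‖ ^ 2) := by ring
      _ < 0 := neg_neg_of_pos (by positivity)
  · have hve : B v e < 0 := by
      rw [hB.1]
      exact hev.trans_lt (by nlinarith)
    simpa only [map_add, map_smul, add_apply, smul_apply, smul_eq_mul] using
      add_neg hve (mul_neg_of_pos_of_neg hc0 he)

namespace IsOrientedLorentzOn

lemma exists_pushUp [FiniteDimensional ℝ E] (hG : IsOrientedLorentzOn G F U) (hy₀ : y₀ ∈ U) :
    ∃ ℓ : E →L[ℝ] ℝ, ∃ ρ > 0, ∀ y ∈ ball y₀ ρ, ∀ s : ℝ, s ≠ 0 →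
      y + s • F y₀ ∈ ball y₀ ρ → ∀ v ∈ causalCone (G y) (F y),
        v + (|s| * ℓ v) • F y₀ ∈ timelikeCone (G (y + s • F y₀)) (F (y + s • F y₀)) := by
  obtain ⟨k, hk, hcone⟩ := hG.exists_mul_norm_le_of_mem_causalCone hy₀
  obtain ⟨Λ, V, hV, hΛ⟩ := (((hG.contDiffOn.contDiffAt (hG.isOpen.mem_nhds hy₀)).of_le
    (by simp : (1 : WithTop ℕ∞) ≤ ∞))).exists_lipschitzOnWith
  obtain ⟨η, hη, htimelike⟩ := hG.exists_timelike_ball hy₀ (hG.future_mem hy₀)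
  have hnear : ∀ᶠ y in 𝓝 y₀, ‖G y (F y₀) - G y₀ (F y₀)‖ < k / 2 := by
    have hcont : ContinuousAt (fun y => G y (F y₀)) y₀ :=
      (hG.continuousAt_metric hy₀).clm_apply continuousAt_const
    simpa only [dist_eq_norm] using hcont.eventually (ball_mem_nhds _ (half_pos hk))
  obtain ⟨ρ, hρ, hball⟩ := eventually_nhds_iff_ball.1
    (hcone.and (hnear.and ((eventually_mem_set.2 hV).and (ball_mem_nhds y₀ hη))))
  refine ⟨((Λ * ‖F y₀‖ + 1) / k ^ 2) • -G y₀ (F y₀), ρ, hρ, fun y hy s hs hys v hv => ?_⟩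
  set e := F y₀
  set y' := y + s • e with hy'
  obtain ⟨hkv, -, hyV, -⟩ := hball y hy
  obtain ⟨-, hclose, hy'V, hy'η⟩ := hball y' hys
  obtain ⟨hy'U, hcone'⟩ := htimelike y' hy'η
  have he := hcone' e (mem_ball_self hη)
  have hB := hG.lorentz y' hy'U
  have hev : G y' e v ≤ -(k / 2) * ‖v‖ := by
    have hdiff := (le_abs_self _).trans ((G y' e - G y₀ e).le_opNorm v)
    have hkv' := hkv v hv
    rw [neg_apply] at hkv'
    rw [sub_apply] at hdiff
    linarith [mul_le_mul_of_nonneg_right hclose.le (norm_nonneg v)]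
  have hvv : G y' v v ≤ |s| * (Λ * ‖e‖) * ‖v‖ ^ 2 := by
    have hLip : ‖G y' - G y‖ ≤ Λ * (|s| * ‖e‖) := by
      simpa [← dist_eq_norm, hy', norm_smul] using hΛ.dist_le_mul y' hy'V y hyV
    calc G y' v v = G y v v + (G y' - G y) v v := by simp
      _ ≤ 0 + ‖G y' - G y‖ * ‖v‖ * ‖v‖ :=
        add_le_add hv.1 ((le_abs_self _).trans ((G y' - G y).le_opNorm₂ v v))
      _ ≤ 0 + Λ * (|s| * ‖e‖) * ‖v‖ * ‖v‖ := by gcongr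
      _ = |s| * (Λ * ‖e‖) * ‖v‖ ^ 2 := by ring
  exact hB.mem_timelikeCone_of_mem (hG.future_timelike y' hy'U) he
    (hB.add_smul_mem_timelikeCone (abs_pos.2 hs) hk (by positivity)
      (ne_zero_of_mem_causalCone hv) he.1 (hkv v hv) hev hvv)

end IsOrientedLorentzOn

end Cones

/-! ### The Gauss lemma -/

section Gauss

open Metric

lemma exists_taylor_bound {V : Type*} [NormedAddCommGroup V] [NormedSpace ℝ V] {f : V → ℝ}
    {Ω s : Set V} (hΩ : IsOpen Ω) (hf : ContDiffOn ℝ 2 f Ω) (hs : IsCompact s) (hc : Convex ℝ s)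
    (hsΩ : s ⊆ Ω) :
    ∃ C : ℝ, 0 ≤ C ∧ ∀ x ∈ s, ∀ y ∈ s, |f y - f x - fderiv ℝ f x (y - x)| ≤ C * ‖y - x‖ ^ 2 := by
  have hf' : ContDiffOn ℝ 1 (fderiv ℝ f) Ω := hf.fderiv_of_isOpen hΩ (by norm_num)
  obtain ⟨C, hC⟩ := hs.exists_bound_of_continuousOn
    ((hf'.continuousOn_fderiv_of_isOpen hΩ le_rfl).mono hsΩ)
  have hLip : ∀ x ∈ s, ∀ y ∈ s, ‖fderiv ℝ f y - fderiv ℝ f x‖ ≤ C * ‖y - x‖ := fun x hx y hy =>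
    hc.norm_image_sub_le_of_norm_fderiv_le (fun z hz => (hf'.differentiableOn one_ne_zero z
      (hsΩ hz)).differentiableAt (hΩ.mem_nhds (hsΩ hz))) hC hx hy
  refine ⟨|C|, abs_nonneg _, fun x hx y hy => ?_⟩
  have hseg : segment ℝ x y ⊆ s := hc.segment_subset hx hy
  have hbound : ∀ z ∈ segment ℝ x y, ‖fderiv ℝ f z - fderiv ℝ f x‖ ≤ |C| * ‖y - x‖ := by
    intro z hz
    have hzx : ‖z - x‖ ≤ ‖y - x‖ := by
      rw [← dist_eq_norm, ← dist_eq_norm, dist_comm z, dist_comm y]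
      linarith [dist_add_dist_of_mem_segment hz, dist_nonneg (x := z) (y := y)]
    calc ‖fderiv ℝ f z - fderiv ℝ f x‖ ≤ C * ‖z - x‖ := hLip x hx z (hseg hz)
      _ ≤ |C| * ‖y - x‖ := by gcongr; exact le_abs_self C
  calc |f y - f x - fderiv ℝ f x (y - x)| ≤ |C| * ‖y - x‖ * ‖y - x‖ :=
        (convex_segment x y).norm_image_sub_le_of_norm_fderiv_le'
          (fun z hz => (hf.differentiableOn two_ne_zero z (hsΩ (hseg hz))).differentiableAt
            (hΩ.mem_nhds (hsΩ (hseg hz)))) hbound (left_mem_segment ℝ x y)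
          (right_mem_segment ℝ x y)
    _ = |C| * ‖y - x‖ ^ 2 := by ring

variable {E : Type*} [NormedAddCommGroup E] [NormedSpace ℝ E] [FiniteDimensional ℝ E]
  {G : E → E →L[ℝ] E →L[ℝ] ℝ} {F : E → E} {U : Set E} {y₀ y v x e : E} {κ η δ t : ℝ} {z z' : E × E}

namespace LocalGeodesicFlow

variable {Φ : LocalGeodesicFlow G U y₀ κ}

lemma energy_eq (hG : IsLorentzMetricOn G U) (hz : z ∈ closedBall (y₀, (0 : E)) (Φ.R / 2))
    (ht : t ∈ Icc 0 Φ.τ) : energy G (Φ.Z z t) = energy G z := by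
  have hderiv : ∀ s ∈ Ico 0 Φ.τ, HasDerivWithinAt (fun s => energy G (Φ.Z z s)) 0 (Ici s) s := by
    intro s hs
    have hU := fst_mem hz (Ico_subset_Icc_self hs)
    have henergy := ((hG.contDiffOn_energy.differentiableOn (by simp) _
      ⟨hU, mem_univ _⟩).differentiableAt
        ((hG.isOpen.prod isOpen_univ).mem_nhds ⟨hU, mem_univ _⟩)).hasFDerivAt
    exact (henergy.comp_hasDerivWithinAt s (deriv_right hz s hs)).congr_deriv
      (hG.fderiv_energy_geodesicField hU)
  have hcont : ContinuousOn (fun s => energy G (Φ.Z z s)) (Icc 0 Φ.τ) :=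
    hG.contDiffOn_energy.continuousOn.comp (continuousOn hz) fun s hs =>
      ⟨fst_mem hz hs, mem_univ _⟩
  have hconst : energy G (Φ.Z z t) = energy G (Φ.Z z 0) :=
    constant_of_has_deriv_right_zero hcont hderiv t ht
  rw [hconst, Φ.init z hz]

lemma apply_velocity_eq (hG : IsLorentzMetricOn G U)
    (hz : z ∈ closedBall (y₀, (0 : E)) (Φ.R / 2)) (ht : t ∈ Icc 0 Φ.τ) :
    G (Φ.Z z t).1 (Φ.Z z t).2 (Φ.Z z t).2 = G z.1 z.2 z.2 := by
  have h := energy_eq hG hz ht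
  unfold energy at h
  linarith

lemma hasDerivWithinAt_apply_separation (hG : IsLorentzMetricOn G U)
    (hz : z ∈ closedBall (y₀, (0 : E)) (Φ.R / 2)) (hz' : z' ∈ closedBall (y₀, (0 : E)) (Φ.R / 2))
    (ht : t ∈ Icc 0 Φ.τ) :
    HasDerivWithinAt (fun t => G (Φ.Z z t).1 (Φ.Z z t).2 ((Φ.Z z' t).1 - (Φ.Z z t).1))
      (fderiv ℝ (energy G) (Φ.Z z t) (Φ.Z z' t - Φ.Z z t)) (Icc 0 Φ.τ) t := by
  have hU := fst_mem hz ht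
  have hd := Φ.deriv z hz t ht
  have hd' := Φ.deriv z' hz' t ht
  refine (hG.hasDerivWithinAt_apply hU (hasDerivWithinAt_fst hd) (hasDerivWithinAt_snd hd)
    ((hasDerivWithinAt_fst hd').sub (hasDerivWithinAt_fst hd))).congr_deriv ?_
  simp only [geodesicField, Pi.sub_apply]
  rw [hG.spray_spec hU, hG.fderiv_energy hU, christoffelOf]
  simp only [Prod.fst_sub, Prod.snd_sub]
  ring

-- By conservation of energy, `t (energy (y, v') - energy (y, v)) - g(velocity, separation)` has as
-- its derivative the second-order Taylor remainder of the energy between the two geodesics.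
theorem exists_gauss_bound (Φ : LocalGeodesicFlow G U y₀ κ) (hG : IsLorentzMetricOn G U) :
    ∃ C : ℝ, 0 ≤ C ∧ ∀ y ∈ closedBall y₀ (Φ.R / 2),
      ∀ v ∈ closedBall (0 : E) (Φ.R / 2), ∀ v' ∈ closedBall (0 : E) (Φ.R / 2),
      |Φ.τ * (energy G (y, v') - energy G (y, v))
        - G (Φ.exp y v) (Φ.endVelocity y v) (Φ.exp y v' - Φ.exp y v)| ≤ C * ‖v' - v‖ ^ 2 := by
  have hball : closedBall (y₀, (0 : E)) Φ.R ⊆ U ×ˢ univ := by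
    rw [← closedBall_prod_same]
    exact prod_mono Φ.ball_subset (subset_univ _)
  obtain ⟨C, hC0, hC⟩ := exists_taylor_bound (hG.isOpen.prod isOpen_univ)
    (hG.contDiffOn_energy.of_le (WithTop.coe_le_coe.2 (le_top (a := (2 : ℕ∞)))))
    (isCompact_closedBall (y₀, (0 : E)) Φ.R) (convex_closedBall _ _) hball
  refine ⟨4 * C, by positivity, fun y hy v hv v' hv' => ?_⟩
  have hz := mk_mem_closedBall hy hv
  have hz' := mk_mem_closedBall hy hv'
  set A := energy G (y, v') - energy G (y, v) with hA
  have hremainder : ∀ t ∈ Ico 0 Φ.τ,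
      ‖1 * A - fderiv ℝ (energy G) (Φ.Z (y, v) t) (Φ.Z (y, v') t - Φ.Z (y, v) t)‖ ≤
        4 * C * ‖v' - v‖ ^ 2 := by
    intro t ht
    have ht' := Ico_subset_Icc_self ht
    have hdist : ‖Φ.Z (y, v') t - Φ.Z (y, v) t‖ ≤ 2 * ‖v' - v‖ := by
      have h := dist_le hz' hz ht'
      rwa [dist_prod_same_left, dist_eq_norm, dist_eq_norm] at h
    rw [one_mul, hA, ← energy_eq hG hz ht', ← energy_eq hG hz' ht', Real.norm_eq_abs]
    calc _ ≤ C * ‖Φ.Z (y, v') t - Φ.Z (y, v) t‖ ^ 2 :=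
          hC _ (Φ.mem _ hz t ht') _ (Φ.mem _ hz' t ht')
      _ ≤ C * (2 * ‖v' - v‖) ^ 2 := by gcongr
      _ = 4 * C * ‖v' - v‖ ^ 2 := by ring
  have hmvt := norm_image_sub_le_of_norm_deriv_le_segment'
    (fun t ht => ((hasDerivWithinAt_id t (Icc 0 Φ.τ)).mul_const A).sub
      (hasDerivWithinAt_apply_separation hG hz hz' ht)) hremainder Φ.τ Φ.τ_mem
  simp only [Pi.sub_apply, Φ.init _ hz, Φ.init _ hz', id, sub_self, map_zero, zero_mul, sub_zero]
    at hmvt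
  calc _ ≤ 4 * C * ‖v' - v‖ ^ 2 * Φ.τ := hmvt
    _ ≤ 4 * C * ‖v' - v‖ ^ 2 := mul_le_of_le_one_right (by positivity) Φ.τ_le

omit [FiniteDimensional ℝ E] in
lemma snd_ne_zero (hz : z ∈ closedBall (y₀, (0 : E)) (Φ.R / 2)) (hz0 : z.2 ≠ 0)
    (ht : t ∈ Icc 0 Φ.τ) : (Φ.Z z t).2 ≠ 0 := by
  intro h
  have hsub : Icc 0 t ⊆ Icc 0 Φ.τ := Icc_subset_Icc_right ht.2
  have hfield : geodesicField G (Φ.Z z t) = 0 := by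
    rw [← Prod.mk.eta (p := Φ.Z z t), h, geodesicField_zero_velocity]
  have hconst : EqOn (Φ.Z z) (fun _ => Φ.Z z t) (Icc 0 t) :=
    ODE_solution_unique_of_mem_Icc_left (v := fun _ => geodesicField G)
      (s := fun _ => closedBall (y₀, (0 : E)) Φ.R) (fun _ _ => Φ.lipschitz)
      ((continuousOn hz).mono hsub)
      (fun s hs => (Φ.deriv z hz s (hsub (Ioc_subset_Icc_self hs))).mono_of_mem_nhdsWithin
        (mem_of_superset (Icc_mem_nhdsLE hs.1) (Icc_subset_Icc_right (hs.2.trans ht.2))))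
      (fun s hs => Φ.mem z hz s (hsub (Ioc_subset_Icc_self hs))) continuousOn_const
      (fun s _ => by rw [hfield]; exact hasDerivWithinAt_const ..) (fun _ _ => Φ.mem z hz t ht) rfl
  have hinit := hconst (left_mem_Icc.2 ht.1)
  rw [Φ.init z hz] at hinit
  exact hz0 (by rw [hinit]; exact h)

lemma mem_causalCone (hG : IsOrientedLorentzOn G F U)
    (hz : z ∈ closedBall (y₀, (0 : E)) (Φ.R / 2)) (hzc : z.2 ∈ causalCone (G z.1) (F z.1))
    (ht : t ∈ Icc 0 Φ.τ) : (Φ.Z z t).2 ∈ causalCone (G (Φ.Z z t).1) (F (Φ.Z z t).1) := by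
  have hcausal : ∀ s ∈ Icc 0 Φ.τ, G (Φ.Z z s).1 (Φ.Z z s).2 (Φ.Z z s).2 ≤ 0 := fun s hs =>
    (apply_velocity_eq hG.toIsLorentzMetricOn hz hs).trans_le hzc.1
  have hmaps : MapsTo (fun s => (Φ.Z z s).1) (Icc 0 Φ.τ) U := fun s hs => fst_mem hz hs
  have hcont : ContinuousOn (fun s => G (Φ.Z z s).1 (Φ.Z z s).2 (F (Φ.Z z s).1)) (Icc 0 Φ.τ) :=
    ((hG.contDiffOn.continuousOn.comp (continuousOn hz).fst hmaps).clm_apply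
      (continuousOn hz).snd).clm_apply (hG.future_continuousOn.comp (continuousOn hz).fst hmaps)
  refine ⟨hcausal t ht, ?_⟩
  by_contra! h
  have hinit : G (Φ.Z z 0).1 (Φ.Z z 0).2 (F (Φ.Z z 0).1) ≤ 0 := by
    rw [Φ.init z hz]
    exact hzc.2.le
  obtain ⟨s, hs, hs0⟩ := intermediate_value_Icc ht.1
    (hcont.mono (Icc_subset_Icc_right ht.2)) ⟨hinit, h⟩
  have hs' : s ∈ Icc 0 Φ.τ := Icc_subset_Icc_right ht.2 hs
  have hsU := fst_mem hz hs'
  exact (hG.lorentz _ hsU).ne_zero_of_causal (hG.future_timelike _ hsU)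
    (snd_ne_zero hz (ne_zero_of_mem_causalCone hzc) hs') (hcausal s hs') hs0

lemma mem_timelikeCone (hG : IsOrientedLorentzOn G F U)
    (hz : z ∈ closedBall (y₀, (0 : E)) (Φ.R / 2)) (hzt : z.2 ∈ timelikeCone (G z.1) (F z.1))
    (ht : t ∈ Icc 0 Φ.τ) : (Φ.Z z t).2 ∈ timelikeCone (G (Φ.Z z t).1) (F (Φ.Z z t).1) :=
  ⟨(apply_velocity_eq hG.toIsLorentzMetricOn hz ht).trans_lt hzt.1,
    (mem_causalCone hG hz (timelikeCone_subset_causalCone hzt) ht).2⟩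

/-! ### Causal curves stay in the timelike image of a point -/

/-- The points reached from `y` along future timelike geodesics of the flow. -/
def timelikeImage (Φ : LocalGeodesicFlow G U y₀ κ) (F : E → E) (y : E) : Set E :=
  Φ.exp y '' (closedBall 0 (Φ.R / 2) ∩ timelikeCone (G y) (F y))

/-- An inverse of the exponential map at `y`. It is meaningful on `closedBall y (Φ.τ * Φ.R / 4)`,
which the exponential map covers, and has junk values off the range of the exponential map. -/
def log (Φ : LocalGeodesicFlow G U y₀ κ) (y : E) : E → E :=
  Function.invFunOn (Φ.exp y) (closedBall 0 (Φ.R / 2))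

lemma log_mem (hy : y ∈ closedBall y₀ (Φ.R / 2)) (hx : x ∈ closedBall y (Φ.τ * Φ.R / 4)) :
    Φ.log y x ∈ closedBall 0 (Φ.R / 2) :=
  have := FiniteDimensional.complete ℝ E
  Function.invFunOn_mem (surjOn_exp hy hx)

lemma exp_log (hy : y ∈ closedBall y₀ (Φ.R / 2)) (hx : x ∈ closedBall y (Φ.τ * Φ.R / 4)) :
    Φ.exp y (Φ.log y x) = x :=
  have := FiniteDimensional.complete ℝ E
  Function.invFunOn_eq (surjOn_exp hy hx)

lemma log_exp (hy : y ∈ closedBall y₀ (Φ.R / 2)) (hv : v ∈ closedBall (0 : E) (Φ.R / 2))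
    (hx : Φ.exp y v ∈ closedBall y (Φ.τ * Φ.R / 4)) : Φ.log y (Φ.exp y v) = v := by
  have h := norm_sub_le hy (log_mem hy hx) hv
  rwa [exp_log hy hx, sub_self, norm_zero, mul_zero, norm_le_zero_iff, sub_eq_zero] at h

lemma norm_log_sub_le {x' : E} (hy : y ∈ closedBall y₀ (Φ.R / 2))
    (hx : x ∈ closedBall y (Φ.τ * Φ.R / 4)) (hx' : x' ∈ closedBall y (Φ.τ * Φ.R / 4)) :
    ‖Φ.log y x - Φ.log y x'‖ ≤ 2 / Φ.τ * ‖x - x'‖ := by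
  simpa only [exp_log hy hx, exp_log hy hx'] using norm_sub_le hy (log_mem hy hx) (log_mem hy hx')

lemma continuousOn_log (hy : y ∈ closedBall y₀ (Φ.R / 2)) :
    ContinuousOn (Φ.log y) (closedBall y (Φ.τ * Φ.R / 4)) := by
  have hτ := Φ.τ_pos
  refine (LipschitzOnWith.of_dist_le_mul (K := ⟨2 / Φ.τ, by positivity⟩) ?_).continuousOn
  intro x hx x' hx'
  rw [dist_eq_norm, dist_eq_norm]
  exact norm_log_sub_le hy hx hx'

theorem hasFDerivWithinAt_energy_log (hG : IsLorentzMetricOn G U)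
    (hy : y ∈ closedBall y₀ (Φ.R / 2)) (hx : x ∈ closedBall y (Φ.τ * Φ.R / 4)) :
    HasFDerivWithinAt (fun x => energy G (y, Φ.log y x))
      (Φ.τ⁻¹ • G x (Φ.endVelocity y (Φ.log y x))) (closedBall y (Φ.τ * Φ.R / 4)) x := by
  obtain ⟨C, hC0, hC⟩ := Φ.exists_gauss_bound hG
  have hτ := Φ.τ_pos
  rw [hasFDerivWithinAt_iff_isLittleO]
  refine Asymptotics.IsBigO.trans_isLittleO (g := fun x' => ‖x' - x‖ ^ 2) ?_
    ((Asymptotics.isLittleO_pow_sub_sub x one_lt_two).mono nhdsWithin_le_nhds)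
  refine Asymptotics.IsBigO.of_bound (Φ.τ⁻¹ * (C * (2 / Φ.τ) ^ 2)) ?_
  filter_upwards [self_mem_nhdsWithin] with x' hx'
  have hgauss := hC y hy _ (log_mem hy hx) _ (log_mem hy hx')
  rw [exp_log hy hx, exp_log hy hx'] at hgauss
  rw [Real.norm_eq_abs, Real.norm_of_nonneg (by positivity : 0 ≤ ‖x' - x‖ ^ 2)]
  calc |energy G (y, Φ.log y x') - energy G (y, Φ.log y x)
        - (Φ.τ⁻¹ • G x (Φ.endVelocity y (Φ.log y x))) (x' - x)|
      = Φ.τ⁻¹ * |Φ.τ * (energy G (y, Φ.log y x') - energy G (y, Φ.log y x))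
        - G x (Φ.endVelocity y (Φ.log y x)) (x' - x)| := by
        rw [← abs_of_pos (inv_pos.2 hτ), ← abs_mul, abs_of_pos (inv_pos.2 hτ), mul_sub,
          inv_mul_cancel_left₀ hτ.ne', smul_apply, smul_eq_mul]
    _ ≤ Φ.τ⁻¹ * (C * (2 / Φ.τ * ‖x' - x‖) ^ 2) := by
        gcongr
        refine hgauss.trans ?_
        gcongr
        exact norm_log_sub_le hy hx' hx
    _ = Φ.τ⁻¹ * (C * (2 / Φ.τ) ^ 2) * ‖x' - x‖ ^ 2 := by ring

lemma exists_hasDerivWithinAt_energy_log_nonpos (hG : IsOrientedLorentzOn G F U)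
    (hy : y ∈ closedBall y₀ (Φ.R / 2)) {c : ℝ → E} {c' : E} {s : Set ℝ}
    (hc : ∀ u ∈ s, c u ∈ closedBall y (Φ.τ * Φ.R / 4)) (ht : t ∈ s)
    (hderiv : HasDerivWithinAt c c' s t) (hcausal : c' ∈ causalCone (G (c t)) (F (c t)))
    (hlog : Φ.log y (c t) ∈ timelikeCone (G y) (F y)) :
    ∃ h' ≤ 0, HasDerivWithinAt (fun u => energy G (y, Φ.log y (c u))) h' s t := by
  refine ⟨_, ?_, (hasFDerivWithinAt_energy_log hG.toIsLorentzMetricOn hy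
    (hc t ht)).comp_hasDerivWithinAt t hderiv hc⟩
  have hz := mk_mem_closedBall hy (log_mem hy (hc t ht))
  have hend := mem_timelikeCone hG hz hlog Φ.τ_mem
  have hexp : (Φ.Z (y, Φ.log y (c t)) Φ.τ).1 = c t := exp_log hy (hc t ht)
  have hU : c t ∈ U := hexp ▸ fst_mem hz Φ.τ_mem
  rw [hexp] at hend
  exact mul_nonpos_of_nonneg_of_nonpos (inv_pos.2 Φ.τ_pos).le
    ((hG.lorentz _ hU).neg_of_timelike_causal (hG.future_timelike _ hU) hend hcausal).le

theorem mem_timelikeImage_of_causal (hG : IsOrientedLorentzOn G F U)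
    (hy : y ∈ closedBall y₀ (Φ.τ * Φ.R / 8)) {c : ℝ → E} {a b : ℝ} (hab : a ≤ b)
    (hc : ContinuousOn c (Icc a b))
    (hmem : ∀ t ∈ Icc a b, c t ∈ closedBall y₀ (Φ.τ * Φ.R / 8))
    (hderiv : ∀ t ∈ Ico a b,
      ∃ c' ∈ causalCone (G (c t)) (F (c t)), HasDerivWithinAt c c' (Ici t) t)
    (ha : c a ∈ Φ.timelikeImage F y) : c b ∈ Φ.timelikeImage F y := by
  have hτR : Φ.τ * Φ.R ≤ Φ.R := mul_le_of_le_one_left Φ.R_pos.le Φ.τ_le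
  have hR := Φ.R_pos
  have hy' : y ∈ closedBall y₀ (Φ.R / 2) := closedBall_subset_closedBall (by linarith) hy
  have hyU : y ∈ U := Φ.ball_subset (closedBall_subset_closedBall (by linarith) hy)
  have hcy : ∀ t ∈ Icc a b, c t ∈ closedBall y (Φ.τ * Φ.R / 4) := fun t ht => by
    have hct := hmem t ht
    rw [mem_closedBall] at hct hy ⊢
    linarith [dist_triangle_right (c t) y y₀]
  have hlog_a : Φ.log y (c a) ∈ timelikeCone (G y) (F y) := by
    obtain ⟨v, ⟨hv, hvt⟩, hva⟩ := ha
    rw [← hva, log_exp hy' hv (hva ▸ hcy a (left_mem_Icc.2 hab))]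
    exact hvt
  have hlog : ∀ t ∈ Icc a b, Φ.log y (c t) ∈ timelikeCone (G y) (F y) := by
    refine (hG.lorentz y hyU).forall_mem_timelikeCone_of_deriv_nonpos (hG.future_timelike y hyU)
      ((continuousOn_log hy').comp hc hcy) hlog_a fun t ht hlog_t => ?_
    obtain ⟨c', hc', hd⟩ := hderiv t ht
    obtain ⟨h', hh', hdh⟩ := exists_hasDerivWithinAt_energy_log_nonpos hG hy' (s := Icc t b)
      (fun u hu => hcy u ⟨ht.1.trans hu.1, hu.2⟩) (left_mem_Icc.2 ht.2.le)
      (hd.mono Icc_subset_Ici_self) hc' hlog_t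
    refine ⟨2 * h', by linarith, ?_⟩
    have heq : (fun t => G y (Φ.log y (c t)) (Φ.log y (c t))) =
        fun t => 2 * energy G (y, Φ.log y (c t)) := by
      funext t
      simp only [energy]
      ring
    rw [heq]
    exact (hdh.mono_of_mem_nhdsWithin (Icc_mem_nhdsGE ht.2)).const_mul 2
  exact ⟨_, ⟨log_mem hy' (hcy b (right_mem_Icc.2 hab)), hlog b (right_mem_Icc.2 hab)⟩,
    exp_log hy' (hcy b (right_mem_Icc.2 hab))⟩

theorem add_smul_mem_timelikeImage
    (hη : ∀ v ∈ ball e η, v ∈ timelikeCone (G y) (F y)) (hκη : 2 * κ * ‖e‖ < η)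
    (hδ : 0 < δ) (hy : y ∈ closedBall y₀ (Φ.R / 2)) (hδe : δ * ‖e‖ ≤ Φ.τ * Φ.R / 4) :
    y + δ • e ∈ Φ.timelikeImage F y := by
  have hτ := Φ.τ_pos
  have hx : y + δ • e ∈ closedBall y (Φ.τ * Φ.R / 4) := by
    rwa [mem_closedBall_iff_norm, add_sub_cancel_left, norm_smul, Real.norm_of_nonneg hδ.le]
  set w := Φ.log y (y + δ • e)
  have hwm := log_mem hy hx
  refine ⟨w, ⟨hwm, ?_⟩, exp_log hy hx⟩
  have hpos : 0 < Φ.τ / δ := by positivity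
  rw [← smul_mem_timelikeCone_iff hpos]
  refine hη _ ?_
  have hnear := norm_exp_sub_exp_sub_le hy hwm Φ.zero_mem_closedBall
  rw [exp_log hy hx, exp_zero hy, add_sub_cancel_left, sub_zero] at hnear
  have hclose : ‖(Φ.τ / δ) • w - e‖ ≤ κ * ‖(Φ.τ / δ) • w‖ := by
    calc ‖(Φ.τ / δ) • w - e‖ = δ⁻¹ * ‖δ • e - Φ.τ • w‖ := by
          rw [norm_sub_rev (δ • e), ← Real.norm_of_nonneg (inv_pos.2 hδ).le, ← norm_smul, smul_sub,
            smul_smul, smul_smul, inv_mul_cancel₀ hδ.ne', one_smul, ← div_eq_inv_mul]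
      _ ≤ δ⁻¹ * (κ * Φ.τ * ‖w‖) := by gcongr
      _ = κ * ‖(Φ.τ / δ) • w‖ := by
          rw [norm_smul, Real.norm_of_nonneg hpos.le]
          ring
  have htwice : ‖(Φ.τ / δ) • w‖ ≤ 2 * ‖e‖ := by
    nlinarith [norm_nonneg ((Φ.τ / δ) • w), norm_le_norm_sub_add ((Φ.τ / δ) • w) e, Φ.κ_le]
  rw [mem_ball_iff_norm]
  nlinarith [Φ.κ_nonneg]

end LocalGeodesicFlow

end Gauss

/-! ### Spacetimes in charts -/

section Charts

variable {d : ℕ} {M : Type*} [TopologicalSpace M] [ChartedSpace (Coord d) M]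
  [IsManifold (𝓡 d) ∞ M] {g : LorentzStructure d M} {x₀ x : M} {y : Coord d}

/-- The differential at `x` of the chart at `x₀`; it takes tangent vectors to their coordinates. -/
def chartDeriv (x₀ x : M) : TangentSpace (𝓡 d) x →L[ℝ] Coord d :=
  mfderiv (𝓡 d) 𝓘(ℝ, Coord d) (extChartAt (𝓡 d) x₀) x

/-- The differential at `y` of the inverse of the chart at `x₀`; it takes coordinates to tangent
vectors. -/
def chartSymmDeriv (x₀ : M) (y : Coord d) :
    Coord d →L[ℝ] TangentSpace (𝓡 d) ((extChartAt (𝓡 d) x₀).symm y) :=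
  mfderiv 𝓘(ℝ, Coord d) (𝓡 d) (extChartAt (𝓡 d) x₀).symm y

/-- The time orientation in the coordinates of the chart at `x₀`, at the coordinate point `y`. -/
def coordFuture (g : LorentzStructure d M) (x₀ : M) (y : Coord d) : Coord d :=
  chartDeriv x₀ ((extChartAt (𝓡 d) x₀).symm y) (g.future ((extChartAt (𝓡 d) x₀).symm y))

lemma contMDiffOn_chartSymmDeriv (x₀ : M) (v : Coord d) :
    ContMDiffOn 𝓘(ℝ, Coord d) (𝓡 d).tangent ∞
      (fun y => (⟨(extChartAt (𝓡 d) x₀).symm y, chartSymmDeriv x₀ y v⟩ : TangentBundle (𝓡 d) M))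
      (extChartAt (𝓡 d) x₀).target := by
  have hopen : IsOpen (extChartAt (𝓡 d) x₀).target := isOpen_extChartAt_target x₀
  have htangent := (contMDiffOn_extChartAt_symm (I := 𝓡 d) (n := ∞) x₀).contMDiffOn_tangentMapWithin
    (m := ∞) (by simp) hopen.uniqueMDiffOn
  have hconst : ContMDiff 𝓘(ℝ, Coord d) 𝓘(ℝ, Coord d).tangent ∞
      (fun y : Coord d => (⟨y, v⟩ : TangentBundle 𝓘(ℝ, Coord d) (Coord d))) :=
    contMDiff_vectorSpace_iff_contDiff.2 contDiff_const
  refine (htangent.comp (hconst.contMDiffOn (s := (extChartAt (𝓡 d) x₀).target))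
    fun y hy => hy).congr fun y hy => ?_
  simp only [Function.comp, tangentMapWithin, mfderivWithin_of_isOpen hopen hy]
  rfl

lemma contDiffOn_coordMetric (g : LorentzStructure d M) (x₀ : M) :
    ContDiffOn ℝ ∞ (coordMetric g x₀) (extChartAt (𝓡 d) x₀).target := by
  rw [contDiffOn_clm_apply]
  intro v
  rw [contDiffOn_clm_apply]
  intro w y hy
  have hmetric : ContMDiffOn 𝓘(ℝ, Coord d) ((𝓡 d).prod 𝓘(ℝ, Coord d →L[ℝ] Coord d →L[ℝ] ℝ)) ∞
      (fun y => Bundle.TotalSpace.mk' (Coord d →L[ℝ] Coord d →L[ℝ] ℝ)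
        (E := fun x : M => TangentSpace (𝓡 d) x →L[ℝ] TangentSpace (𝓡 d) x →L[ℝ] ℝ)
        ((extChartAt (𝓡 d) x₀).symm y) (g.metric ((extChartAt (𝓡 d) x₀).symm y)))
      (extChartAt (𝓡 d) x₀).target :=
    g.smooth.comp_contMDiffOn (contMDiffOn_extChartAt_symm (I := 𝓡 d) (n := ∞) x₀)
  have happly := ContMDiffOn.clm_bundle_apply₂ (F₁ := Coord d) (F₂ := Coord d) (F₃ := ℝ)
    (E₁ := fun x : M => TangentSpace (𝓡 d) x) (E₂ := fun x : M => TangentSpace (𝓡 d) x)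
    (E₃ := Bundle.Trivial M ℝ) (b := (extChartAt (𝓡 d) x₀).symm)
    (ψ := fun y => g.metric ((extChartAt (𝓡 d) x₀).symm y)) hmetric
    (contMDiffOn_chartSymmDeriv x₀ v) (contMDiffOn_chartSymmDeriv x₀ w) y hy
  rw [Bundle.contMDiffWithinAt_totalSpace] at happly
  exact happly.2.contDiffWithinAt

lemma chartDeriv_chartSymmDeriv (hy : y ∈ (extChartAt (𝓡 d) x₀).target) (v : Coord d) :
    chartDeriv x₀ ((extChartAt (𝓡 d) x₀).symm y) (chartSymmDeriv x₀ y v) = v := by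
  have h := mfderiv_extChartAt_comp_mfderivWithin_extChartAt_symm (I := 𝓡 d) hy
  rw [ModelWithCorners.range_eq_univ, mfderivWithin_univ] at h
  exact DFunLike.congr_fun h v

lemma chartSymmDeriv_chartDeriv (hy : y ∈ (extChartAt (𝓡 d) x₀).target)
    (v : TangentSpace (𝓡 d) ((extChartAt (𝓡 d) x₀).symm y)) :
    chartSymmDeriv x₀ y (chartDeriv x₀ ((extChartAt (𝓡 d) x₀).symm y) v) = v := by
  have h := mfderivWithin_extChartAt_symm_comp_mfderiv_extChartAt (I := 𝓡 d) hy
  rw [ModelWithCorners.range_eq_univ, mfderivWithin_univ] at h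
  exact DFunLike.congr_fun h v

lemma coordMetric_apply (x₀ : M) (y v w : Coord d) :
    coordMetric g x₀ y v w = g.metric ((extChartAt (𝓡 d) x₀).symm y)
      (chartSymmDeriv x₀ y v) (chartSymmDeriv x₀ y w) := rfl

lemma coordMetric_chartDeriv (hy : y ∈ (extChartAt (𝓡 d) x₀).target)
    (v w : TangentSpace (𝓡 d) ((extChartAt (𝓡 d) x₀).symm y)) :
    coordMetric g x₀ y (chartDeriv x₀ _ v) (chartDeriv x₀ _ w) = g.metric _ v w := by
  rw [coordMetric_apply, chartSymmDeriv_chartDeriv hy, chartSymmDeriv_chartDeriv hy]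

lemma chartSymmDeriv_mem_futureTimelike_iff (hy : y ∈ (extChartAt (𝓡 d) x₀).target) {v : Coord d} :
    chartSymmDeriv x₀ y v ∈ futureTimelike g ((extChartAt (𝓡 d) x₀).symm y) ↔
      v ∈ timelikeCone (coordMetric g x₀ y) (coordFuture g x₀ y) := by
  simp only [timelikeCone, futureTimelike, mem_ofPred_eq, coordFuture, coordMetric_apply,
    chartSymmDeriv_chartDeriv hy]

lemma chartSymmDeriv_mem_futureCausal_iff (hy : y ∈ (extChartAt (𝓡 d) x₀).target) {v : Coord d} :
    chartSymmDeriv x₀ y v ∈ futureCausal g ((extChartAt (𝓡 d) x₀).symm y) ↔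
      v ∈ causalCone (coordMetric g x₀ y) (coordFuture g x₀ y) := by
  simp only [causalCone, futureCausal, mem_ofPred_eq, coordFuture, coordMetric_apply,
    chartSymmDeriv_chartDeriv hy]

lemma chartDeriv_mem_timelikeCone_iff (hx : x ∈ (extChartAt (𝓡 d) x₀).source)
    {v : TangentSpace (𝓡 d) x} :
    chartDeriv x₀ x v ∈ timelikeCone (coordMetric g x₀ (extChartAt (𝓡 d) x₀ x))
      (coordFuture g x₀ (extChartAt (𝓡 d) x₀ x)) ↔ v ∈ futureTimelike g x := by
  obtain ⟨y, hy, rfl⟩ : ∃ y ∈ (extChartAt (𝓡 d) x₀).target, (extChartAt (𝓡 d) x₀).symm y = x :=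
    ⟨_, (extChartAt (𝓡 d) x₀).map_source hx, (extChartAt (𝓡 d) x₀).left_inv hx⟩
  rw [(extChartAt (𝓡 d) x₀).right_inv hy, ← chartSymmDeriv_mem_futureTimelike_iff hy,
    chartSymmDeriv_chartDeriv hy]

lemma chartDeriv_mem_causalCone_iff (hx : x ∈ (extChartAt (𝓡 d) x₀).source)
    {v : TangentSpace (𝓡 d) x} :
    chartDeriv x₀ x v ∈ causalCone (coordMetric g x₀ (extChartAt (𝓡 d) x₀ x))
      (coordFuture g x₀ (extChartAt (𝓡 d) x₀ x)) ↔ v ∈ futureCausal g x := by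
  obtain ⟨y, hy, rfl⟩ : ∃ y ∈ (extChartAt (𝓡 d) x₀).target, (extChartAt (𝓡 d) x₀).symm y = x :=
    ⟨_, (extChartAt (𝓡 d) x₀).map_source hx, (extChartAt (𝓡 d) x₀).left_inv hx⟩
  rw [(extChartAt (𝓡 d) x₀).right_inv hy, ← chartSymmDeriv_mem_futureCausal_iff hy,
    chartSymmDeriv_chartDeriv hy]

lemma chartDeriv_injective (hx : x ∈ (extChartAt (𝓡 d) x₀).source) :
    Function.Injective (chartDeriv (d := d) x₀ x) := by
  obtain ⟨y, hy, rfl⟩ : ∃ y ∈ (extChartAt (𝓡 d) x₀).target, (extChartAt (𝓡 d) x₀).symm y = x :=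
    ⟨_, (extChartAt (𝓡 d) x₀).map_source hx, (extChartAt (𝓡 d) x₀).left_inv hx⟩
  exact Function.LeftInverse.injective fun v => chartSymmDeriv_chartDeriv hy v

lemma chartDeriv_surjective (hx : x ∈ (extChartAt (𝓡 d) x₀).source) :
    Function.Surjective (chartDeriv (d := d) x₀ x) := by
  obtain ⟨y, hy, rfl⟩ : ∃ y ∈ (extChartAt (𝓡 d) x₀).target, (extChartAt (𝓡 d) x₀).symm y = x :=
    ⟨_, (extChartAt (𝓡 d) x₀).map_source hx, (extChartAt (𝓡 d) x₀).left_inv hx⟩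
  exact Function.RightInverse.surjective fun v => chartDeriv_chartSymmDeriv hy v

lemma continuousOn_chartDeriv (x₀ : M) :
    ContinuousOn (fun p : TangentBundle (𝓡 d) M => chartDeriv x₀ p.1 p.2)
      {p | p.1 ∈ (extChartAt (𝓡 d) x₀).source} := by
  have hopen : IsOpen (extChartAt (𝓡 d) x₀).source := isOpen_extChartAt_source x₀
  have hchart := contMDiffOn_extChartAt (I := 𝓡 d) (n := 1) (x := x₀)
  rw [← extChartAt_source (𝓡 d)] at hchart
  have hsnd : Continuous fun p : TangentBundle 𝓘(ℝ, Coord d) (Coord d) => p.2 :=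
    (contMDiff_snd_tangentBundle_modelSpace (I := 𝓘(ℝ, Coord d)) (n := 0)).continuous
  refine (hsnd.comp_continuousOn
    (hchart.continuousOn_tangentMapWithin le_rfl hopen.uniqueMDiffOn)).congr fun p hp => ?_
  simp only [Function.comp, tangentMapWithin, chartDeriv]
  rw [mfderivWithin_of_isOpen hopen hp]
  rfl

theorem isOrientedLorentzOn_coord (g : LorentzStructure d M) (x₀ : M) :
    IsOrientedLorentzOn (coordMetric g x₀) (coordFuture g x₀) (extChartAt (𝓡 d) x₀).target where
  isOpen := isOpen_extChartAt_target x₀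
  contDiffOn := contDiffOn_coordMetric g x₀
  lorentz y hy := by
    refine ⟨fun v w => g.symm _ _ _, ?_⟩
    obtain ⟨v, hv, hpos⟩ := g.signature ((extChartAt (𝓡 d) x₀).symm y)
    refine ⟨chartDeriv x₀ _ v, by rwa [coordMetric_chartDeriv hy], fun w hw hvw => ?_⟩
    rw [← chartDeriv_chartSymmDeriv hy w, coordMetric_chartDeriv hy] at hvw ⊢
    refine hpos _ (fun h => hw ?_) hvw
    rw [← chartDeriv_chartSymmDeriv hy w, h, map_zero]
  future_continuousOn :=
    (continuousOn_chartDeriv x₀).comp (g.future_continuous.comp_continuousOn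
      (continuousOn_extChartAt_symm x₀)) fun _ hy => (extChartAt (𝓡 d) x₀).map_target hy
  future_timelike y hy := by
    rw [coordFuture, coordMetric_chartDeriv hy]
    exact g.future_timelike _

end Charts

section ChartBall

variable (d : ℕ) {M : Type*} [TopologicalSpace M] [ChartedSpace (Coord d) M] (x₀ : M) {r : ℝ}

/-- The points of the chart domain at `x₀` whose coordinates lie in the open ball of radius `r`
about those of `x₀`. -/
def chartBall (r : ℝ) : Set M :=
  (extChartAt (𝓡 d) x₀).source ∩
    extChartAt (𝓡 d) x₀ ⁻¹' Metric.ball (extChartAt (𝓡 d) x₀ x₀) r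

lemma isOpen_chartBall : IsOpen (chartBall d x₀ r) :=
  (continuousOn_extChartAt x₀).isOpen_inter_preimage (isOpen_extChartAt_source x₀)
    Metric.isOpen_ball

lemma mem_chartBall_self (hr : 0 < r) : x₀ ∈ chartBall d x₀ r :=
  ⟨mem_extChartAt_source x₀, Metric.mem_ball_self hr⟩

lemma chartBall_subset_chartBall {r' : ℝ} (h : r ≤ r') : chartBall d x₀ r ⊆ chartBall d x₀ r' :=
  inter_subset_inter_right _ (preimage_mono (Metric.ball_subset_ball h))

lemma closure_chartBall_subset [T2Space M]
    (hr : Metric.closedBall (extChartAt (𝓡 d) x₀ x₀) r ⊆ (extChartAt (𝓡 d) x₀).target) :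
    closure (chartBall d x₀ r) ⊆ (extChartAt (𝓡 d) x₀).source ∩
      extChartAt (𝓡 d) x₀ ⁻¹' Metric.closedBall (extChartAt (𝓡 d) x₀ x₀) r := by
  set φ := extChartAt (𝓡 d) x₀
  have hcompact : IsCompact (φ.symm '' Metric.closedBall (φ x₀) r) :=
    (isCompact_closedBall _ _).image_of_continuousOn ((continuousOn_extChartAt_symm x₀).mono hr)
  have hsub : chartBall d x₀ r ⊆ φ.symm '' Metric.closedBall (φ x₀) r := fun x hx =>
    ⟨φ x, Metric.ball_subset_closedBall hx.2, φ.left_inv hx.1⟩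
  refine (closure_minimal hsub hcompact.isClosed).trans ?_
  rintro _ ⟨z, hz, rfl⟩
  exact ⟨φ.map_target (hr hz), by rwa [mem_preimage, φ.right_inv (hr hz)]⟩

end ChartBall

/-! ### Curves -/

section Curves

variable {d : ℕ} {M : Type*} [TopologicalSpace M] [ChartedSpace (Coord d) M]
  {C : ∀ x : M, Set (TangentSpace (𝓡 d) x)} {γ γ' : ℝ → M} {s s' : Set ℝ} {a b c t δ : ℝ}

/-- `γ` is a `C¹` curve on `[a, b]` all of whose velocities lie in the cone field `C`. These are the
pieces of the curves in the sense of `IsCurveIn`. -/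
structure IsC1CurveIn (C : ∀ x : M, Set (TangentSpace (𝓡 d) x)) (γ : ℝ → M) (a b : ℝ) : Prop where
  contMDiffOn : ContMDiffOn 𝓘(ℝ, ℝ) (𝓡 d) 1 γ (Icc a b)
  velocity_mem : ∀ t ∈ Icc a b, velocity γ (Icc a b) t ∈ C (γ t)

lemma mem_congr {x x' : M} (hx : x = x') {v v' : Coord d} (hv : v = v')
    (h : (v : TangentSpace (𝓡 d) x) ∈ C x) : (v' : TangentSpace (𝓡 d) x') ∈ C x' := by
  subst hx hv
  exact h

lemma velocity_mem_congr (h : EqOn γ γ' s) (ht : t ∈ s) (hv : velocity (d := d) γ s t ∈ C (γ t)) :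
    velocity (d := d) γ' s t ∈ C (γ' t) := by
  have hvel : (velocity (d := d) γ s t : Coord d) = velocity (d := d) γ' s t :=
    DFunLike.congr_fun (mfderivWithin_congr (I := 𝓘(ℝ, ℝ)) (I' := 𝓡 d)
      (fun x hx => (h hx).symm) (h ht).symm).symm (1 : ℝ)
  exact mem_congr (h ht) hvel hv

lemma velocity_eq_of_subset (hγ : MDifferentiableWithinAt 𝓘(ℝ, ℝ) (𝓡 d) γ s t) (hs : s' ⊆ s)
    (hu : UniqueDiffWithinAt ℝ s' t) : velocity (d := d) γ s' t = velocity γ s t :=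
  DFunLike.congr_fun ((hγ.hasMFDerivWithinAt.mono hs).mfderivWithin hu.uniqueMDiffWithinAt) (1 : ℝ)

lemma velocity_comp_add_const (hab : a < b)
    (hγ : MDifferentiableOn 𝓘(ℝ, ℝ) (𝓡 d) γ (Icc (a + δ) (b + δ))) (ht : t ∈ Icc a b) :
    velocity (d := d) (fun t => γ (t + δ)) (Icc a b) t
      = velocity γ (Icc (a + δ) (b + δ)) (t + δ) := by
  have hmaps : MapsTo (fun t => t + δ) (Icc a b) (Icc (a + δ) (b + δ)) := fun t ht =>
    ⟨add_le_add_left ht.1 δ, add_le_add_left ht.2 δ⟩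
  have hadd : HasMFDerivWithinAt 𝓘(ℝ, ℝ) 𝓘(ℝ, ℝ) (fun t : ℝ => t + δ) (Icc a b) t
      (ContinuousLinearMap.id ℝ ℝ) :=
    ((hasFDerivWithinAt_id t (Icc a b)).add_const δ).hasMFDerivWithinAt
  exact DFunLike.congr_fun ((HasMFDerivWithinAt.comp (f := fun t : ℝ => t + δ) t
    (hγ _ (hmaps ht)).hasMFDerivWithinAt hadd hmaps).mfderivWithin
      (uniqueDiffOn_Icc hab t ht).uniqueMDiffWithinAt) (1 : ℝ)

lemma LocallyFiniteIn.mono {B : Set ℝ} (h : LocallyFiniteIn B s) (hs : s' ⊆ s) :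
    LocallyFiniteIn B s' := fun a b hab => h a b (hab.trans hs)

namespace IsC1CurveIn

lemma mono {a' b' : ℝ} (h : IsC1CurveIn C γ a b) (ha : a ≤ a') (hab : a' < b') (hb : b' ≤ b) :
    IsC1CurveIn C γ a' b' := by
  have hsub : Icc a' b' ⊆ Icc a b := Icc_subset_Icc ha hb
  refine ⟨h.contMDiffOn.mono hsub, fun t ht => ?_⟩
  rw [velocity_eq_of_subset (h.contMDiffOn.mdifferentiableOn one_ne_zero t (hsub ht)) hsub
    (uniqueDiffOn_Icc hab t ht)]
  exact h.velocity_mem t (hsub ht)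

lemma congr (h : IsC1CurveIn C γ a b) (heq : EqOn γ γ' (Icc a b)) : IsC1CurveIn C γ' a b :=
  ⟨h.contMDiffOn.congr fun _ ht => (heq ht).symm,
    fun t ht => velocity_mem_congr heq ht (h.velocity_mem t ht)⟩

lemma comp_add_const (hab : a < b) (h : IsC1CurveIn C γ (a + δ) (b + δ)) :
    IsC1CurveIn C (fun t => γ (t + δ)) a b := by
  have hmaps : MapsTo (fun t => t + δ) (Icc a b) (Icc (a + δ) (b + δ)) := fun t ht =>
    ⟨add_le_add_left ht.1 δ, add_le_add_left ht.2 δ⟩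
  have hadd : ContMDiff 𝓘(ℝ, ℝ) 𝓘(ℝ, ℝ) 1 (fun t : ℝ => t + δ) :=
    (contDiff_id.add contDiff_const).contMDiff
  refine ⟨h.contMDiffOn.comp hadd.contMDiffOn hmaps, fun t ht => ?_⟩
  rw [velocity_comp_add_const hab (h.contMDiffOn.mdifferentiableOn one_ne_zero) ht]
  exact h.velocity_mem _ (hmaps ht)

lemma isCurveIn (h : IsC1CurveIn C γ a b) : IsCurveIn C γ (Icc a b) := by
  refine ⟨ordConnected_Icc, h.contMDiffOn.continuousOn, ∅, fun _ _ _ => ?_,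
    fun a' b' hab hsub _ => ?_⟩
  · simp only [empty_inter, finite_empty]
  · have h' := h.mono (hsub (left_mem_Icc.2 hab.le)).1 hab (hsub (right_mem_Icc.2 hab.le)).2
    exact ⟨h'.contMDiffOn, h'.velocity_mem⟩

end IsC1CurveIn

namespace IsCurveIn

lemma mono (h : IsCurveIn C γ s) (hs : s' ⊆ s) (hs' : s'.OrdConnected) : IsCurveIn C γ s' := by
  obtain ⟨-, hc, B, hB, hpiece⟩ := h
  exact ⟨hs', hc.mono hs, B, hB.mono hs, fun a b hab hsub => hpiece a b hab (hsub.trans hs)⟩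

lemma congr (h : IsCurveIn C γ s) (heq : EqOn γ γ' s) : IsCurveIn C γ' s := by
  obtain ⟨hs, hc, B, hB, hpiece⟩ := h
  refine ⟨hs, hc.congr fun t ht => (heq ht).symm, B, hB, fun a b hab hsub hdisj => ?_⟩
  obtain ⟨hsmooth, hvel⟩ := hpiece a b hab hsub hdisj
  have h' := (IsC1CurveIn.mk hsmooth hvel).congr (heq.mono hsub)
  exact ⟨h'.contMDiffOn, h'.velocity_mem⟩

lemma union (hab : a ≤ b) (hbc : b ≤ c) (h : IsCurveIn C γ (Icc a b))
    (h' : IsCurveIn C γ (Icc b c)) : IsCurveIn C γ (Icc a c) := by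
  obtain ⟨-, hc, B, hB, hpiece⟩ := h
  obtain ⟨-, hc', B', hB', hpiece'⟩ := h'
  refine ⟨ordConnected_Icc, ?_, {b} ∪ (B ∩ Icc a b ∪ B' ∩ Icc b c), fun _ _ _ => ?_,
    fun u v huv hsub hdisj => ?_⟩
  · rw [← Icc_union_Icc_eq_Icc hab hbc]
    exact hc.union_of_isClosed hc' isClosed_Icc isClosed_Icc
  · exact ((finite_singleton b).union ((hB a b subset_rfl).union (hB' b c subset_rfl))).subset
      inter_subset_left
  have hu := hsub (left_mem_Icc.2 huv.le)
  have hv := hsub (right_mem_Icc.2 huv.le)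
  rw [← disjoint_iff_inter_eq_empty, disjoint_union_right, disjoint_union_right,
    disjoint_singleton_right] at hdisj
  obtain ⟨hb, hdB, hdB'⟩ := hdisj
  rcases le_or_gt v b with hvb | hvb
  · have hsub' : Icc u v ⊆ Icc a b := Icc_subset_Icc hu.1 hvb
    exact hpiece u v huv hsub' (eq_empty_of_forall_notMem fun x hx =>
      hdB.notMem_of_mem_left hx.1 ⟨hx.2, hsub' (Ioo_subset_Icc_self hx.1)⟩)
  · have hsub' : Icc u v ⊆ Icc b c := Icc_subset_Icc (not_lt.1 fun hub => hb ⟨hub, hvb⟩) hv.2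
    exact hpiece' u v huv hsub' (eq_empty_of_forall_notMem fun x hx =>
      hdB'.notMem_of_mem_left hx.1 ⟨hx.2, hsub' (Ioo_subset_Icc_self hx.1)⟩)

lemma comp_add_const (h : IsCurveIn C γ (Icc (a + δ) (b + δ))) :
    IsCurveIn C (fun t => γ (t + δ)) (Icc a b) := by
  obtain ⟨-, hc, B, hB, hpiece⟩ := h
  have hmaps : MapsTo (fun t => t + δ) (Icc a b) (Icc (a + δ) (b + δ)) := fun t ht =>
    ⟨add_le_add_left ht.1 δ, add_le_add_left ht.2 δ⟩
  refine ⟨ordConnected_Icc, hc.comp (by fun_prop) hmaps,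
    (fun t => t + δ) ⁻¹' (B ∩ Icc (a + δ) (b + δ)), fun _ _ _ => ?_, fun u v huv hsub hdisj => ?_⟩
  · exact ((hB _ _ subset_rfl).preimage (add_left_injective δ).injOn).subset inter_subset_left
  have hsub' : Icc (u + δ) (v + δ) ⊆ Icc (a + δ) (b + δ) := Icc_subset_Icc
    (hmaps (hsub (left_mem_Icc.2 huv.le))).1 (hmaps (hsub (right_mem_Icc.2 huv.le))).2
  obtain ⟨hsmooth, hvel⟩ := hpiece (u + δ) (v + δ) (by linarith) hsub'
    (eq_empty_of_forall_notMem fun x hx => by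
      refine (disjoint_iff_inter_eq_empty.2 hdisj).notMem_of_mem_left (a := x - δ)
        ⟨by linarith [hx.1.1], by linarith [hx.1.2]⟩ ?_
      rw [mem_preimage, sub_add_cancel]
      exact ⟨hx.2, hsub' (Ioo_subset_Icc_self hx.1)⟩)
  have h' := (IsC1CurveIn.mk hsmooth hvel).comp_add_const huv
  exact ⟨h'.contMDiffOn, h'.velocity_mem⟩

lemma exists_isC1CurveIn_right (h : IsCurveIn C γ s) (hab : a < b) (hs : Icc a b ⊆ s) :
    ∃ c ∈ Ioc a b, IsC1CurveIn C γ a c := by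
  obtain ⟨-, -, B, hB, hpiece⟩ := h
  have hclosed : IsClosed ((B ∩ Icc a b) \ {a}) := ((hB a b hs).subset sdiff_subset).isClosed
  obtain ⟨l, u, hau, hlu⟩ := mem_nhds_iff_exists_Ioo_subset.1
    (hclosed.isOpen_compl.mem_nhds fun ha => ha.2 rfl)
  have hac : a < min b u := lt_min hab hau.2
  obtain ⟨hsmooth, hvel⟩ := hpiece a (min b u) hac
    ((Icc_subset_Icc_right (min_le_left _ _)).trans hs) (eq_empty_of_forall_notMem fun x hx =>
      hlu ⟨hau.1.trans hx.1.1, hx.1.2.trans_le (min_le_right _ _)⟩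
        ⟨⟨hx.2, hx.1.1.le, hx.1.2.le.trans (min_le_left _ _)⟩, hx.1.1.ne'⟩)
  exact ⟨_, ⟨hac, min_le_left _ _⟩, hsmooth, hvel⟩

end IsCurveIn

end Curves

section CoordinateCurves

variable {d : ℕ} {M : Type*} [TopologicalSpace M] [ChartedSpace (Coord d) M]
  [IsManifold (𝓡 d) ∞ M] {g : LorentzStructure d M} {x₀ : M} {a b t : ℝ}

lemma hasDerivWithinAt_chart {γ : ℝ → M} {s : Set ℝ}
    (hγ : MDifferentiableWithinAt 𝓘(ℝ, ℝ) (𝓡 d) γ s t)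
    (ht : γ t ∈ (extChartAt (𝓡 d) x₀).source) :
    HasDerivWithinAt (fun τ => extChartAt (𝓡 d) x₀ (γ τ))
      (chartDeriv x₀ (γ t) (velocity γ s t)) s t := by
  rw [extChartAt_source] at ht
  have hchart := (hasMFDerivAt_extChartAt (I := 𝓡 d) ht).mdifferentiableAt.hasMFDerivAt
  have hcomp : HasFDerivWithinAt (fun τ => extChartAt (𝓡 d) x₀ (γ τ))
      ((chartDeriv x₀ (γ t)).comp (mfderivWithin 𝓘(ℝ, ℝ) (𝓡 d) γ s t) : ℝ →L[ℝ] Coord d) s t :=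
    (hchart.comp_hasMFDerivWithinAt t hγ.hasMFDerivWithinAt).hasFDerivWithinAt
  exact hcomp.hasDerivWithinAt

lemma velocity_chart_symm_comp {σ : ℝ → Coord d} {σ' : Coord d} {s : Set ℝ}
    (hs : UniqueDiffWithinAt ℝ s t) (hσ : HasDerivWithinAt σ σ' s t)
    (ht : σ t ∈ (extChartAt (𝓡 d) x₀).target) :
    velocity (fun τ => (extChartAt (𝓡 d) x₀).symm (σ τ)) s t = chartSymmDeriv x₀ (σ t) σ' := by
  have hsymm := mdifferentiableWithinAt_extChartAt_symm (I := 𝓡 d) ht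
  rw [ModelWithCorners.range_eq_univ, mdifferentiableWithinAt_univ] at hsymm
  have hcomp := DFunLike.congr_fun ((hsymm.hasMFDerivAt.comp_hasMFDerivWithinAt t
    hσ.hasFDerivWithinAt.hasMFDerivWithinAt).mfderivWithin hs.uniqueMDiffWithinAt) (1 : ℝ)
  refine hcomp.trans ?_
  change chartSymmDeriv x₀ (σ t) ((1 : ℝ) • σ') = _
  rw [one_smul]

lemma contDiffOn_one_of_hasDerivWithinAt {E : Type*} [NormedAddCommGroup E] [NormedSpace ℝ E]
    {σ σ' : ℝ → E} (hab : a < b) (hσ : ∀ t ∈ Icc a b, HasDerivWithinAt σ (σ' t) (Icc a b) t)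
    (hσ' : ContinuousOn σ' (Icc a b)) : ContDiffOn ℝ 1 σ (Icc a b) := by
  rw [contDiffOn_one_iff_derivWithin (uniqueDiffOn_Icc hab)]
  exact ⟨fun t ht => (hσ t ht).differentiableWithinAt,
    hσ'.congr fun t ht => (hσ t ht).derivWithin (uniqueDiffOn_Icc hab t ht)⟩

lemma isC1CurveIn_chart_symm_comp {C : ∀ x : M, Set (TangentSpace (𝓡 d) x)} {σ σ' : ℝ → Coord d}
    (hab : a < b) (htarget : ∀ t ∈ Icc a b, σ t ∈ (extChartAt (𝓡 d) x₀).target)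
    (hσ : ∀ t ∈ Icc a b, HasDerivWithinAt σ (σ' t) (Icc a b) t) (hσ' : ContinuousOn σ' (Icc a b))
    (hC : ∀ t ∈ Icc a b, chartSymmDeriv x₀ (σ t) (σ' t) ∈ C ((extChartAt (𝓡 d) x₀).symm (σ t))) :
    IsC1CurveIn C (fun t => (extChartAt (𝓡 d) x₀).symm (σ t)) a b := by
  refine ⟨(contMDiffOn_extChartAt_symm (I := 𝓡 d) (n := 1) x₀).comp
    (contDiffOn_one_of_hasDerivWithinAt hab hσ hσ').contMDiffOn htarget, fun t ht => ?_⟩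
  rw [velocity_chart_symm_comp (uniqueDiffOn_Icc hab t ht) (hσ t ht) (htarget t ht)]
  exact hC t ht

lemma IsCurveIn.exists_right_deriv {C : ∀ x : M, Set (TangentSpace (𝓡 d) x)} {γ : ℝ → M}
    {s : Set ℝ} (h : IsCurveIn C γ s) {u : ℝ} (htu : t < u) (hs : Icc t u ⊆ s)
    (ht : γ t ∈ (extChartAt (𝓡 d) x₀).source) :
    ∃ v ∈ C (γ t),
      HasDerivWithinAt (fun τ => extChartAt (𝓡 d) x₀ (γ τ)) (chartDeriv x₀ (γ t) v) (Ici t) t := by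
  obtain ⟨v, ⟨htv, -⟩, hγ⟩ := h.exists_isC1CurveIn_right htu hs
  have hmem := left_mem_Icc.2 htv.le
  exact ⟨_, hγ.velocity_mem t hmem, hasDerivWithinAt_Ici_of_Icc (hasDerivWithinAt_chart
    (hγ.contMDiffOn.mdifferentiableOn one_ne_zero t hmem) ht) ⟨le_rfl, htv⟩⟩

lemma IsTimelikeCurve.isCausalCurve {γ : ℝ → M} {s : Set ℝ} (h : IsTimelikeCurve g γ s) :
    IsCausalCurve g γ s := by
  obtain ⟨hs, hc, B, hB, hpiece⟩ := h
  refine ⟨hs, hc, B, hB, fun a b hab hsub hdisj => ?_⟩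
  obtain ⟨hsmooth, hvel⟩ := hpiece a b hab hsub hdisj
  exact ⟨hsmooth, fun t ht => ⟨(hvel t ht).1.le, (hvel t ht).2⟩⟩

namespace TimelikeJoined

lemma of_curve {γ : ℝ → M} (hab : a < b) (h : IsTimelikeCurve g γ (Icc a b)) :
    TimelikeJoined g univ ∅ (γ a) (γ b) :=
  ⟨γ, a, b, hab, h, rfl, rfl, fun _ _ => ⟨trivial, id⟩⟩

lemma of_coord {σ σ' : ℝ → Coord d} (hab : a < b)
    (htarget : ∀ t ∈ Icc a b, σ t ∈ (extChartAt (𝓡 d) x₀).target)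
    (hσ : ∀ t ∈ Icc a b, HasDerivWithinAt σ (σ' t) (Icc a b) t) (hσ' : ContinuousOn σ' (Icc a b))
    (hC : ∀ t ∈ Icc a b, σ' t ∈ timelikeCone (coordMetric g x₀ (σ t)) (coordFuture g x₀ (σ t))) :
    TimelikeJoined g univ ∅ ((extChartAt (𝓡 d) x₀).symm (σ a))
      ((extChartAt (𝓡 d) x₀).symm (σ b)) :=
  of_curve hab (isC1CurveIn_chart_symm_comp hab htarget hσ hσ' fun t ht =>
    (chartSymmDeriv_mem_futureTimelike_iff (htarget t ht)).2 (hC t ht)).isCurveIn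

lemma trans {x y z : M} (h : TimelikeJoined g univ ∅ x y) (h' : TimelikeJoined g univ ∅ y z) :
    TimelikeJoined g univ ∅ x z := by
  obtain ⟨γ, a, b, hab, hγ, rfl, rfl, -⟩ := h
  obtain ⟨γ', a', b', hab', hγ', hy, rfl, -⟩ := h'
  obtain ⟨c, rfl⟩ : ∃ c, b' = c + (a' - b) := ⟨b' - (a' - b), by ring⟩
  have hbc : b < c := by linarith
  have hshift : IsTimelikeCurve g (fun t => γ' (t + (a' - b))) (Icc b c) :=
    IsCurveIn.comp_add_const (by rwa [add_sub_cancel])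
  set β : ℝ → M := fun t => if t ≤ b then γ t else γ' (t + (a' - b)) with hβ
  have hβγ : EqOn γ β (Icc a b) := fun t ht => by simp only [hβ, if_pos ht.2]
  have hβγ' : EqOn (fun t => γ' (t + (a' - b))) β (Icc b c) := fun t ht => by
    rcases ht.1.eq_or_lt with rfl | h
    · simp only [hβ, le_refl, if_true, add_sub_cancel, hy]
    · simp only [hβ, if_neg (not_le.2 h)]
  have hjoin := of_curve (hab.trans hbc)
    ((IsCurveIn.congr hγ hβγ).union hab.le hbc.le (IsCurveIn.congr hshift hβγ'))
  rwa [← hβγ ⟨le_rfl, hab.le⟩, ← hβγ' ⟨hbc.le, le_rfl⟩] at hjoin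

end TimelikeJoined

end CoordinateCurves

/-! ### Past sets -/

section PastSets

variable {d : ℕ} {M : Type*} [TopologicalSpace M] [ChartedSpace (Coord d) M]
  [IsManifold (𝓡 d) ∞ M] {g : LorentzStructure d M} {x₀ : M} {y₀ e : Coord d} {L W : Set M}

/-- A past set: an open set that contains the chronological past of each of its points. -/
structure IsPastSet (g : LorentzStructure d M) (L : Set M) : Prop where
  isOpen : IsOpen L
  mem_of_timelikeJoined {x y : M} : TimelikeJoined g univ ∅ x y → y ∈ L → x ∈ L

lemma exists_timelike_segment (g : LorentzStructure d M)
    (hy₀ : y₀ ∈ (extChartAt (𝓡 d) x₀).target)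
    (he : e ∈ timelikeCone (coordMetric g x₀ y₀) (coordFuture g x₀ y₀)) :
    ∃ η > 0, ∀ y ∈ Metric.ball y₀ η, ∀ y' ∈ Metric.ball y₀ η, ∀ s > (0 : ℝ),
      s⁻¹ • (y' - y) ∈ Metric.ball e η → TimelikeJoined g univ ∅
        ((extChartAt (𝓡 d) x₀).symm y) ((extChartAt (𝓡 d) x₀).symm y') := by
  obtain ⟨η, hη, hcone⟩ := (isOrientedLorentzOn_coord g x₀).exists_timelike_ball hy₀ he
  refine ⟨η, hη, fun y hy y' hy' s hs hslope => ?_⟩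
  have hmem : ∀ t ∈ Icc 0 s, y + t • (s⁻¹ • (y' - y)) ∈ Metric.ball y₀ η := fun t ht => by
    have hconvex := (convex_ball y₀ η).add_smul_sub_mem hy hy' (t := t / s)
      ⟨div_nonneg ht.1 hs.le, (div_le_one hs).2 ht.2⟩
    rwa [smul_smul, ← div_eq_mul_inv]
  have hderiv : ∀ t ∈ Icc 0 s, HasDerivWithinAt (fun t : ℝ => y + t • (s⁻¹ • (y' - y)))
      (s⁻¹ • (y' - y)) (Icc 0 s) t := fun t _ => by
    simpa using ((hasDerivWithinAt_id t (Icc 0 s)).smul_const (s⁻¹ • (y' - y))).const_add y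
  have hjoin := TimelikeJoined.of_coord hs (fun t ht => (hcone _ (hmem t ht)).1) hderiv
    continuousOn_const fun t ht => (hcone _ (hmem t ht)).2 _ hslope
  rwa [zero_smul, add_zero, smul_inv_smul₀ hs.ne', add_sub_cancel] at hjoin

lemma TimelikeJoined.eventually_left {x w : M} (h : TimelikeJoined g univ ∅ x w) :
    ∀ᶠ x' in 𝓝 x, TimelikeJoined g univ ∅ x' w := by
  obtain ⟨γ, a, b, hab, hγ, rfl, rfl, -⟩ := h
  set φ := extChartAt (𝓡 d) (γ a)
  have hsource : γ a ∈ φ.source := mem_extChartAt_source (γ a)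
  have hφcont : ContinuousAt φ (γ a) := continuousAt_extChartAt (γ a)
  obtain ⟨v, hv, hderiv⟩ := IsCurveIn.exists_right_deriv hγ hab subset_rfl hsource
  obtain ⟨η, hη, hseg⟩ := exists_timelike_segment g (φ.map_source hsource)
    ((chartDeriv_mem_timelikeCone_iff hsource).2 hv)
  have hcont : Tendsto γ (𝓝[>] a) (𝓝 (γ a)) :=
    (hγ.2.1 a (left_mem_Icc.2 hab.le)).mono_left (nhdsWithin_le_of_mem (Icc_mem_nhdsGT hab))
  have hslope : ∀ᶠ t in 𝓝[>] a,
      (t - a)⁻¹ • (φ (γ t) - φ (γ a)) ∈ Metric.ball (chartDeriv (γ a) (γ a) v) η :=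
    ((hasDerivWithinAt_iff_tendsto_slope' self_notMem_Ioi).1 hderiv.Ioi_of_Ici).eventually
      (Metric.ball_mem_nhds _ hη)
  obtain ⟨t, ht, htball, htsource, hta, htb⟩ := (hslope.and
    (((hφcont.tendsto.comp hcont).eventually (Metric.ball_mem_nhds _ hη)).and
      ((hcont.eventually (extChartAt_source_mem_nhds (I := 𝓡 d) (γ a))).and
        (Ioo_mem_nhdsGT hab)))).exists
  have hslope' : ∀ᶠ x' in 𝓝 (γ a),
      (t - a)⁻¹ • (φ (γ t) - φ x') ∈ Metric.ball (chartDeriv (γ a) (γ a) v) η :=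
    ((continuousAt_const.sub hφcont).const_smul ((t - a)⁻¹)).eventually
      (Metric.isOpen_ball.mem_nhds ht)
  filter_upwards [hslope', hφcont.eventually (Metric.ball_mem_nhds _ hη),
    extChartAt_source_mem_nhds (I := 𝓡 d) (γ a)] with x' hx' hball hx'source
  have hjoin := hseg _ hball (φ (γ t)) htball (t - a) (sub_pos.2 hta) hx'
  rw [φ.left_inv hx'source, φ.left_inv htsource] at hjoin
  exact hjoin.trans (TimelikeJoined.of_curve htb
    (IsCurveIn.mono hγ (Icc_subset_Icc_left hta.le) ordConnected_Icc))

lemma mem_pastOf {x : M} : x ∈ pastOf g W ↔ ∃ w ∈ W, TimelikeJoined g univ ∅ x w := by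
  simp only [pastOf, chronPast, mem_iUnion, mem_ofPred_eq, exists_prop]

theorem isPastSet_pastOf (g : LorentzStructure d M) (W : Set M) : IsPastSet g (pastOf g W) where
  isOpen := isOpen_iff_mem_nhds.2 fun x hx => by
    obtain ⟨w, hw, hxw⟩ := mem_pastOf.1 hx
    exact hxw.eventually_left.mono fun x' hx' => mem_pastOf.2 ⟨w, hw, hx'⟩
  mem_of_timelikeJoined hxy hy := by
    obtain ⟨w, hw, hyw⟩ := mem_pastOf.1 hy
    exact mem_pastOf.2 ⟨w, hw, hxy.trans hyw⟩

lemma subset_closure_pastOf (g : LorentzStructure d M) (W : Set M) : W ⊆ closure (pastOf g W) := by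
  intro x hx
  set y₀ := extChartAt (𝓡 d) x x with hy₀
  set e := coordFuture g x y₀
  obtain ⟨η, hη, hseg⟩ := exists_timelike_segment g (mem_extChartAt_target x)
    ((isOrientedLorentzOn_coord g x).future_mem (mem_extChartAt_target x))
  have hlim : Tendsto (fun s : ℝ => y₀ - s • e) (𝓝[>] 0) (𝓝 y₀) := by
    have hcont : Continuous fun s : ℝ => y₀ - s • e := by fun_prop
    simpa only [zero_smul, sub_zero] using (hcont.tendsto 0).mono_left nhdsWithin_le_nhds
  have hlim' : Tendsto (fun s : ℝ => (extChartAt (𝓡 d) x).symm (y₀ - s • e)) (𝓝[>] 0) (𝓝 x) := by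
    simpa only [hy₀, Function.comp_def, extChartAt_to_inv] using
      (continuousAt_extChartAt_symm (I := 𝓡 d) x).tendsto.comp hlim
  refine mem_closure_of_tendsto hlim' ?_
  filter_upwards [hlim.eventually (Metric.ball_mem_nhds y₀ hη), self_mem_nhdsWithin] with s hball hs
  have hjoin := hseg _ hball y₀ (Metric.mem_ball_self hη) s hs (by
    rw [sub_sub_cancel, inv_smul_smul₀ (ne_of_gt hs)]
    exact Metric.mem_ball_self hη)
  rw [hy₀, extChartAt_to_inv] at hjoin
  exact mem_pastOf.2 ⟨x, hx, hjoin⟩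

lemma IsPastSet.exists_segment (hL : IsPastSet g L) (hy₀ : y₀ ∈ (extChartAt (𝓡 d) x₀).target)
    (he : e ∈ timelikeCone (coordMetric g x₀ y₀) (coordFuture g x₀ y₀)) :
    ∃ η > 0, ∀ y ∈ Metric.ball y₀ η, ∀ y' ∈ Metric.ball y₀ η, ∀ s > (0 : ℝ),
      s⁻¹ • (y' - y) ∈ Metric.ball e η → (extChartAt (𝓡 d) x₀).symm y' ∈ closure L →
        (extChartAt (𝓡 d) x₀).symm y ∈ L := by
  obtain ⟨η, hη, hseg⟩ := exists_timelike_segment g hy₀ he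
  obtain ⟨ρ, hρ, hball⟩ := Metric.isOpen_iff.1 (isOpen_extChartAt_target (I := 𝓡 d) x₀) y₀ hy₀
  refine ⟨min η ρ, lt_min hη hρ, fun y hy y' hy' s hs hslope hclosure => ?_⟩
  set φ := extChartAt (𝓡 d) x₀
  have hmono : ∀ z : Coord d, Metric.ball z (min η ρ) ⊆ Metric.ball z η := fun z =>
    Metric.ball_subset_ball (min_le_left η ρ)
  have htarget : y' ∈ φ.target := hball (Metric.ball_subset_ball (min_le_right η ρ) hy')
  have hφ : ContinuousAt φ (φ.symm y') := continuousAt_extChartAt' (φ.map_target htarget)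
  have hnear : ∀ᶠ x in 𝓝 (φ.symm y'), s⁻¹ • (φ x - y) ∈ Metric.ball e η :=
    ((hφ.sub continuousAt_const).const_smul s⁻¹).eventually (Metric.isOpen_ball.mem_nhds (by
      change s⁻¹ • (φ (φ.symm y') - y) ∈ _
      rw [φ.right_inv htarget]
      exact hmono _ hslope))
  have hnear' : ∀ᶠ x in 𝓝 (φ.symm y'), φ x ∈ Metric.ball y₀ η :=
    hφ.eventually (Metric.isOpen_ball.mem_nhds (by rw [φ.right_inv htarget]; exact hmono _ hy'))
  obtain ⟨x, ⟨hx, hx', hsource⟩, hxL⟩ := mem_closure_iff_nhds.1 hclosure _ (hnear.and (hnear'.and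
    ((isOpen_extChartAt_source x₀).mem_nhds (φ.map_target htarget))))
  have hjoin := hseg y (hmono _ hy) _ hx' s hs hx
  rw [φ.left_inv hsource] at hjoin
  exact hL.mem_of_timelikeJoined hjoin hxL

end PastSets

section PushUp

variable {E : Type*} [NormedAddCommGroup E] [NormedSpace ℝ E] {ℓ : E →L[ℝ] ℝ} {e y : E} {ε : ℝ}

/-- The size of the displacement along a fixed vector that turns causal curves into timelike ones.
Along a curve `c` it solves `f' = |f| ℓ(c')`, the equation that `exists_pushUp` asks for. -/
def pushSize (ℓ : E →L[ℝ] ℝ) (ε : ℝ) (y : E) : ℝ := ε * Real.exp (SignType.sign ε * ℓ y)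

/-- The point `y`, displaced along `e` by `pushSize`: to the future for `ε > 0` and to the past for
`ε < 0`, if `e` is future-directed. -/
def push (ℓ : E →L[ℝ] ℝ) (e : E) (ε : ℝ) (y : E) : E := y + pushSize ℓ ε y • e

lemma pushSize_pos (hε : 0 < ε) : 0 < pushSize ℓ ε y := mul_pos hε (Real.exp_pos _)

lemma pushSize_neg (hε : ε < 0) : pushSize ℓ ε y < 0 := mul_neg_of_neg_of_pos hε (Real.exp_pos _)

lemma pushSize_ne_zero (hε : ε ≠ 0) : pushSize ℓ ε y ≠ 0 := mul_ne_zero hε (Real.exp_pos _).ne'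

lemma inv_smul_push_sub (hε : ε ≠ 0) : (pushSize ℓ ε y)⁻¹ • (push ℓ e ε y - y) = e := by
  rw [push, add_sub_cancel_left, inv_smul_smul₀ (pushSize_ne_zero hε)]

lemma tendsto_push (ℓ : E →L[ℝ] ℝ) (e y : E) :
    Tendsto (fun p : ℝ × E => push ℓ e p.1 p.2) (𝓝 (0, y)) (𝓝 y) := by
  have hsign : ∀ ε : ℝ, |((SignType.sign ε : SignType) : ℝ)| ≤ 1 := fun ε => by
    rcases lt_trichotomy ε 0 with h | h | h <;> simp [h]
  have hbound : Tendsto (fun p : ℝ × E => |p.1| * Real.exp |ℓ p.2|) (𝓝 (0, y)) (𝓝 0) := by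
    have hcont : Continuous fun p : ℝ × E => |p.1| * Real.exp |ℓ p.2| := by fun_prop
    simpa only [abs_zero, zero_mul] using hcont.tendsto (0, y)
  have hsize : Tendsto (fun p : ℝ × E => pushSize ℓ p.1 p.2) (𝓝 (0, y)) (𝓝 0) := by
    refine squeeze_zero_norm (fun p => ?_) hbound
    rw [pushSize, norm_mul, Real.norm_eq_abs, Real.norm_eq_abs, Real.abs_exp]
    gcongr
    refine (le_abs_self _).trans ?_
    rw [abs_mul]
    exact mul_le_of_le_one_left (abs_nonneg _) (hsign _)
  simpa only [push, zero_smul, add_zero] using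
    (continuous_snd.tendsto ((0 : ℝ), y)).add (hsize.smul_const e)

lemma contDiff_push (ℓ : E →L[ℝ] ℝ) (e : E) (ε : ℝ) : ContDiff ℝ 1 (push ℓ e ε) :=
  contDiff_id.add (ContDiff.smul (contDiff_const.mul
    (Real.contDiff_exp.comp (contDiff_const.mul ℓ.contDiff))) contDiff_const)

lemma hasDerivWithinAt_push {c : ℝ → E} {c' : E} {s : Set ℝ} {t : ℝ}
    (hc : HasDerivWithinAt c c' s t) :
    HasDerivWithinAt (fun t => push ℓ e ε (c t)) (c' + (|pushSize ℓ ε (c t)| * ℓ c') • e) s t := by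
  have hsize := (((ℓ.hasFDerivAt.comp_hasDerivWithinAt t hc).const_mul
    ((SignType.sign ε : SignType) : ℝ)).exp.const_mul ε).smul_const e
  refine (hc.add hsize).congr_deriv ?_
  rw [pushSize, abs_mul, Real.abs_exp, ← self_mul_sign]
  simp only [Function.comp]
  ring_nf

variable {d : ℕ} {M : Type*} [TopologicalSpace M] [ChartedSpace (Coord d) M]

lemma tendsto_symm_push {x₀ x : M} (hx : x ∈ (extChartAt (𝓡 d) x₀).source)
    (ℓ : Coord d →L[ℝ] ℝ) (e : Coord d) :
    Tendsto (fun ε => (extChartAt (𝓡 d) x₀).symm (push ℓ e ε (extChartAt (𝓡 d) x₀ x))) (𝓝 0)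
      (𝓝 x) := by
  have hpush := (tendsto_push ℓ e (extChartAt (𝓡 d) x₀ x)).comp
    ((continuous_id.prodMk continuous_const).tendsto' (0 : ℝ) (0, _) rfl)
  have hsymm := (continuousAt_extChartAt_symm'' (I := 𝓡 d)
    ((extChartAt (𝓡 d) x₀).map_source hx)).tendsto
  rw [(extChartAt (𝓡 d) x₀).left_inv hx] at hsymm
  exact hsymm.comp hpush

variable [IsManifold (𝓡 d) ∞ M] {g : LorentzStructure d M} {L : Set M}

lemma exists_timelikeJoined_push (g : LorentzStructure d M) (x₀ : M) :
    ∃ ℓ : Coord d →L[ℝ] ℝ, ∃ r > 0, ∀ ε ∈ Metric.ball (0 : ℝ) r, ε ≠ 0 →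
      ∀ (γ : ℝ → M) (a b : ℝ), a < b → IsC1CurveIn (futureCausal g) γ a b →
      (∀ t ∈ Icc a b, γ t ∈ chartBall d x₀ r) →
      TimelikeJoined g univ ∅
        ((extChartAt (𝓡 d) x₀).symm (push ℓ (coordFuture g x₀ (extChartAt (𝓡 d) x₀ x₀)) ε
          (extChartAt (𝓡 d) x₀ (γ a))))
        ((extChartAt (𝓡 d) x₀).symm (push ℓ (coordFuture g x₀ (extChartAt (𝓡 d) x₀ x₀)) ε
          (extChartAt (𝓡 d) x₀ (γ b)))) := by
  set φ := extChartAt (𝓡 d) x₀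
  set y₀ := φ x₀
  have hy₀ : y₀ ∈ φ.target := mem_extChartAt_target x₀
  obtain ⟨ℓ, ρ, hρ, hpush⟩ := (isOrientedLorentzOn_coord g x₀).exists_pushUp hy₀
  set e := coordFuture g x₀ y₀
  have hnear : ∀ᶠ p : ℝ × Coord d in 𝓝 (0, y₀),
      p.2 ∈ Metric.ball y₀ ρ ∧ push ℓ e p.1 p.2 ∈ Metric.ball y₀ ρ ∩ φ.target :=
    ((continuous_snd.tendsto ((0 : ℝ), y₀)).eventually (Metric.ball_mem_nhds y₀ hρ)).and
      ((tendsto_push ℓ e y₀).eventually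
        (inter_mem (Metric.ball_mem_nhds y₀ hρ) ((isOpen_extChartAt_target x₀).mem_nhds hy₀)))
  obtain ⟨r, hr, hball⟩ := Metric.eventually_nhds_iff_ball.1 hnear
  refine ⟨ℓ, r, hr, fun ε hεr hε γ a b hab hγ hin => ?_⟩
  have hgood := fun t ht => hball (ε, φ (γ t)) (ball_prod_same (0 : ℝ) y₀ r ▸ ⟨hεr, (hin t ht).2⟩)
  have hderiv := fun t ht => hasDerivWithinAt_push (ℓ := ℓ) (e := e) (ε := ε)
    (hasDerivWithinAt_chart (hγ.contMDiffOn.mdifferentiableOn one_ne_zero t ht) (hin t ht).1)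
  have hsmooth : ContDiffOn ℝ 1 (fun t => push ℓ e ε (φ (γ t))) (Icc a b) := by
    have hchart := contMDiffOn_extChartAt (I := 𝓡 d) (n := 1) (x := x₀)
    rw [← extChartAt_source (𝓡 d)] at hchart
    exact (contDiff_push ℓ e ε).comp_contDiffOn
      (hchart.comp hγ.contMDiffOn fun t ht => (hin t ht).1).contDiffOn
  refine TimelikeJoined.of_coord hab (fun t ht => (hgood t ht).2.2)
    (fun t ht => (hsmooth.differentiableOn one_ne_zero t ht).hasDerivWithinAt)
    (hsmooth.continuousOn_derivWithin (uniqueDiffOn_Icc hab) le_rfl) fun t ht => ?_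
  rw [(hderiv t ht).derivWithin (uniqueDiffOn_Icc hab t ht)]
  exact hpush _ (hgood t ht).1 _ (pushSize_ne_zero hε) (hgood t ht).2.1 _
    ((chartDeriv_mem_causalCone_iff (hin t ht).1).2 (hγ.velocity_mem t ht))

lemma IsPastSet.exists_nhds_of_causal (hL : IsPastSet g L) (x₀ : M) :
    ∃ N, IsOpen N ∧ x₀ ∈ N ∧ ∀ (γ : ℝ → M) (a b : ℝ), a < b → IsC1CurveIn (futureCausal g) γ a b →
      (∀ t ∈ Icc a b, γ t ∈ N) → (γ b ∈ L → γ a ∈ L) ∧ (γ b ∈ closure L → γ a ∈ closure L) := by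
  obtain ⟨ℓ, r, hr, hpush⟩ := exists_timelikeJoined_push g x₀
  have hy₀ : extChartAt (𝓡 d) x₀ x₀ ∈ (extChartAt (𝓡 d) x₀).target := mem_extChartAt_target x₀
  obtain ⟨η, hη, hseg⟩ := hL.exists_segment hy₀ ((isOrientedLorentzOn_coord g x₀).future_mem hy₀)
  set φ := extChartAt (𝓡 d) x₀
  set e := coordFuture g x₀ (φ x₀)
  refine ⟨chartBall d x₀ (min r η), isOpen_chartBall d x₀, mem_chartBall_self d x₀ (lt_min hr hη),
    fun γ a b hab hγ hin => ?_⟩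
  have hsource := fun t ht => (hin t ht).1
  have hη' := fun t ht => Metric.ball_subset_ball (min_le_right r η) (hin t ht).2
  have hjoin := fun ε hεr hε => hpush ε hεr hε γ a b hab hγ fun t ht =>
    chartBall_subset_chartBall d x₀ (min_le_left r η) (hin t ht)
  have ha := left_mem_Icc.2 hab.le
  have hb := right_mem_Icc.2 hab.le
  have hεball : ∀ᶠ ε in 𝓝 (0 : ℝ), ε ∈ Metric.ball (0 : ℝ) r := Metric.ball_mem_nhds 0 hr
  have hpushball : ∀ t ∈ Icc a b, ∀ᶠ ε in 𝓝 0, push ℓ e ε (φ (γ t)) ∈ Metric.ball (φ x₀) η :=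
    fun t ht => ((tendsto_push ℓ e (φ (γ t))).comp
      ((continuous_id.prodMk continuous_const).tendsto' (0 : ℝ) (0, _) rfl)).eventually
        (Metric.isOpen_ball.mem_nhds (hη' t ht))
  constructor
  · intro hbL
    have hpushL := (tendsto_symm_push (hsource b hb) ℓ e).eventually (hL.isOpen.mem_nhds hbL)
    obtain ⟨ε, hε, hεr, hεL, hεη⟩ := (eventually_mem_nhdsWithin.and
      ((hεball.and (hpushL.and (hpushball a ha))).filter_mono
        (nhdsWithin_le_nhds (s := Ioi 0)))).exists
    have hmem := hseg _ (hη' a ha) _ hεη _ (pushSize_pos hε)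
      (by rw [inv_smul_push_sub (ne_of_gt hε)]; exact Metric.mem_ball_self hη)
      (subset_closure (hL.mem_of_timelikeJoined (hjoin ε hεr (ne_of_gt hε)) hεL))
    rwa [φ.left_inv (hsource a ha)] at hmem
  · intro hbL
    refine mem_closure_of_tendsto
      ((tendsto_symm_push (hsource a ha) ℓ e).mono_left (nhdsWithin_le_nhds (s := Iio 0))) ?_
    filter_upwards [self_mem_nhdsWithin,
      (hεball.and (hpushball b hb)).filter_mono nhdsWithin_le_nhds] with ε hε ⟨hεr, hεη⟩
    refine hL.mem_of_timelikeJoined (hjoin ε hεr (ne_of_lt hε)) (hseg _ hεη _ (hη' b hb) _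
      (neg_pos.2 (pushSize_neg (ℓ := ℓ) (y := φ (γ b)) hε)) ?_ (by rwa [φ.left_inv (hsource b hb)]))
    rw [inv_neg, neg_smul, ← smul_neg, neg_sub, inv_smul_push_sub (ne_of_lt hε)]
    exact Metric.mem_ball_self hη

theorem IsPastSet.of_causal (hL : IsPastSet g L) {γ : ℝ → M} {a b : ℝ} (hab : a ≤ b)
    (hγ : IsC1CurveIn (futureCausal g) γ a b) :
    (γ b ∈ L → γ a ∈ L) ∧ (γ b ∈ closure L → γ a ∈ closure L) := by
  choose N hN hmem hlocal using hL.exists_nhds_of_causal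
  obtain ⟨t, ht₀, hmono, ⟨m, hm⟩, hcover⟩ := exists_monotone_Icc_subset_open_cover_Icc hab
    (c := fun x : M => (Icc a b).domRestrict γ ⁻¹' N x)
    (fun x => (hN x).preimage hγ.contMDiffOn.continuousOn.domRestrict)
    (fun u _ => mem_iUnion.2 ⟨γ u, hmem _⟩)
  have hstep : ∀ n, (γ (t n) ∈ L → γ a ∈ L) ∧ (γ (t n) ∈ closure L → γ a ∈ closure L) := by
    intro n
    induction n with
    | zero => rw [ht₀]; exact ⟨id, id⟩
    | succ n ih =>
      rcases (hmono n.le_succ).eq_or_lt with heq | hlt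
      · rwa [← heq]
      · obtain ⟨x, hx⟩ := hcover n
        have hpiece := hlocal x γ (t n) (t (n + 1)) hlt (hγ.mono (t n).2.1 hlt (t (n + 1)).2.2)
          fun u hu => hx (a := ⟨u, (t n).2.1.trans hu.1, hu.2.trans (t (n + 1)).2.2⟩) hu
        exact ⟨ih.1 ∘ hpiece.1, ih.2 ∘ hpiece.2⟩
  simpa only [hm m le_rfl] using hstep m

end PushUp

/-! ### Future-infinite causal curves leave small neighbourhoods -/

section TimeFunction

variable {E : Type*} [NormedAddCommGroup E] [NormedSpace ℝ E] {G : E → E →L[ℝ] E →L[ℝ] ℝ}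
  {F : E → E} {U : Set E} {y₀ : E}

lemma norm_christoffelOf_le (G : E → E →L[ℝ] E →L[ℝ] ℝ) (y u v w : E) :
    ‖christoffelOf G y u v w‖ ≤ 3 / 2 * ‖fderiv ℝ G y‖ * ‖u‖ * ‖v‖ * ‖w‖ := by
  have hle : ∀ p q r : E, ‖fderiv ℝ G y p q r‖ ≤ ‖fderiv ℝ G y‖ * ‖p‖ * ‖q‖ * ‖r‖ := fun p q r =>
    (((fderiv ℝ G y p).le_opNorm₂ q r)).trans (by gcongr; exact (fderiv ℝ G y).le_opNorm p)
  rw [christoffelOf, norm_mul, Real.norm_of_nonneg (by norm_num : (0 : ℝ) ≤ 1 / 2)]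
  linarith [norm_sub_le (fderiv ℝ G y u v w + fderiv ℝ G y v u w) (fderiv ℝ G y w u v),
    norm_add_le (fderiv ℝ G y u v w) (fderiv ℝ G y v u w), hle u v w, hle v u w, hle w u v]

/-- Around `y`, the linear form `ℓ` is a time function whose increase along a causal curve bounds
both the coordinate length of the curve and the logarithmic change of a parallel vector. -/
def IsTimeFunctionAt (G : E → E →L[ℝ] E →L[ℝ] ℝ) (F : E → E) (ℓ : E →L[ℝ] ℝ) (y : E) : Prop :=
  ∀ u ∈ causalCone (G y) (F y), ‖u‖ ≤ ℓ u ∧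
    ∀ ξ a, (∀ w, G y a w + christoffelOf G y u ξ w = 0) → ‖a‖ ≤ ℓ u * ‖ξ‖

variable [FiniteDimensional ℝ E]

lemma IsLorentzMetricOn.exists_norm_le (hG : IsLorentzMetricOn G U) (hy₀ : y₀ ∈ U) :
    ∃ N, ∀ᶠ y in 𝓝 y₀, ∀ a, ‖a‖ ≤ N * ‖G y a‖ := by
  have := FiniteDimensional.complete ℝ E
  obtain ⟨A, hA⟩ := (hG.lorentz y₀ hy₀).exists_equiv
  have hcont : ContinuousAt G y₀ := hG.contDiffOn.continuousOn.continuousAt (hG.isOpen.mem_nhds hy₀)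
  have hinverse : ContinuousAt (fun y => ‖(G y).inverse‖) y₀ :=
    ((hA ▸ contDiffAt_map_inverse (n := 0) A).continuousAt.comp hcont).norm
  refine ⟨‖(G y₀).inverse‖ + 1, ?_⟩
  filter_upwards [hinverse.eventually_lt_const (lt_add_one _),
    hcont.eventually (hA ▸ ContinuousLinearEquiv.nhds A)] with y hy ⟨B, hB⟩ a
  calc ‖a‖ = ‖(G y).inverse (G y a)‖ := by simp [← hB]
    _ ≤ ‖(G y).inverse‖ * ‖G y a‖ := ContinuousLinearMap.le_opNorm _ _
    _ ≤ (‖(G y₀).inverse‖ + 1) * ‖G y a‖ := by gcongr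

lemma IsLorentzMetricOn.exists_transport_bound (hG : IsLorentzMetricOn G U) (hy₀ : y₀ ∈ U) :
    ∃ C ≥ 0, ∀ᶠ y in 𝓝 y₀, ∀ u ξ a : E,
      (∀ w, G y a w + christoffelOf G y u ξ w = 0) → ‖a‖ ≤ C * ‖u‖ * ‖ξ‖ := by
  obtain ⟨N, hN⟩ := hG.exists_norm_le hy₀
  have hderiv : ContinuousAt (fun y => ‖fderiv ℝ G y‖) y₀ :=
    (hG.contDiffOn_fderiv.continuousOn.continuousAt (hG.isOpen.mem_nhds hy₀)).norm
  set K := ‖fderiv ℝ G y₀‖ + 1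
  refine ⟨|N| * (3 / 2 * K), by positivity, ?_⟩
  filter_upwards [hN, hderiv.eventually_lt_const (lt_add_one _)] with y hy hK u ξ a ha
  have hGa : ‖G y a‖ ≤ 3 / 2 * K * ‖u‖ * ‖ξ‖ := by
    refine ContinuousLinearMap.opNorm_le_bound _ (by positivity) fun w => ?_
    rw [eq_neg_of_add_eq_zero_left (ha w), norm_neg]
    exact (norm_christoffelOf_le G y u ξ w).trans (by gcongr)
  calc ‖a‖ ≤ N * ‖G y a‖ := hy a
    _ ≤ |N| * (3 / 2 * K * ‖u‖ * ‖ξ‖) := by gcongr; exact le_abs_self N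
    _ = |N| * (3 / 2 * K) * ‖u‖ * ‖ξ‖ := by ring

lemma IsOrientedLorentzOn.exists_isTimeFunctionAt (hG : IsOrientedLorentzOn G F U)
    (hy₀ : y₀ ∈ U) :
    ∃ ℓ : E →L[ℝ] ℝ, ∀ᶠ y in 𝓝 y₀, IsTimeFunctionAt G F ℓ y := by
  obtain ⟨k, hk, hcone⟩ := hG.exists_mul_norm_le_of_mem_causalCone hy₀
  obtain ⟨C, hC, htransport⟩ := hG.toIsLorentzMetricOn.exists_transport_bound hy₀
  refine ⟨((1 + C) / k) • (-G y₀ (F y₀)), ?_⟩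
  filter_upwards [hcone, htransport] with y hy hy' u hu
  have hle : (1 + C) * ‖u‖ ≤ ((1 + C) / k) * (-G y₀ (F y₀)) u := by
    rw [div_mul_eq_mul_div, le_div_iff₀ hk, mul_assoc, mul_comm ‖u‖]
    gcongr
    exact hy u hu
  refine ⟨le_trans ?_ hle, fun ξ a ha => (hy' u ξ a ha).trans ?_⟩
  · nlinarith [norm_nonneg u]
  · exact mul_le_mul_of_nonneg_right (le_trans (by nlinarith [norm_nonneg u]) hle) (norm_nonneg ξ)

end TimeFunction

section Monotonicity

variable {f : ℝ → ℝ} {a b : ℝ}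

lemma le_of_hasDerivAt_nonneg_off_finite (B : Finset ℝ) (hab : a ≤ b)
    (hf : ContinuousOn f (Icc a b))
    (hderiv : ∀ t ∈ Ioo a b, t ∉ B → ∃ f' ≥ 0, HasDerivAt f f' t) : f a ≤ f b := by
  induction B using Finset.induction_on generalizing a b with
  | empty =>
    choose! f' hnonneg hf' using fun t ht => hderiv t ht (Finset.notMem_empty t)
    exact monotoneOn_of_hasDerivWithinAt_nonneg (convex_Icc a b) hf
      (fun t ht => (hf' t (by rwa [interior_Icc] at ht)).hasDerivWithinAt)
      (fun t ht => hnonneg t (by rwa [interior_Icc] at ht))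
      (left_mem_Icc.2 hab) (right_mem_Icc.2 hab) hab
  | insert p B _ ih =>
    by_cases hp : p ∈ Ioo a b
    · refine (ih hp.1.le (hf.mono (Icc_subset_Icc_right hp.2.le)) fun t ht htB => ?_).trans
        (ih hp.2.le (hf.mono (Icc_subset_Icc_left hp.1.le)) fun t ht htB => ?_)
      · exact hderiv t ⟨ht.1, ht.2.trans hp.2⟩ (by simp [htB, ht.2.ne])
      · exact hderiv t ⟨hp.1.trans ht.1, ht.2⟩ (by simp [htB, ht.1.ne'])
    · refine ih hab hf fun t ht htB => hderiv t ht ?_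
      rw [Finset.mem_insert, not_or]
      exact ⟨fun h => hp (h ▸ ht), htB⟩

lemma monotoneOn_of_hasDerivWithinAt_Ici_nonneg (hf : ContinuousOn f (Icc a b))
    (hderiv : ∀ t ∈ Ico a b, ∃ f' ≥ 0, HasDerivWithinAt f f' (Ici t) t) :
    MonotoneOn f (Icc a b) := by
  choose! f' hnonneg hf' using hderiv
  intro x hx y hy hxy
  have hle := image_le_of_deriv_right_le_deriv_boundary (f := fun t => -f t)
    (f' := fun t => -f' t) (B := fun _ => -f x) (B' := fun _ => 0)
    (hf.neg.mono (Icc_subset_Icc hx.1 hy.2))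
    (fun t ht => (hf' t ⟨hx.1.trans ht.1, ht.2.trans_le hy.2⟩).neg) le_rfl continuousOn_const
    (fun t _ => hasDerivWithinAt_const _ _ _)
    (fun t ht => neg_nonpos.2 (hnonneg t ⟨hx.1.trans ht.1, ht.2.trans_le hy.2⟩))
    (right_mem_Icc.2 hxy)
  exact neg_le_neg_iff.1 hle

lemma norm_le_exp_mul_norm {E : Type*} [NormedAddCommGroup E] [InnerProductSpace ℝ E]
    {ξ : ℝ → E} {B : Set ℝ} (hab : a ≤ b) (hB : (B ∩ Icc a b).Finite)
    (hf : ContinuousOn f (Icc a b)) (hξ : ContinuousOn ξ (Icc a b))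
    (hderiv : ∀ t ∈ Ioo a b, t ∉ B → ∃ f' ξ', HasDerivAt f f' t ∧ HasDerivAt ξ ξ' t ∧
      ‖ξ'‖ ≤ f' * ‖ξ t‖) :
    ‖ξ a‖ ≤ Real.exp (f b - f a) * ‖ξ b‖ := by
  have hmono : ‖ξ a‖ ^ 2 * Real.exp (2 * f a) ≤ ‖ξ b‖ ^ 2 * Real.exp (2 * f b) := by
    refine le_of_hasDerivAt_nonneg_off_finite hB.toFinset
      (f := fun t => ‖ξ t‖ ^ 2 * Real.exp (2 * f t)) hab
      ((hξ.norm.pow 2).mul (hf.const_mul 2).rexp) fun t ht htB => ?_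
    obtain ⟨f', ξ', hf', hξ', hle⟩ :=
      hderiv t ht fun h => htB (hB.mem_toFinset.2 ⟨h, Ioo_subset_Icc_self ht⟩)
    refine ⟨_, ?_, hξ'.norm_sq.mul (hf'.const_mul 2).exp⟩
    have hinner : -(f' * ‖ξ t‖ ^ 2) ≤ inner ℝ (ξ t) ξ' := by
      nlinarith [(abs_le.1 (abs_real_inner_le_norm (ξ t) ξ')).1, norm_nonneg (ξ t)]
    nlinarith [mul_nonneg (neg_le_iff_add_nonneg'.1 hinner) (Real.exp_pos (2 * f t)).le]
  have hsq : ∀ x y : ℝ, x ^ 2 * Real.exp (2 * y) = (x * Real.exp y) ^ 2 := fun x y => by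
    rw [mul_pow, ← Real.exp_nat_mul, Nat.cast_ofNat]
  rw [hsq, hsq] at hmono
  rw [Real.exp_sub, div_mul_eq_mul_div, le_div_iff₀ (Real.exp_pos _), mul_comm (Real.exp _)]
  exact le_of_pow_le_pow_left₀ two_ne_zero (by positivity) hmono

end Monotonicity

section Integrals

lemma setLIntegral_deriv_le_of_monotoneOn {h : ℝ → ℝ} {a b : ℝ} (hab : a ≤ b)
    (hh : MonotoneOn h (Icc a b)) :
    ∫⁻ t in Ioo a b, ENNReal.ofReal (deriv h t) ≤ ENNReal.ofReal (h b - h a) := by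
  have huIcc : MonotoneOn h (uIcc a b) := by rwa [uIcc_of_le hab]
  have hint : IntegrableOn (deriv h) (Ioo a b) :=
    ((intervalIntegrable_iff_integrableOn_Ioc_of_le hab).1 huIcc.intervalIntegrable_deriv).mono_set
      Ioo_subset_Ioc_self
  have hnonneg : 0 ≤ᵐ[volume.restrict (Ioo a b)] deriv h := by
    filter_upwards [ae_restrict_mem measurableSet_Ioo] with t ht
    rw [← derivWithin_of_mem_nhds (Icc_mem_nhds ht.1 ht.2)]
    exact hh.derivWithin_nonneg
  have hle := huIcc.intervalIntegral_deriv_mem_uIcc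
  rw [uIcc_of_le (sub_nonneg.2 (hh (left_mem_Icc.2 hab) (right_mem_Icc.2 hab) hab)),
    intervalIntegral.integral_of_le hab, integral_Ioc_eq_integral_Ioo] at hle
  rw [← ofReal_integral_eq_lintegral_ofReal hint hnonneg]
  exact ENNReal.ofReal_le_ofReal hle.2

lemma setLIntegral_inter_Ici_le {s : Set ℝ} (hs : s.OrdConnected) {t₀ : ℝ}
    {f : ℝ → ENNReal} {K : ENNReal} (hf : ∀ b ∈ s, t₀ ≤ b → ∫⁻ t in Ioo t₀ b, f t ≤ K) :
    ∫⁻ t in s ∩ Ici t₀, f t ≤ K := by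
  let ι := {q : ℚ // t₀ ≤ (q : ℝ) ∧ (q : ℝ) ∈ s}
  have hinterior : interior (s ∩ Ici t₀) ⊆ ⋃ q : ι, Ioo t₀ (q.1 : ℝ) := by
    intro t ht
    have hmem := interior_subset ht
    rw [interior_inter, interior_Ici] at ht
    obtain ⟨u, htu, hu⟩ := ((eventually_mem_nhdsWithin (s := Ioi t)).and
      (nhdsWithin_le_nhds (mem_interior_iff_mem_nhds.1 ht.1))).exists
    obtain ⟨q, htq, hqu⟩ := exists_rat_btwn (mem_Ioi.1 htu)
    exact mem_iUnion.2 ⟨⟨q, hmem.2.trans htq.le, hs.out hmem.1 hu ⟨htq.le, hqu.le⟩⟩, ht.2, htq⟩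
  have hdirected : Directed (· ⊆ ·) fun q : ι => Ioo t₀ (q.1 : ℝ) :=
    directed_of_isDirected_le fun p q hpq => Ioo_subset_Ioo_right (Rat.cast_le.2 hpq)
  have hfrontier :=
    (hs.inter (ordConnected_Ici (a := t₀))).convex.addHaar_frontier (volume : Measure ℝ)
  calc ∫⁻ t in s ∩ Ici t₀, f t = ∫⁻ t in interior (s ∩ Ici t₀), f t :=
        setLIntegral_congr (interior_ae_eq_of_null_frontier hfrontier).symm
    _ ≤ ∫⁻ t in ⋃ q : ι, Ioo t₀ (q.1 : ℝ), f t := lintegral_mono_set hinterior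
    _ = ⨆ q : ι, ∫⁻ t in Ioo t₀ (q.1 : ℝ), f t := setLIntegral_iUnion_of_directed _ hdirected
    _ ≤ K := iSup_le fun q => hf q.1 q.2.2 q.2.1

end Integrals

section Escape

lemma sub_le_of_mem_chartBall {d : ℕ} {M : Type*} [TopologicalSpace M]
    [ChartedSpace (Coord d) M] (ℓ : Coord d →L[ℝ] ℝ) {x₀ x y : M} {ρ : ℝ}
    (hx : x ∈ chartBall d x₀ ρ) (hy : y ∈ chartBall d x₀ ρ) :
    ℓ (extChartAt (𝓡 d) x₀ y) - ℓ (extChartAt (𝓡 d) x₀ x) ≤ ‖ℓ‖ * (2 * ρ) := by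
  rw [← map_sub]
  refine (le_abs_self _).trans ((ℓ.le_opNorm _).trans ?_)
  gcongr
  rw [← dist_eq_norm]
  linarith [dist_triangle_right (extChartAt (𝓡 d) x₀ y) (extChartAt (𝓡 d) x₀ x)
    (extChartAt (𝓡 d) x₀ x₀), Metric.mem_ball.1 hx.2, Metric.mem_ball.1 hy.2]

variable {d : ℕ} {M : Type*} [TopologicalSpace M] [ChartedSpace (Coord d) M]
  [IsManifold (𝓡 d) ∞ M] {g : LorentzStructure d M} {x₀ : M} {γ : ℝ → M} {s : Set ℝ} {a b t t₀ : ℝ}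
  {ℓ : Coord d →L[ℝ] ℝ}

/-- The part of the chart domain at `x₀` on which the linear form `ℓ` of the coordinates is a time
function in the sense of `IsTimeFunctionAt`. -/
def timeFunctionDomain (g : LorentzStructure d M) (x₀ : M) (ℓ : Coord d →L[ℝ] ℝ) : Set M :=
  {x | x ∈ (extChartAt (𝓡 d) x₀).source ∧
    IsTimeFunctionAt (coordMetric g x₀) (coordFuture g x₀) ℓ (extChartAt (𝓡 d) x₀ x)}

lemma exists_chartBall_subset_timeFunctionDomain (g : LorentzStructure d M) (x₀ : M) :
    ∃ ℓ, ∃ ρ > 0, chartBall d x₀ ρ ⊆ timeFunctionDomain g x₀ ℓ := by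
  obtain ⟨ℓ, hℓ⟩ := (isOrientedLorentzOn_coord g x₀).exists_isTimeFunctionAt
    (mem_extChartAt_target x₀)
  obtain ⟨ρ, hρ, hball⟩ := Metric.eventually_nhds_iff_ball.1 hℓ
  exact ⟨ℓ, ρ, hρ, fun x hx => ⟨hx.1, hball _ hx.2⟩⟩

lemma exists_norm_symm_le_chartDeriv (e : Coord d ≃L[ℝ] TangentSpace (𝓡 d) (γ t₀))
    (h : γ t₀ ∈ (extChartAt (𝓡 d) x₀).source) :
    ∃ m ≥ 0, ∀ u : Coord d, ‖u‖ ≤ m * ‖chartDeriv x₀ (γ t₀) (e u)‖ := by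
  let A : Coord d →L[ℝ] Coord d :=
    (chartDeriv x₀ (γ t₀)).comp (e : Coord d →L[ℝ] TangentSpace (𝓡 d) (γ t₀))
  have hker : LinearMap.ker (A : Coord d →ₗ[ℝ] Coord d) = ⊥ :=
    LinearMap.ker_eq_bot.2 ((chartDeriv_injective h).comp e.injective)
  obtain ⟨m, -, hm⟩ := LinearMap.exists_antilipschitzWith (A : Coord d →ₗ[ℝ] Coord d) hker
  refine ⟨m, m.2, fun u => ?_⟩
  have hle := hm.le_mul_dist u 0
  rw [map_zero, dist_zero_right, dist_zero_right] at hle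
  exact hle

lemma IsParallelAlong.mono {s' : Set ℝ} {V : ∀ t, TangentSpace (𝓡 d) (γ t)}
    (h : IsParallelAlong g γ s V) (hs : s' ⊆ s) : IsParallelAlong g γ s' V := by
  obtain ⟨hc, B, hB, hode⟩ := h
  exact ⟨hc.mono hs, B, hB.mono hs, fun t ht => hode t ⟨interior_mono hs ht.1, ht.2⟩⟩

namespace IsCausalCurve

lemma continuousOn_chart (hγ : IsCausalCurve g γ s)
    (hdom : ∀ t ∈ s, γ t ∈ timeFunctionDomain g x₀ ℓ) :
    ContinuousOn (fun t => extChartAt (𝓡 d) x₀ (γ t)) s :=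
  (continuousOn_extChartAt x₀).comp hγ.2.1 fun t ht => (hdom t ht).1

lemma monotoneOn_timeFunction (hγ : IsCausalCurve g γ (Icc a b))
    (hdom : ∀ t ∈ Icc a b, γ t ∈ timeFunctionDomain g x₀ ℓ) :
    MonotoneOn (fun t => ℓ (extChartAt (𝓡 d) x₀ (γ t))) (Icc a b) := by
  refine monotoneOn_of_hasDerivWithinAt_Ici_nonneg
    (ℓ.continuous.comp_continuousOn (hγ.continuousOn_chart hdom)) fun t ht => ?_
  obtain ⟨hsource, htime⟩ := hdom t (Ico_subset_Icc_self ht)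
  obtain ⟨v, hv, hderiv⟩ := hγ.exists_right_deriv ht.2 (Icc_subset_Icc_left ht.1) hsource
  exact ⟨_, (norm_nonneg _).trans (htime _ ((chartDeriv_mem_causalCone_iff hsource).2 hv)).1,
    ℓ.hasFDerivAt.comp_hasDerivWithinAt t hderiv⟩

lemma deriv_mem_causalCone (hγ : IsCausalCurve g γ s) (ht : s ∈ 𝓝 t)
    (hsource : γ t ∈ (extChartAt (𝓡 d) x₀).source) {c' : Coord d}
    (hc' : HasDerivAt (fun τ => extChartAt (𝓡 d) x₀ (γ τ)) c' t) :
    c' ∈ causalCone (coordMetric g x₀ (extChartAt (𝓡 d) x₀ (γ t)))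
      (coordFuture g x₀ (extChartAt (𝓡 d) x₀ (γ t))) := by
  obtain ⟨u, htu, hus⟩ := mem_nhdsGE_iff_exists_Icc_subset.1 (mem_nhdsWithin_of_mem_nhds ht)
  obtain ⟨v, hv, hderiv⟩ := hγ.exists_right_deriv htu hus hsource
  rw [(uniqueDiffWithinAt_Ici t).eq_deriv _ hc'.hasDerivWithinAt hderiv]
  exact (chartDeriv_mem_causalCone_iff hsource).2 hv

lemma enorm_chartDeriv_velocity_le (hγ : IsCausalCurve g γ s) (ht : s ∈ 𝓝 t)
    (hdom : γ t ∈ timeFunctionDomain g x₀ ℓ) :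
    ‖chartDeriv (d := d) x₀ (γ t) (velocity γ s t)‖ₑ ≤
      ENNReal.ofReal (deriv (fun τ => ℓ (extChartAt (𝓡 d) x₀ (γ τ))) t) := by
  by_cases hdiff : MDifferentiableWithinAt 𝓘(ℝ, ℝ) (𝓡 d) γ s t
  · have hderiv := (hasDerivWithinAt_chart hdiff hdom.1).hasDerivAt ht
    have hℓ : HasDerivAt (fun τ => ℓ (extChartAt (𝓡 d) x₀ (γ τ))) _ t :=
      ℓ.hasFDerivAt.comp_hasDerivAt t hderiv
    rw [← ofReal_norm, hℓ.deriv]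
    exact ENNReal.ofReal_le_ofReal (hdom.2 _ (hγ.deriv_mem_causalCone ht hdom.1 hderiv)).1
  · have hzero : velocity (d := d) γ s t = 0 := by
      rw [velocity, mfderivWithin_zero_of_not_mdifferentiableWithinAt hdiff]
      rfl
    rw [hzero, map_zero, enorm_zero]
    exact zero_le

lemma norm_chartDeriv_le_of_isParallelAlong (hγ : IsCausalCurve g γ (Icc a b)) (hab : a ≤ b)
    (hdom : ∀ t ∈ Icc a b, γ t ∈ timeFunctionDomain g x₀ ℓ)
    {V : ∀ t, TangentSpace (𝓡 d) (γ t)} (hV : IsParallelAlong g γ (Icc a b) V) :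
    ‖chartDeriv x₀ (γ a) (V a)‖ ≤
      Real.exp (ℓ (extChartAt (𝓡 d) x₀ (γ b)) - ℓ (extChartAt (𝓡 d) x₀ (γ a))) *
        ‖chartDeriv x₀ (γ b) (V b)‖ := by
  obtain ⟨hVcont, B, hB, hode⟩ := hV
  have hξ : ContinuousOn (fun t => chartDeriv x₀ (γ t) (V t)) (Icc a b) :=
    ContinuousOn.comp (g := fun p : TangentBundle (𝓡 d) M => chartDeriv x₀ p.1 p.2)
      (continuousOn_chartDeriv x₀) hVcont fun t ht => (hdom t ht).1
  refine norm_le_exp_mul_norm (f := fun t => ℓ (extChartAt (𝓡 d) x₀ (γ t)))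
    (ξ := fun t => chartDeriv x₀ (γ t) (V t)) hab (hB a b subset_rfl)
    (ℓ.continuous.comp_continuousOn (hγ.continuousOn_chart hdom)) hξ fun t ht htB => ?_
  obtain ⟨hsource, htime⟩ := hdom t (Ioo_subset_Icc_self ht)
  obtain ⟨hc, hξt, hparallel⟩ := hode t ⟨by rwa [interior_Icc], htB⟩ x₀
    (by rwa [extChartAt_source] at hsource)
  exact ⟨_, _, ℓ.hasFDerivAt.comp_hasDerivAt t hc.hasDerivAt, hξt.hasDerivAt,
    (htime _ (hγ.deriv_mem_causalCone (Icc_mem_nhds ht.1 ht.2) hsource hc.hasDerivAt)).2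
      _ _ hparallel⟩

lemma exists_frame_bound (hγ : IsCausalCurve g γ s)
    {e : ∀ t : ℝ, Coord d ≃L[ℝ] TangentSpace (𝓡 d) (γ t)}
    (hparallel : ∀ u : Coord d, IsParallelAlong g γ s (fun t => e t u)) (ht₀ : t₀ ∈ s)
    (hdom : ∀ t ∈ s, t₀ ≤ t → γ t ∈ timeFunctionDomain g x₀ ℓ) {D : ℝ}
    (hD : ∀ t ∈ s, t₀ ≤ t →
      ℓ (extChartAt (𝓡 d) x₀ (γ t)) - ℓ (extChartAt (𝓡 d) x₀ (γ t₀)) ≤ D) :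
    ∃ Q ≥ 0, ∀ t ∈ s, t₀ ≤ t → ∀ v : TangentSpace (𝓡 d) (γ t),
      ‖(e t).symm v‖ ≤ Q * ‖chartDeriv x₀ (γ t) v‖ := by
  obtain ⟨m, hm, hbound⟩ := exists_norm_symm_le_chartDeriv (e t₀) (hdom t₀ ht₀ le_rfl).1
  refine ⟨m * Real.exp D, by positivity, fun t ht htt₀ v => ?_⟩
  obtain ⟨u, rfl⟩ := (e t).surjective v
  have hsub : Icc t₀ t ⊆ s := hγ.1.out ht₀ ht
  rw [ContinuousLinearEquiv.symm_apply_apply, mul_assoc]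
  refine (hbound u).trans ?_
  gcongr
  refine (norm_chartDeriv_le_of_isParallelAlong (hγ.mono hsub ordConnected_Icc) htt₀
    (fun τ hτ => hdom τ (hsub hτ) hτ.1) ((hparallel u).mono hsub)).trans ?_
  gcongr
  exact hD t ht htt₀

end IsCausalCurve

theorem exists_chartBall_escape (g : LorentzStructure d M) (x₀ : M) :
    ∃ ρ > 0, ∀ γ s, IsCausalCurve g γ s → IsFutureInfinite g γ s →
      ∀ t₀ ∈ s, ∃ t ∈ s, t₀ ≤ t ∧ γ t ∉ chartBall d x₀ ρ := by
  obtain ⟨ℓ, ρ, hρ, hball⟩ := exists_chartBall_subset_timeFunctionDomain g x₀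
  refine ⟨ρ, hρ, fun γ s hγ ⟨e, hparallel, hint⟩ t₀ ht₀ => ?_⟩
  by_contra! hstay
  have hD : ∀ t ∈ s, t₀ ≤ t →
      ℓ (extChartAt (𝓡 d) x₀ (γ t)) - ℓ (extChartAt (𝓡 d) x₀ (γ t₀)) ≤ ‖ℓ‖ * (2 * ρ) :=
    fun t ht htt₀ => sub_le_of_mem_chartBall ℓ (hstay t₀ ht₀ le_rfl) (hstay t ht htt₀)
  obtain ⟨Q, hQ, hframe⟩ := hγ.exists_frame_bound hparallel ht₀
    (fun t ht htt₀ => hball (hstay t ht htt₀)) hD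
  have hle : ∫⁻ t in s ∩ Ici t₀, ‖(e t).symm (velocity γ s t)‖ₑ ≤
      ENNReal.ofReal Q * ENNReal.ofReal (‖ℓ‖ * (2 * ρ)) := by
    refine setLIntegral_inter_Ici_le hγ.1 fun b hb htb => ?_
    have hsub : Icc t₀ b ⊆ s := hγ.1.out ht₀ hb
    have hdom : ∀ t ∈ Icc t₀ b, γ t ∈ timeFunctionDomain g x₀ ℓ := fun t ht =>
      hball (hstay t (hsub ht) ht.1)
    calc ∫⁻ t in Ioo t₀ b, ‖(e t).symm (velocity γ s t)‖ₑ
        ≤ ∫⁻ t in Ioo t₀ b, ENNReal.ofReal Q *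
            ENNReal.ofReal (deriv (fun τ => ℓ (extChartAt (𝓡 d) x₀ (γ τ))) t) := by
          refine setLIntegral_mono' measurableSet_Ioo fun t ht => ?_
          have htI := Ioo_subset_Icc_self ht
          refine le_trans ?_ (mul_le_mul_right (hγ.enorm_chartDeriv_velocity_le
            (mem_of_superset (Icc_mem_nhds ht.1 ht.2) hsub) (hdom t htI)) _)
          rw [← ofReal_norm, ← ofReal_norm, ← ENNReal.ofReal_mul hQ]
          exact ENNReal.ofReal_le_ofReal (hframe t (hsub htI) ht.1.le _)
      _ = ENNReal.ofReal Q * ∫⁻ t in Ioo t₀ b,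
            ENNReal.ofReal (deriv (fun τ => ℓ (extChartAt (𝓡 d) x₀ (γ τ))) t) :=
          lintegral_const_mul' _ _ ENNReal.ofReal_ne_top
      _ ≤ ENNReal.ofReal Q * ENNReal.ofReal (‖ℓ‖ * (2 * ρ)) := by
          gcongr
          exact (setLIntegral_deriv_le_of_monotoneOn htb
            (IsCausalCurve.monotoneOn_timeFunction (hγ.mono hsub ordConnected_Icc) hdom)).trans
            (ENNReal.ofReal_le_ofReal (hD b hb htb))
  exact (ENNReal.mul_lt_top ENNReal.ofReal_lt_top ENNReal.ofReal_lt_top).not_ge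
    (hint t₀ ht₀ ▸ hle)

end Escape

/-! ### A null geodesic germ through each point of a causal horizon -/

namespace LocalGeodesicFlow

variable {E : Type*} [NormedAddCommGroup E] [NormedSpace ℝ E] [FiniteDimensional ℝ E]
  {G : E → E →L[ℝ] E →L[ℝ] ℝ} {F : E → E} {U K : Set E} {y₀ : E} {κ : ℝ}

theorem exists_causal_exp_mem_of_frequently (Φ : LocalGeodesicFlow G U y₀ κ)
    (hG : IsOrientedLorentzOn G F U) (hy₀ : y₀ ∈ U) (hK : IsClosed K) (hy₀K : y₀ ∉ K)
    (hfreq : ∃ᶠ y in 𝓝 y₀, (Φ.timelikeImage F y ∩ K).Nonempty) :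
    ∃ w ∈ Metric.closedBall 0 (Φ.R / 2) ∩ causalCone (G y₀) (F y₀), Φ.exp y₀ w ∈ K := by
  have hR : 0 < Φ.R / 2 := half_pos Φ.R_pos
  obtain ⟨y, hy, hyR⟩ := exists_seq_forall_of_frequently
    (hfreq.and_eventually (Metric.closedBall_mem_nhds y₀ hR))
  choose hyK hyR using hyR
  choose x hx hxK using hyK
  choose v hv hvx using hx
  obtain ⟨w, hw, ψ, hψ, hlim⟩ :=
    (isCompact_closedBall (0 : E) (Φ.R / 2)).tendsto_subseq fun n => (hv n).1
  have hy' : Tendsto (y ∘ ψ) atTop (𝓝 y₀) := hy.comp hψ.tendsto_atTop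
  have hy₀R := Metric.mem_closedBall_self (x := y₀) hR.le
  have hexp : Tendsto (fun n => Φ.exp (y (ψ n)) (v (ψ n))) atTop (𝓝 (Φ.exp y₀ w)) := by
    rw [tendsto_iff_dist_tendsto_zero]
    refine squeeze_zero (fun _ => dist_nonneg)
      (fun n => dist_exp_le (hyR _) (hv _).1 hy₀R hw) ?_
    have hdist := (hy'.prodMk_nhds hlim).dist (tendsto_const_nhds (x := (y₀, w)))
    rw [dist_self] at hdist
    simpa only [mul_zero, Function.comp_def] using hdist.const_mul 2
  have hexpK : Φ.exp y₀ w ∈ K :=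
    hK.mem_of_tendsto hexp (Eventually.of_forall fun n => hvx (ψ n) ▸ hxK (ψ n))
  have hw0 : w ≠ 0 := by
    rintro rfl
    exact hy₀K (exp_zero (Φ := Φ) hy₀R ▸ hexpK)
  exact ⟨w, ⟨hw, hG.mem_causalCone_of_tendsto hy₀ hw0 hy' hlim fun n => (hv _).2⟩, hexpK⟩

end LocalGeodesicFlow

section Horizon

variable {d : ℕ} {M : Type*} [TopologicalSpace M] [ChartedSpace (Coord d) M]
  [IsManifold (𝓡 d) ∞ M] {g : LorentzStructure d M} {L W : Set M} {x₀ : M} {κ r : ℝ}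
  {Φ : LocalGeodesicFlow (coordMetric g x₀) (extChartAt (𝓡 d) x₀).target
    (extChartAt (𝓡 d) x₀ x₀) κ} {y : Coord d}

lemma IsCausalCurve.mem_timelikeImage {γ : ℝ → M} {a b : ℝ} (hab : a ≤ b)
    (hγ : IsCausalCurve g γ (Icc a b))
    (hy : y ∈ Metric.closedBall (extChartAt (𝓡 d) x₀ x₀) (Φ.τ * Φ.R / 8))
    (hmem : ∀ t ∈ Icc a b, γ t ∈ (extChartAt (𝓡 d) x₀).source ∧
      extChartAt (𝓡 d) x₀ (γ t) ∈ Metric.closedBall (extChartAt (𝓡 d) x₀ x₀) (Φ.τ * Φ.R / 8))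
    (ha : extChartAt (𝓡 d) x₀ (γ a) ∈ Φ.timelikeImage (coordFuture g x₀) y) :
    extChartAt (𝓡 d) x₀ (γ b) ∈ Φ.timelikeImage (coordFuture g x₀) y := by
  refine LocalGeodesicFlow.mem_timelikeImage_of_causal (isOrientedLorentzOn_coord g x₀)
    (c := fun t => extChartAt (𝓡 d) x₀ (γ t)) hy hab
    ((continuousOn_extChartAt x₀).comp hγ.2.1 fun t ht => (hmem t ht).1)
    (fun t ht => (hmem t ht).2) (fun t ht => ?_) ha
  have hsource := (hmem t (Ico_subset_Icc_self ht)).1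
  obtain ⟨v, hv, hderiv⟩ :=
    IsCurveIn.exists_right_deriv hγ ht.2 (Icc_subset_Icc_left ht.1) hsource
  exact ⟨_, (chartDeriv_mem_causalCone_iff hsource).2 hv, hderiv⟩

lemma IsCausalCurve.mem_chartBall_or_exit [T2Space M] {γ : ℝ → M} {a b : ℝ} (hab : a ≤ b)
    (hγ : IsCausalCurve g γ (Icc a b)) (hr : r ≤ Φ.τ * Φ.R / 8)
    (hy : y ∈ Metric.closedBall (extChartAt (𝓡 d) x₀ x₀) (Φ.τ * Φ.R / 8))
    (ha : γ a ∈ chartBall d x₀ r)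
    (haI : extChartAt (𝓡 d) x₀ (γ a) ∈ Φ.timelikeImage (coordFuture g x₀) y) :
    (γ b ∈ chartBall d x₀ r ∧
      extChartAt (𝓡 d) x₀ (γ b) ∈ Φ.timelikeImage (coordFuture g x₀) y) ∨
    ∃ t ∈ Ioc a b, γ t ∈ (extChartAt (𝓡 d) x₀).source ∧
      extChartAt (𝓡 d) x₀ (γ t) ∈ Φ.timelikeImage (coordFuture g x₀) y ∩
        Metric.sphere (extChartAt (𝓡 d) x₀ x₀) r := by
  have hτR : Φ.τ * Φ.R ≤ Φ.R := mul_le_of_le_one_left Φ.R_pos.le Φ.τ_le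
  have hR := Φ.R_pos
  have htarget : Metric.closedBall (extChartAt (𝓡 d) x₀ x₀) r ⊆ (extChartAt (𝓡 d) x₀).target :=
    (Metric.closedBall_subset_closedBall (by linarith)).trans Φ.ball_subset
  have himage : ∀ t ∈ Icc a b, (∀ u ∈ Icc a t, γ u ∈ closure (chartBall d x₀ r)) →
      extChartAt (𝓡 d) x₀ (γ t) ∈ Φ.timelikeImage (coordFuture g x₀) y := fun t ht hu =>
    IsCausalCurve.mem_timelikeImage ht.1
      (hγ.mono (Icc_subset_Icc_right ht.2) ordConnected_Icc) hy
      (fun u hut => (closure_chartBall_subset d x₀ htarget (hu u hut)).imp_right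
        fun h => Metric.closedBall_subset_closedBall hr h) haI
  by_cases hexit : ∃ t ∈ Icc a b, γ t ∉ chartBall d x₀ r
  · obtain ⟨t, ht, hout, hclosure, hin⟩ :=
      exists_first_exit (isOpen_chartBall d x₀) hγ.2.1 ha hexit
    obtain ⟨hsource, hdist⟩ := closure_chartBall_subset d x₀ htarget hclosure
    refine Or.inr ⟨t, ht, hsource, himage t (Ioc_subset_Icc_self ht) fun u hu => ?_,
      le_antisymm hdist (not_lt.1 fun h => hout ⟨hsource, h⟩)⟩
    rcases hu.2.eq_or_lt with rfl | hut
    · exact hclosure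
    · exact subset_closure (hin u ⟨hu.1, hut⟩)
  · push Not at hexit
    exact Or.inl ⟨hexit b (right_mem_Icc.2 hab),
      himage b (right_mem_Icc.2 hab) fun u hu => subset_closure (hexit u hu)⟩

/-- `α` is a geodesic on `[0, τ]`, written as a pair of position and velocity in the chart at `x₀`,
that runs in the closure of `L`. -/
structure IsGeodesicGermIn (g : LorentzStructure d M) (L : Set M) (x₀ : M) (τ : ℝ)
    (α : ℝ → Coord d × Coord d) : Prop where
  pos : 0 < τ
  deriv : ∀ t ∈ Icc 0 τ,
    HasDerivWithinAt α (geodesicField (coordMetric g x₀) (α t)) (Icc 0 τ) t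
  mem_closure : ∀ t ∈ Icc 0 τ, (extChartAt (𝓡 d) x₀).symm (α t).1 ∈ closure L

lemma IsGeodesicGermIn.hasDerivWithinAt_fst {τ : ℝ} {α : ℝ → Coord d × Coord d}
    (hα : IsGeodesicGermIn g L x₀ τ α) :
    HasDerivWithinAt (fun t => (α t).1) (α 0).2 (Ici 0) 0 :=
  hasDerivWithinAt_Ici_of_Icc
    (Spacetimes.hasDerivWithinAt_fst (hα.deriv 0 (left_mem_Icc.2 hα.pos.le)))
    (left_mem_Ico.2 hα.pos)

lemma IsPastSet.isGeodesicGermIn (hL : IsPastSet g L) {w : Coord d}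
    (hw : w ∈ Metric.closedBall 0 (Φ.R / 2))
    (hcausal : w ∈ causalCone (coordMetric g x₀ (extChartAt (𝓡 d) x₀ x₀))
      (coordFuture g x₀ (extChartAt (𝓡 d) x₀ x₀)))
    (hend : (extChartAt (𝓡 d) x₀).symm (Φ.exp (extChartAt (𝓡 d) x₀ x₀) w) ∈ closure L) :
    IsGeodesicGermIn g L x₀ Φ.τ (Φ.Z (extChartAt (𝓡 d) x₀ x₀, w)) := by
  have hz := mk_mem_closedBall
    (Metric.mem_closedBall_self (x := extChartAt (𝓡 d) x₀ x₀) (half_pos Φ.R_pos).le) hw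
  have hderiv := Φ.deriv _ hz
  have hC1 := isC1CurveIn_chart_symm_comp (C := futureCausal g) Φ.τ_pos
    (fun t ht => LocalGeodesicFlow.fst_mem hz ht)
    (fun t ht => hasDerivWithinAt_fst (hderiv t ht)) (LocalGeodesicFlow.continuousOn hz).snd
    fun t ht => (chartSymmDeriv_mem_futureCausal_iff (LocalGeodesicFlow.fst_mem hz ht)).2
      (LocalGeodesicFlow.mem_causalCone (isOrientedLorentzOn_coord g x₀) hz hcausal ht)
  refine ⟨Φ.τ_pos, hderiv, fun t ht => ?_⟩
  rcases ht.2.eq_or_lt with rfl | hlt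
  · exact hend
  · exact (hL.of_causal hlt.le (hC1.mono ht.1 hlt le_rfl)).2 hend

lemma IsPastSet.eventually_mem_of_corner (hL : IsPastSet g L)
    (hy : y ∈ (extChartAt (𝓡 d) x₀).target) {c σ : ℝ → Coord d} {v w : Coord d}
    (hc : HasDerivWithinAt c v (Ici 0) 0) (hσ : HasDerivWithinAt σ w (Ici 0) 0)
    (hc0 : c 0 = y) (hσ0 : σ 0 = y)
    (hwv : w - v ∈ timelikeCone (coordMetric g x₀ y) (coordFuture g x₀ y))
    (hclosure : ∀ᶠ s in 𝓝[>] 0, (extChartAt (𝓡 d) x₀).symm (σ s) ∈ closure L) :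
    ∀ᶠ s in 𝓝[>] 0, (extChartAt (𝓡 d) x₀).symm (c s) ∈ L := by
  obtain ⟨η, hη, hsegment⟩ := hL.exists_segment hy hwv
  have hslope : ∀ᶠ s in 𝓝[>] (0 : ℝ), slope (σ - c) 0 s ∈ Metric.ball (w - v) η :=
    ((hasDerivWithinAt_iff_tendsto_slope' self_notMem_Ioi).1 (hσ.sub hc).Ioi_of_Ici).eventually
      (Metric.ball_mem_nhds _ hη)
  have hnear : ∀ {f : ℝ → Coord d} {f' : Coord d}, HasDerivWithinAt f f' (Ici 0) 0 → f 0 = y →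
      ∀ᶠ s in 𝓝[>] 0, f s ∈ Metric.ball y η := fun {f f'} hf hf0 =>
    (hf0 ▸ (hf.continuousWithinAt.mono Ioi_subset_Ici_self).tendsto).eventually
      (Metric.ball_mem_nhds y hη)
  filter_upwards [hslope, hnear hc hc0, hnear hσ hσ0, hclosure, self_mem_nhdsWithin]
    with s hs hcs hσs hsL hpos
  refine hsegment _ hcs _ hσs s hpos ?_ hsL
  rwa [slope_def_module, Pi.sub_apply, Pi.sub_apply, hc0, hσ0, sub_self, sub_zero, sub_zero] at hs

lemma IsPastSet.mem_of_timelike_germ (hL : IsPastSet g L) {τ : ℝ} {α : ℝ → Coord d × Coord d}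
    (hα : IsGeodesicGermIn g L x₀ τ α) (hα0 : (α 0).1 = extChartAt (𝓡 d) x₀ x₀)
    (htimelike : (α 0).2 ∈ timelikeCone (coordMetric g x₀ (extChartAt (𝓡 d) x₀ x₀))
      (coordFuture g x₀ (extChartAt (𝓡 d) x₀ x₀))) : x₀ ∈ L := by
  have hmem := hL.eventually_mem_of_corner (mem_extChartAt_target x₀)
    (hasDerivWithinAt_const 0 (Ici 0) _) hα.hasDerivWithinAt_fst rfl hα0
    (by rwa [sub_zero]) (eventually_of_mem (Icc_mem_nhdsGT hα.pos) fun s hs => hα.mem_closure s hs)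
  simpa only [extChartAt_to_inv] using hmem.exists.choose_spec

variable [T2Space M]

lemma exists_exit_point (hr : r ≤ Φ.τ * Φ.R / 8)
    (hescape : ∀ γ s, IsCausalCurve g γ s → IsFutureInfinite g γ s →
      ∀ t₀ ∈ s, ∃ t ∈ s, t₀ ≤ t ∧ γ t ∉ chartBall d x₀ r)
    (hW : IsFutureInfiniteWorldline g W) {x : M} (hx : x ∈ pastOf g W)
    (hxr : x ∈ chartBall d x₀ r)
    (hy : y ∈ Metric.closedBall (extChartAt (𝓡 d) x₀ x₀) (Φ.τ * Φ.R / 8))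
    (hxy : extChartAt (𝓡 d) x₀ x ∈ Φ.timelikeImage (coordFuture g x₀) y) :
    (Φ.timelikeImage (coordFuture g x₀) y ∩ (Metric.sphere (extChartAt (𝓡 d) x₀ x₀) r ∩
      (extChartAt (𝓡 d) x₀).symm ⁻¹' closure (pastOf g W))).Nonempty := by
  obtain ⟨γ, s, -, hγ, hinf, rfl⟩ := hW
  suffices hexit : ∃ q ∈ (extChartAt (𝓡 d) x₀).source,
      extChartAt (𝓡 d) x₀ q ∈ Φ.timelikeImage (coordFuture g x₀) y ∩
        Metric.sphere (extChartAt (𝓡 d) x₀ x₀) r ∧ q ∈ closure (pastOf g (γ '' s)) by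
    obtain ⟨q, hq, ⟨hqI, hqr⟩, hqL⟩ := hexit
    exact ⟨_, hqI, hqr, by rwa [mem_preimage, (extChartAt (𝓡 d) x₀).left_inv hq]⟩
  obtain ⟨_, ⟨t₁, ht₁, rfl⟩, σ, a, b, hab, hσ, rfl, hσb, -⟩ := mem_pastOf.1 hx
  have hclosure : ∀ t ∈ s, γ t ∈ closure (pastOf g (γ '' s)) := fun t ht =>
    subset_closure_pastOf g _ (mem_image_of_mem γ ht)
  rcases IsCausalCurve.mem_chartBall_or_exit hab.le hσ.isCausalCurve hr hy hxr hxy with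
    ⟨hball, himage⟩ | ⟨t, ht, hsource, hexit⟩
  · rw [hσb] at hball himage
    obtain ⟨t₂, ht₂, hle, hout⟩ := hescape γ s hγ hinf t₁ ht₁
    have hsub : Icc t₁ t₂ ⊆ s := hγ.1.out ht₁ ht₂
    obtain ⟨t, ht, hsource, hexit⟩ := (IsCausalCurve.mem_chartBall_or_exit hle
      (hγ.mono hsub ordConnected_Icc) hr hy hball himage).resolve_left fun h => hout h.1
    exact ⟨_, hsource, hexit, hclosure t (hsub (Ioc_subset_Icc_self ht))⟩
  · refine ⟨_, hsource, hexit, ?_⟩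
    rcases ht.2.eq_or_lt with rfl | hlt
    · exact hσb ▸ hclosure t₁ ht₁
    · exact subset_closure (mem_pastOf.2 ⟨γ t₁, mem_image_of_mem γ ht₁, hσb ▸
        TimelikeJoined.of_curve hlt (hσ.mono (Icc_subset_Icc_left ht.1.le) ordConnected_Icc)⟩)

lemma frequently_exit_point (hr₀ : 0 < r) (hr : r ≤ Φ.τ * Φ.R / 8)
    (hescape : ∀ γ s, IsCausalCurve g γ s → IsFutureInfinite g γ s →
      ∀ t₀ ∈ s, ∃ t ∈ s, t₀ ≤ t ∧ γ t ∉ chartBall d x₀ r)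
    (hW : IsFutureInfiniteWorldline g W) (hx₀ : x₀ ∈ closure (pastOf g W)) {e : Coord d} {η : ℝ}
    (hη : ∀ᶠ y in 𝓝 (extChartAt (𝓡 d) x₀ x₀),
      ∀ v ∈ Metric.ball e η, v ∈ timelikeCone (coordMetric g x₀ y) (coordFuture g x₀ y))
    (hκη : 2 * κ * ‖e‖ < η) :
    ∃ᶠ y in 𝓝 (extChartAt (𝓡 d) x₀ x₀), (Φ.timelikeImage (coordFuture g x₀) y ∩
      (Metric.sphere (extChartAt (𝓡 d) x₀ x₀) r ∩
        (extChartAt (𝓡 d) x₀).symm ⁻¹' closure (pastOf g W))).Nonempty := by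
  have hR := Φ.R_pos
  have hτR : 0 < Φ.τ * Φ.R := mul_pos Φ.τ_pos hR
  refine frequently_iff.2 fun {N} hN => ?_
  have hshift : Tendsto (fun q : M × ℝ => extChartAt (𝓡 d) x₀ q.1 - q.2 • e)
      (𝓝 x₀ ×ˢ 𝓝[>] 0) (𝓝 (extChartAt (𝓡 d) x₀ x₀)) := by
    have hδ : Tendsto (fun δ : ℝ => δ • e) (𝓝[>] 0) (𝓝 0) :=
      ((continuous_id.smul continuous_const).tendsto' 0 0 (zero_smul ℝ e)).mono_left
        nhdsWithin_le_nhds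
    simpa only [sub_zero, Function.comp_def] using
      ((continuousAt_extChartAt x₀).tendsto.comp tendsto_fst).sub (hδ.comp tendsto_snd)
  have hsmall : ∀ᶠ δ : ℝ in 𝓝[>] 0, δ * ‖e‖ ≤ Φ.τ * Φ.R / 4 :=
    (((continuous_id.mul continuous_const).tendsto' 0 0 (zero_mul ‖e‖)).mono_left
      nhdsWithin_le_nhds).eventually (eventually_le_nhds (by positivity))
  have hball : ∀ {ρ : ℝ}, 0 < ρ → ∀ᶠ y in 𝓝 (extChartAt (𝓡 d) x₀ x₀),
      y ∈ Metric.closedBall (extChartAt (𝓡 d) x₀ x₀) ρ := Metric.closedBall_mem_nhds _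
  have hgood := (hshift.eventually (hη.and ((eventually_mem_set.2 hN).and
    ((hball (half_pos hR)).and (hball (by positivity : 0 < Φ.τ * Φ.R / 8)))))).curry
  obtain ⟨x, hxL, hxr, hx⟩ := ((mem_closure_iff_frequently.1 hx₀).and_eventually
    (((isOpen_chartBall d x₀).eventually_mem (mem_chartBall_self d x₀ hr₀)).and hgood)).exists
  obtain ⟨δ, ⟨hcone, hyN, hyR, hyτR⟩, hδe, hδ⟩ :=
    (hx.and (hsmall.and self_mem_nhdsWithin)).exists
  have himage := LocalGeodesicFlow.add_smul_mem_timelikeImage hcone hκη hδ hyR hδe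
  rw [sub_add_cancel] at himage
  exact ⟨_, hyN, exists_exit_point hr hescape hW hxL hxr hyτR himage⟩

theorem exists_causal_germ (hW : IsFutureInfiniteWorldline g W) {p : M}
    (hp : p ∈ closure (pastOf g W)) :
    ∃ τ α, IsGeodesicGermIn g (pastOf g W) p τ α ∧ (α 0).1 = extChartAt (𝓡 d) p p ∧
      (α 0).2 ∈ causalCone (coordMetric g p (extChartAt (𝓡 d) p p))
        (coordFuture g p (extChartAt (𝓡 d) p p)) := by
  have hG := isOrientedLorentzOn_coord g p
  have hy₀ : extChartAt (𝓡 d) p p ∈ (extChartAt (𝓡 d) p).target := mem_extChartAt_target p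
  obtain ⟨η, hη, hcone⟩ := hG.exists_timelike_ball hy₀ (hG.future_mem hy₀)
  obtain ⟨ρ, hρ, hescape⟩ := exists_chartBall_escape g p
  set φ := extChartAt (𝓡 d) p
  have hκη : ∀ᶠ κ : ℝ in 𝓝[>] 0, 2 * κ * ‖coordFuture g p (φ p)‖ < η := by
    have hcont : Continuous fun κ : ℝ => 2 * κ * ‖coordFuture g p (φ p)‖ := by fun_prop
    exact ((hcont.tendsto' 0 0 (by ring)).mono_left nhdsWithin_le_nhds).eventually
      (eventually_lt_nhds hη)
  obtain ⟨κ, hκη, hκ, hκ'⟩ :=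
    (hκη.and (Ioc_mem_nhdsGT (by norm_num : (0 : ℝ) < 1 / 2))).exists
  obtain ⟨Φ⟩ := hG.toIsLorentzMetricOn.exists_localGeodesicFlow hy₀ hκ hκ'
  have hR := Φ.R_pos
  have hτR : Φ.τ * Φ.R ≤ Φ.R := mul_le_of_le_one_left hR.le Φ.τ_le
  obtain ⟨r, hr₀, hr⟩ : ∃ r, 0 < r ∧ r ≤ min (Φ.τ * Φ.R / 8) ρ :=
    ⟨_, lt_min (by have := Φ.τ_pos; positivity) hρ, le_rfl⟩
  obtain ⟨hrτR, hrρ⟩ := le_min_iff.1 hr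
  have hsphere : Metric.sphere (φ p) r ⊆ φ.target := Metric.sphere_subset_closedBall.trans
    ((Metric.closedBall_subset_closedBall (by linarith)).trans Φ.ball_subset)
  obtain ⟨w, ⟨hw, hcausal⟩, -, hend⟩ := Φ.exists_causal_exp_mem_of_frequently hG hy₀
    (((continuousOn_extChartAt_symm p).mono hsphere).preimage_isClosed_of_isClosed
      Metric.isClosed_sphere isClosed_closure)
    (fun h => hr₀.ne' (Metric.mem_sphere.1 h.1 ▸ dist_self (φ p)))
    (frequently_exit_point hr₀ hrτR (fun γ s hγ hinf t₀ ht₀ =>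
      (hescape γ s hγ hinf t₀ ht₀).imp fun _ h =>
        ⟨h.1, h.2.1, fun hmem => h.2.2 (chartBall_subset_chartBall d p hrρ hmem)⟩) hW hp
      (eventually_of_mem (Metric.ball_mem_nhds _ hη) fun y hy => (hcone y hy).2) hκη)
  have hinit := Φ.init _
    (mk_mem_closedBall (Metric.mem_closedBall_self (x := φ p) (half_pos hR).le) hw)
  exact ⟨Φ.τ, Φ.Z (φ p, w), (isPastSet_pastOf g W).isGeodesicGermIn hw hcausal hend,
    congrArg Prod.fst hinit, by rwa [hinit]⟩

end Horizon

/-! ### Null geodesics in a causal horizon -/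

section Uniqueness

variable {E : Type*} [NormedAddCommGroup E] [NormedSpace ℝ E]

lemma exists_eqOn_Icc_of_hasDerivWithinAt {V : E → E} {f h : ℝ → E} {a b : ℝ}
    (hV : ContDiffAt ℝ 1 V (f a)) (hab : a < b)
    (hf : ∀ t ∈ Icc a b, HasDerivWithinAt f (V (f t)) (Icc a b) t)
    (hh : ∀ t ∈ Icc a b, HasDerivWithinAt h (V (h t)) (Icc a b) t) (heq : f a = h a) :
    ∃ c ∈ Ioc a b, EqOn f h (Icc a c) := by
  obtain ⟨K, S, hS, hlip⟩ := hV.exists_lipschitzOnWith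
  have hmem : ∀ {f : ℝ → E} {f' : E}, HasDerivWithinAt f f' (Icc a b) a → S ∈ 𝓝 (f a) →
      ∀ᶠ t in 𝓝[≥] a, f t ∈ S := fun hf hS =>
    (hasDerivWithinAt_Ici_of_Icc hf ⟨le_rfl, hab⟩).continuousWithinAt.eventually hS
  obtain ⟨c, hac, hc⟩ := mem_nhdsGE_iff_exists_Icc_subset.1
    ((hmem (hf a ⟨le_rfl, hab.le⟩) hS).and
      ((hmem (hh a ⟨le_rfl, hab.le⟩) (heq ▸ hS)).and (Icc_mem_nhdsGE hab)))
  have hcb : c ≤ b := (hc (right_mem_Icc.2 hac.le)).2.2.2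
  have hsub : Icc a c ⊆ Icc a b := Icc_subset_Icc_right hcb
  have hright : ∀ {f : ℝ → E}, (∀ t ∈ Icc a b, HasDerivWithinAt f (V (f t)) (Icc a b) t) →
      ∀ t ∈ Ico a c, HasDerivWithinAt f (V (f t)) (Ici t) t := fun hf t ht =>
    hasDerivWithinAt_Ici_of_Icc (hf t (hsub (Ico_subset_Icc_self ht))) ⟨ht.1, ht.2.trans_le hcb⟩
  exact ⟨c, ⟨hac, hcb⟩, ODE_solution_unique_of_mem_Icc_right (v := fun _ => V) (s := fun _ => S)
    (fun _ _ => hlip) (fun t ht => ((hf t (hsub ht)).mono hsub).continuousWithinAt) (hright hf)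
    (fun t ht => (hc (Ico_subset_Icc_self ht)).1)
    (fun t ht => ((hh t (hsub ht)).mono hsub).continuousWithinAt) (hright hh)
    (fun t ht => (hc (Ico_subset_Icc_self ht)).2.1) heq⟩

end Uniqueness

section HorizonGeodesics

variable {d : ℕ} {M : Type*} [TopologicalSpace M] [ChartedSpace (Coord d) M]
  [IsManifold (𝓡 d) ∞ M] {g : LorentzStructure d M} {L W : Set M} {x₀ : M} {γ : ℝ → M}
  {τ a T : ℝ} {α : ℝ → Coord d × Coord d}

lemma IsGeodesicGermIn.rescale (hα : IsGeodesicGermIn g L x₀ τ α) {k : ℝ} (hk : 0 < k) :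
    IsGeodesicGermIn g L x₀ (τ / k) fun t => ((α (k * t)).1, k • (α (k * t)).2) := by
  have hmaps : MapsTo (k * ·) (Icc 0 (τ / k)) (Icc 0 τ) := fun t ht =>
    ⟨mul_nonneg hk.le ht.1, (le_div_iff₀' hk).1 ht.2⟩
  refine ⟨div_pos hα.pos hk, fun t ht => ?_, fun t ht => hα.mem_closure _ (hmaps ht)⟩
  have hcomp := (hα.deriv _ (hmaps ht)).scomp t
    (((hasDerivAt_id t).const_mul k).hasDerivWithinAt.congr_deriv (mul_one k)) hmaps
  refine ((Spacetimes.hasDerivWithinAt_fst hcomp).prodMk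
    ((hasDerivWithinAt_snd hcomp).const_smul k)).congr_deriv ?_
  simp only [geodesicField, spray_smul, Prod.smul_mk, smul_smul]

lemma IsGeodesic.hasDerivWithinAt_chart {s : Set ℝ} (hγ : IsGeodesic g γ s)
    (hs : UniqueDiffOn ℝ s) {t : ℝ} (ht : t ∈ s) (hx : γ t ∈ (extChartAt (𝓡 d) x₀).source) :
    HasDerivWithinAt (fun u => (extChartAt (𝓡 d) x₀ (γ u),
        derivWithin (fun u => extChartAt (𝓡 d) x₀ (γ u)) s u))
      (geodesicField (coordMetric g x₀) (extChartAt (𝓡 d) x₀ (γ t),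
        derivWithin (fun u => extChartAt (𝓡 d) x₀ (γ u)) s t)) s t := by
  have hx' : γ t ∈ (chartAt (Coord d) x₀).source := by rwa [extChartAt_source] at hx
  have hc : ContDiffWithinAt ℝ 2 (fun u => extChartAt (𝓡 d) x₀ (γ u)) s t :=
    ((contMDiffAt_extChartAt' (I := 𝓡 d) (n := 2) hx').comp_contMDiffWithinAt t
      (hγ.1 t ht)).contDiffWithinAt
  have hc' := hc.derivWithin (m := 1) hs (by norm_num) ht
  refine ((hc.differentiableWithinAt two_ne_zero).hasDerivWithinAt).prodMk
    ((hc'.differentiableWithinAt one_ne_zero).hasDerivWithinAt.congr_deriv ?_)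
  exact (isOrientedLorentzOn_coord g x₀).toIsLorentzMetricOn.eq_spray
    ((extChartAt (𝓡 d) x₀).map_source hx) (hγ.2 t ht x₀ hx')

lemma IsGeodesicGermIn.eventually_mem_closure (hα : IsGeodesicGermIn g L x₀ τ α)
    (hγ : IsGeodesic g γ (Ici a)) (hT : a ≤ T) (hx : γ T ∈ (extChartAt (𝓡 d) x₀).source)
    (hα0 : α 0 = (extChartAt (𝓡 d) x₀ (γ T), chartDeriv x₀ (γ T) (velocity γ (Ici a) T))) :
    ∀ᶠ t in 𝓝[>] T, γ t ∈ closure L := by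
  have hG := (isOrientedLorentzOn_coord g x₀).toIsLorentzMetricOn
  have hsource : ∀ᶠ t in 𝓝[≥] T, γ t ∈ (extChartAt (𝓡 d) x₀).source :=
    ((hγ.1.continuousOn T hT).mono (Ici_subset_Ici.2 hT)).eventually
      ((isOpen_extChartAt_source x₀).mem_nhds hx)
  obtain ⟨b, hb, hsub⟩ := mem_nhdsGE_iff_exists_Icc_subset.1
    (hsource.and (Icc_mem_nhdsGE (lt_add_of_pos_right T hα.pos)))
  set Ψ : ℝ → Coord d × Coord d := fun t => (extChartAt (𝓡 d) x₀ (γ t),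
    derivWithin (fun u => extChartAt (𝓡 d) x₀ (γ u)) (Ici a) t) with hΨ
  have hshift : MapsTo (fun t => t - T) (Icc T b) (Icc 0 τ) := fun t ht =>
    ⟨sub_nonneg.2 ht.1, sub_le_iff_le_add'.2 (hsub ht).2.2⟩
  have hinit : Ψ T = α (T - T) := by
    rw [sub_self, hα0, hΨ]
    exact congrArg _ ((Spacetimes.hasDerivWithinAt_chart
      (hγ.1.mdifferentiableOn two_ne_zero T hT) hx).derivWithin (uniqueDiffOn_Ici a T hT))
  obtain ⟨c, hc, heq⟩ := exists_eqOn_Icc_of_hasDerivWithinAt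
    (V := geodesicField (coordMetric g x₀)) (f := Ψ) (h := fun t => α (t - T))
    ((hG.contDiffOn_geodesicField.contDiffAt ((hG.isOpen.prod isOpen_univ).mem_nhds
      ⟨(extChartAt (𝓡 d) x₀).map_source hx, mem_univ _⟩)).of_le (mod_cast le_top)) hb
    (fun t ht => (hγ.hasDerivWithinAt_chart (uniqueDiffOn_Ici a) (hT.trans ht.1)
      (hsub ht).1).mono fun u hu => hT.trans hu.1)
    (fun t ht => ((hα.deriv _ (hshift ht)).scomp t
      ((hasDerivWithinAt_id t _).sub_const T) hshift).congr_deriv (one_smul ℝ _)) hinit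
  refine eventually_of_mem (Icc_mem_nhdsGT hc.1) fun t ht => ?_
  have htb : t ∈ Icc T b := Icc_subset_Icc_right hc.2 ht
  rw [← (extChartAt (𝓡 d) x₀).left_inv (hsub htb).1,
    show extChartAt (𝓡 d) x₀ (γ t) = (α (t - T)).1 from congrArg Prod.fst (heq ht)]
  exact hα.mem_closure _ (hshift htb)

lemma IsPastSet.exists_mem_of_corner (hL : IsPastSet g L)
    (hα : IsGeodesicGermIn g L (γ T) τ α) (haT : a < T)
    (hγ : MDifferentiableWithinAt 𝓘(ℝ, ℝ) (𝓡 d) γ (Ici a) T)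
    (hα0 : (α 0).1 = extChartAt (𝓡 d) (γ T) (γ T))
    (hsum : chartDeriv (γ T) (γ T) (velocity γ (Ici a) T) + (α 0).2 ∈
      timelikeCone (coordMetric g (γ T) (extChartAt (𝓡 d) (γ T) (γ T)))
        (coordFuture g (γ T) (extChartAt (𝓡 d) (γ T) (γ T)))) :
    ∃ t ∈ Ioo a T, γ t ∈ L := by
  have hmem : Ici a ∈ 𝓝 T := Ici_mem_nhds haT
  have hreverse : HasDerivWithinAt (fun s => extChartAt (𝓡 d) (γ T) (γ (T - s)))
      (-chartDeriv (γ T) (γ T) (velocity γ (Ici a) T)) (Ici 0) 0 := by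
    have hchart := (hasDerivWithinAt_chart hγ (mem_extChartAt_source (γ T))).hasDerivAt hmem
    exact (HasDerivAt.comp_const_sub T 0 (by rwa [sub_zero])).hasDerivWithinAt
  have hlim : Tendsto (fun s : ℝ => T - s) (𝓝[>] 0) (𝓝 T) :=
    ((continuous_const.sub continuous_id).tendsto' 0 T (sub_zero T)).mono_left nhdsWithin_le_nhds
  have hsource : ∀ᶠ s in 𝓝[>] 0, γ (T - s) ∈ (extChartAt (𝓡 d) (γ T)).source :=
    ((hγ.continuousWithinAt.continuousAt hmem).tendsto.comp hlim).eventually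
      (extChartAt_source_mem_nhds (γ T))
  have hpast := hL.eventually_mem_of_corner (mem_extChartAt_target (γ T)) hreverse
    hα.hasDerivWithinAt_fst (by rw [sub_zero]) hα0 (by rwa [sub_neg_eq_add, add_comm])
    (eventually_of_mem (Icc_mem_nhdsGT hα.pos) fun s hs => hα.mem_closure s hs)
  obtain ⟨s, hs, hsL, hs₀, hsT⟩ :=
    (hsource.and (hpast.and (Ioo_mem_nhdsGT (sub_pos.2 haT)))).exists
  exact ⟨T - s, ⟨by linarith, by linarith⟩, by rwa [(extChartAt (𝓡 d) (γ T)).left_inv hs] at hsL⟩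

lemma IsNullGeodesic.velocity_mem_futureCausal {s : Set ℝ} (hγ : IsNullGeodesic g γ s) {t : ℝ}
    (ht : t ∈ s) : velocity γ s t ∈ futureCausal g (γ t) :=
  (hγ.2 t ht).imp_left le_of_eq

lemma IsNullGeodesic.isC1CurveIn {s : Set ℝ} (hγ : IsNullGeodesic g γ s) {b : ℝ} (hab : a < b)
    (hs : Icc a b ⊆ s) : IsC1CurveIn (futureCausal g) γ a b := by
  refine ⟨(hγ.1.1.mono hs).of_le one_le_two, fun t ht => ?_⟩
  rw [velocity_eq_of_subset ((hγ.1.1.mdifferentiableOn two_ne_zero) t (hs ht)) hs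
    (uniqueDiffOn_Icc hab t ht)]
  exact hγ.velocity_mem_futureCausal (hs ht)

lemma IsNullGeodesic.notMem_of_isPastSet (hγ : IsNullGeodesic g γ (Ici a)) (hL : IsPastSet g L)
    (ha : γ a ∉ L) : ∀ t ∈ Ici a, γ t ∉ L := by
  intro t ht hmem
  rcases (mem_Ici.1 ht).eq_or_lt with rfl | hlt
  · exact ha hmem
  · exact ha ((hL.of_causal hlt.le (hγ.isC1CurveIn hlt Icc_subset_Ici_self)).1 hmem)

lemma horizon_eq_closure_diff (g : LorentzStructure d M) (W : Set M) :
    horizon g W = closure (pastOf g W) \ pastOf g W :=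
  (isPastSet_pastOf g W).isOpen.frontier_eq

variable [T2Space M]

theorem exists_null_germ (hW : IsFutureInfiniteWorldline g W) {p : M} (hp : p ∈ horizon g W) :
    ∃ v ∈ futureNull g p, ∃ τ α, IsGeodesicGermIn g (pastOf g W) p τ α ∧
      α 0 = (extChartAt (𝓡 d) p p, chartDeriv p p v) := by
  rw [horizon_eq_closure_diff] at hp
  obtain ⟨τ, α, hα, hα0, hcausal⟩ := exists_causal_germ hW hp.1
  have hsource := mem_extChartAt_source (I := 𝓡 d) p
  obtain ⟨v, hv⟩ := chartDeriv_surjective hsource (α 0).2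
  rw [← hv, chartDeriv_mem_causalCone_iff hsource] at hcausal
  have hnull : ¬ g.metric p v v < 0 := fun hneg => hp.2 <|
    (isPastSet_pastOf g W).mem_of_timelike_germ hα hα0 <|
      hv ▸ (chartDeriv_mem_timelikeCone_iff hsource).2 ⟨hneg, hcausal.2⟩
  exact ⟨v, ⟨hcausal.1.antisymm (not_lt.1 hnull), hcausal.2⟩, τ, α, hα, Prod.ext hα0 hv.symm⟩

lemma IsNullGeodesic.eventually_mem_closure_pastOf (hW : IsFutureInfiniteWorldline g W)
    (hγ : IsNullGeodesic g γ (Ici a)) (hnot : ∀ t ∈ Ici a, γ t ∉ pastOf g W) (haT : a < T)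
    (hT : γ T ∈ closure (pastOf g W)) : ∀ᶠ t in 𝓝[>] T, γ t ∈ closure (pastOf g W) := by
  have hsource := mem_extChartAt_source (I := 𝓡 d) (γ T)
  have htarget := mem_extChartAt_target (I := 𝓡 d) (γ T)
  have hG := isOrientedLorentzOn_coord g (γ T)
  obtain ⟨τ, α, hα, hα0, hcausal⟩ := exists_causal_germ hW hT
  by_cases hprop : ∃ k : ℝ, 0 < k ∧
      (α 0).2 = k • chartDeriv (d := d) (γ T) (γ T) (velocity γ (Ici a) T)
  · obtain ⟨k, hk, hαk⟩ := hprop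
    refine (hα.rescale (inv_pos.2 hk)).eventually_mem_closure hγ.1 haT.le hsource ?_
    simp only [mul_zero, hα0, hαk, inv_smul_smul₀ hk.ne']
  · push Not at hprop
    obtain ⟨t, ht, htL⟩ := (isPastSet_pastOf g W).exists_mem_of_corner hα haT
      (hγ.1.1.mdifferentiableOn two_ne_zero T haT.le) hα0
      ((hG.lorentz _ htarget).add_mem_timelikeCone (hG.future_timelike _ htarget)
        ((chartDeriv_mem_causalCone_iff hsource).2 (hγ.velocity_mem_futureCausal haT.le))
        hcausal hprop)
    exact absurd htL (hnot t ht.1.le)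

theorem hasFutureInfiniteNullGeodesic (hcomplete : FutureNullComplete g)
    (hW : IsFutureInfiniteWorldline g W) {p : M} (hp : p ∈ horizon g W) :
    HasFutureInfiniteNullGeodesic g (horizon g W) p := by
  obtain ⟨v, hv, τ, α, hα, hα0⟩ := exists_null_germ hW hp
  obtain ⟨γ, hγ, hinit⟩ := hcomplete p v hv
  have hγ0 : γ 0 = p := congrArg (fun z : TangentBundle (𝓡 d) M => z.1) hinit
  have hα0' : α 0 = (extChartAt (𝓡 d) p (γ 0), chartDeriv p (γ 0) (velocity γ (Ici 0) 0)) :=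
    hα0.trans (congrArg (fun z : TangentBundle (𝓡 d) M =>
      (extChartAt (𝓡 d) p z.1, chartDeriv (d := d) p z.1 z.2)) hinit).symm
  rw [horizon_eq_closure_diff] at hp ⊢
  have hnot : ∀ t ∈ Ici 0, γ t ∉ pastOf g W :=
    hγ.notMem_of_isPastSet (isPastSet_pastOf g W) (by rw [hγ0]; exact hp.2)
  have hclosure : ∀ t ∈ Ici 0, γ t ∈ closure (pastOf g W) := by
    intro t ht
    have hclosed : IsClosed (γ ⁻¹' closure (pastOf g W) ∩ Icc 0 t) := by
      rw [inter_comm]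
      exact (hγ.1.1.continuousOn.mono Icc_subset_Ici_self).preimage_isClosed_of_isClosed
        isClosed_Icc isClosed_closure
    refine hclosed.Icc_subset_of_forall_mem_nhdsWithin (by rw [mem_preimage, hγ0]; exact hp.1)
      (fun T hT => ?_) (right_mem_Icc.2 ht)
    rcases hT.2.1.eq_or_lt with rfl | hpos
    · exact hα.eventually_mem_closure hγ.1 le_rfl (by rw [hγ0]; exact mem_extChartAt_source p) hα0'
    · exact hγ.eventually_mem_closure_pastOf hW hnot hpos hT.1
  refine ⟨γ, Ici 0, ordConnected_Ici, not_bddAbove_Ici 0, hγ, ⟨0, self_mem_Ici, hγ0⟩, ?_⟩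
  rintro _ ⟨t, ht, rfl⟩
  exact ⟨hclosure t ht, hnot t ht⟩

end HorizonGeodesics

end Spacetimes

end

theorem mainTheorem6_general {d : ℕ} {M : Type*} [TopologicalSpace M]
    [ChartedSpace (Spacetimes.Coord d) M] [IsManifold (𝓡 d) ∞ M] [T2Space M]
    (g : Spacetimes.LorentzStructure d M) (hcomplete : Spacetimes.FutureNullComplete g) :
    (∀ W : Set M, Spacetimes.IsFutureInfiniteWorldline g W → ∀ p ∈ Spacetimes.horizon g W,
      Spacetimes.HasFutureInfiniteNullGeodesic g (Spacetimes.horizon g W) p) ∧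
    (∀ W a b : Set M, Spacetimes.IsGSLPair g W a b → Spacetimes.GeneratorCondition g W a b) ∧
    (∀ (R : Set (Set M)) (S : Set M → ℝ),
      Spacetimes.GSL g R S ↔ Spacetimes.SimplifiedGSL g R S) := by
  have hgenerator : ∀ W : Set M, Spacetimes.IsFutureInfiniteWorldline g W →
      ∀ p ∈ Spacetimes.horizon g W,
        Spacetimes.HasFutureInfiniteNullGeodesic g (Spacetimes.horizon g W) p :=
    fun W hW p hp => Spacetimes.hasFutureInfiniteNullGeodesic hcomplete hW hp
  have hcondition : ∀ W a b : Set M, Spacetimes.IsGSLPair g W a b →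
      Spacetimes.GeneratorCondition g W a b := by
    rintro W a b ⟨hW, -, ⟨-, -, hedge⟩, -, -⟩ p hp
    exact hgenerator W hW p (hedge hp.1)
  refine ⟨hgenerator, hcondition, fun R S => ⟨fun hgsl W a ha b hb hab => ?_,
    fun hsimplified W a ha b hb hab _ => ?_⟩⟩
  · exact hgsl W a ha b hb hab (hcondition W a b hab)
  · exact hsimplified W a ha b hb hab

theorem mainTheorem6 {d : ℕ} (hd : 2 ≤ d) {M : Type*} [TopologicalSpace M]
    [ChartedSpace (Spacetimes.Coord d) M] [IsManifold (𝓡 d) ∞ M] [T2Space M]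
    [SecondCountableTopology M] [ConnectedSpace M]
    (g : Spacetimes.LorentzStructure d M) (hstable : Spacetimes.StablyCausal g)
    (hcomplete : Spacetimes.FutureNullComplete g) :
    -- every point of a causal horizon lies on a future-infinite null geodesic in the horizon
    (∀ W : Set M, Spacetimes.IsFutureInfiniteWorldline g W → ∀ p ∈ Spacetimes.horizon g W,
      Spacetimes.HasFutureInfiniteNullGeodesic g (Spacetimes.horizon g W) p) ∧
    -- the final hypothesis of the GSL always holds
    (∀ W a b : Set M, Spacetimes.IsGSLPair g W a b → Spacetimes.GeneratorCondition g W a b) ∧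
    -- the GSL is equivalent to its restatement without that hypothesis
    (∀ (R : Set (Set M)) (S : Set M → ℝ),
      Spacetimes.GSL g R S ↔ Spacetimes.SimplifiedGSL g R S) :=
  mainTheorem6_general g hcomplete
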